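/- Let $(Z_H(t))_{(t,H)\in[0,\infty)\times(0,1)}$ be a fractional Gaussian field on a probability space $(\Omega,\mathcal F,\mathbb P)$, i.e. a centered Gaussian family of random variables with $$\mathbb E[Z_H(t)Z_{H'}(s)]=\frac{a_{H,H'}}{2}\left\{t^{H+H'}+s^{H+H'}-|t-s|^{H+H'}\right\},$$ where $a_{H,H'}=a_H:=\sqrt{\Gamma(2H+1)\Gamma(3-2H)}\,\sin^2(\pi H)$ if $H+H'=1$, and otherwise $$a_{H,H'}=-\tfrac{2}{\pi}\sqrt{\Gamma(2H+1)\sin(\pi H)}\sqrt{\Gamma(2H'+1)\sin(\pi H')}\;\Gamma(-(H+H'))\cos\left((H'-H)\tfrac{\pi}{2}\right)\cos\left((H+H')\tfrac{\pi}{2}\right).$$ Fix $H\in(0,1)$ and let $\mathcal F_t^H=\sigma(Z_H(r):0\le r\le t)$, $M_H(t)=\mathbb E[Z_{1-H}(t)\mid\mathcal F_t^H]$ and $$c_M=\frac{a_H^2\,\Gamma(3/2-H)}{2H\,\Gamma(H+1/2)\,\Gamma(3-2H)},\qquad c_\Psi=\frac{2H\,\Gamma(3-2H)\,\Gamma(H+1/2)}{a_H\,\Gamma(3/2-H)},\qquad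 \Psi_H(t)=c_\Psi t^{2H-1}.$$ The Dobrić–Ojeda process is $V_H(t)=\Psi_H(t)M_H(t)$, with $V_H(0)=0$ almost surely. Then there is a standard Brownian motion $(W_t)_{t\ge0}$ with almost surely continuous paths, adapted to $(\mathcal F_t^H)_{t\ge0}$ and with $W_t-W_s$ independent of $\mathcal F_s^H$ for $s\le t$, such that $V_H$ (in a suitable $(\mathcal F_t^H)$-adapted modification with almost surely continuous paths) is an Itô diffusion satisfying $$dV_H(t)=C\,t^{H-1/2}\,dW_t+(2H-1)\,t^{-1}V_H(t)\,dt,\qquad C=c_\Psi\sqrt{c_M(2-2H)},$$ that is, almost surely, $s\mapsto(2H-1)s^{-1}V_H(s)$ is integrable on $[0,t]$ for every $t\ge0$, and $$V_H(t)=V_H(0)+\int_0^t C s^{H-1/2}\,dW_s+\int_0^t(2H-1)s^{-1}V_H(s)\,ds\qquad\text{for all }t\ge0,$$ the first integral being an Itô integral. -/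

import Mathlib

open MeasureTheory ProbabilityTheory Filter Topology
open scoped NNReal ENNReal

namespace DobricOjeda

noncomputable section

/-! ### Brownian motion with respect to a filtration, Itô integral, Itô diffusions -/

/-- `W` is a standard Brownian motion relative to the filtration `F`: it is a standard Brownian
motion with almost surely continuous paths, it is adapted to `F`, and its increments after time
`s` are independent of `F s`. -/
structure IsBrownianMotionWrt {Ω : Type*} {mΩ : MeasurableSpace Ω} (F : Filtration ℝ≥0 mΩ)
    (W : ℝ≥0 → Ω → ℝ) (P : Measure Ω) : Prop where
  isBrownian : IsBrownianReal W P
  adapted : StronglyAdapted F W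
  indep_increment : ∀ s t : ℝ≥0, s ≤ t →
    Indep (MeasurableSpace.comap (fun ω => W t ω - W s ω) inferInstance) (F s) P

/-- A simple process `∑ i < n, ξ i · 1_{(t i, t (i+1)]}` with `t` nondecreasing and each `ξ i`
bounded and `F (t i)`-measurable. -/
structure SimpleProcess {Ω : Type*} {mΩ : MeasurableSpace Ω} (F : Filtration ℝ≥0 mΩ) where
  /-- the number of steps -/
  n : ℕ
  /-- the partition times -/
  time : ℕ → ℝ≥0
  /-- the value on `(time i, time (i+1)]` -/
  coef : ℕ → Ω → ℝ
  mono : Monotone time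
  measurable : ∀ i, StronglyMeasurable[F (time i)] (coef i)
  bounded : ∀ i, ∃ K : ℝ, ∀ ω, |coef i ω| ≤ K

/-- The value of a simple process at time `s`. -/
def SimpleProcess.eval {Ω : Type*} {mΩ : MeasurableSpace Ω} {F : Filtration ℝ≥0 mΩ}
    (φ : SimpleProcess F) (s : ℝ≥0) (ω : Ω) : ℝ :=
  ∑ i ∈ Finset.range φ.n,
    (Set.Ioc (φ.time i) (φ.time (i + 1))).indicator (fun _ => φ.coef i ω) s

/-- The elementary stochastic integral `∫₀ᵗ φ dW` of a simple process. -/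
def SimpleProcess.integral {Ω : Type*} {mΩ : MeasurableSpace Ω} {F : Filtration ℝ≥0 mΩ}
    (φ : SimpleProcess F) (W : ℝ≥0 → Ω → ℝ) (t : ℝ≥0) (ω : Ω) : ℝ :=
  ∑ i ∈ Finset.range φ.n,
    φ.coef i ω * (W (min (φ.time (i + 1)) t) ω - W (min (φ.time i) t) ω)

/-- `I` is (a version of) the Itô integral process `t ↦ ∫₀ᵗ φ dW`. The integrand `φ` is
progressively measurable and almost surely locally square integrable in time; `I` is adapted with
almost surely continuous paths, and there are simple processes `ψ k` with
`∫₀ᵗ |ψ k - φ|² ds → 0` and `∫₀ᵗ ψ k dW → I t` in probability, for every `t`. -/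
structure IsItoIntegral {Ω : Type*} {mΩ : MeasurableSpace Ω} (F : Filtration ℝ≥0 mΩ)
    (W : ℝ≥0 → Ω → ℝ) (φ I : ℝ≥0 → Ω → ℝ) (P : Measure Ω) : Prop where
  progressive : IsStronglyProgressive F φ
  sq_integrable : ∀ᵐ ω ∂P, ∀ t : ℝ≥0,
    ∫⁻ s in Set.Ioc (0 : ℝ) t, ‖φ s.toNNReal ω‖ₑ ^ 2 < ∞
  adapted : StronglyAdapted F I
  continuous : ∀ᵐ ω ∂P, Continuous (I · ω)
  approx : ∃ ψ : ℕ → SimpleProcess F, ∀ t : ℝ≥0,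
    (∀ ε : ℝ≥0∞, 0 < ε → Tendsto (fun k => P {ω | ε ≤
        ∫⁻ s in Set.Ioc (0 : ℝ) t, ‖(ψ k).eval s.toNNReal ω - φ s.toNNReal ω‖ₑ ^ 2})
      atTop (𝓝 0)) ∧
    TendstoInMeasure P (fun k => (ψ k).integral W t) atTop (I t)

/-- `X` is an Itô diffusion driven by `W` with drift coefficient `b` and diffusion coefficient
`σ`, i.e. `dX t = σ (t, X t) dW t + b (t, X t) dt`: the process `X` is adapted with almost surely
continuous paths, the drift is almost surely integrable on every `[0, t]`, and almost surely
`X t = X 0 + ∫₀ᵗ σ (s, X s) dW s + ∫₀ᵗ b (s, X s) ds` for all `t ≥ 0`. -/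
structure IsItoDiffusion {Ω : Type*} {mΩ : MeasurableSpace Ω} (F : Filtration ℝ≥0 mΩ)
    (W : ℝ≥0 → Ω → ℝ) (σ b : ℝ → ℝ → ℝ) (X : ℝ≥0 → Ω → ℝ) (P : Measure Ω) : Prop where
  adapted : StronglyAdapted F X
  continuous : ∀ᵐ ω ∂P, Continuous (X · ω)
  drift_integrable : ∀ᵐ ω ∂P, ∀ t : ℝ≥0,
    IntervalIntegrable (fun s : ℝ => b s (X s.toNNReal ω)) volume 0 t
  sde : ∃ I : ℝ≥0 → Ω → ℝ,
    IsItoIntegral F W (fun s ω => σ (s : ℝ) (X s ω)) I P ∧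
    ∀ᵐ ω ∂P, ∀ t : ℝ≥0,
      X t ω = X 0 ω + I t ω + ∫ s in (0 : ℝ)..t, b s (X s.toNNReal ω)

/-! ### The fractional Gaussian field and the Dobrić–Ojeda process -/

/-- The open interval `(0, 1)` of Hurst indices. -/
abbrev Hurst : Type := Set.Ioo (0 : ℝ) 1

/-- The conjugate index `H' = 1 - H`. -/
def Hurst.conj (H : Hurst) : Hurst :=
  ⟨1 - (H : ℝ), by linarith [H.2.2], by linarith [H.2.1]⟩

/-- The constant `a_H = √(Γ(2H+1) Γ(3-2H)) sin²(πH)`. -/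
def aConj (H : ℝ) : ℝ :=
  √(Real.Gamma (2 * H + 1) * Real.Gamma (3 - 2 * H)) * Real.sin (Real.pi * H) ^ 2

open Classical in
/-- The constant `a_{H,H'}` in the covariance of the fractional Gaussian field. -/
def aCov (H H' : ℝ) : ℝ :=
  if H + H' = 1 then aConj H
  else
    -(2 / Real.pi) * √(Real.Gamma (2 * H + 1) * Real.sin (Real.pi * H))
      * √(Real.Gamma (2 * H' + 1) * Real.sin (Real.pi * H'))
      * Real.Gamma (-(H + H')) * Real.cos ((H' - H) * (Real.pi / 2))
      * Real.cos ((H + H') * (Real.pi / 2))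

/-- `Z` is a fractional Gaussian field on `(0, 1) × [0, ∞)`: a centered Gaussian family with
`E[Z_H(t) Z_{H'}(s)] = (a_{H,H'} / 2) (t^{H+H'} + s^{H+H'} - |t - s|^{H+H'})`. -/
structure IsFractionalGaussianField {Ω : Type*} {mΩ : MeasurableSpace Ω}
    (Z : Hurst × ℝ≥0 → Ω → ℝ) (P : Measure Ω) : Prop where
  measurable : ∀ i, Measurable (Z i)
  gaussian : IsGaussianProcess Z P
  centered : ∀ i, ∫ ω, Z i ω ∂P = 0
  covariance : ∀ (H H' : Hurst) (t s : ℝ≥0),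
    ∫ ω, Z (H, t) ω * Z (H', s) ω ∂P =
      aCov H H' / 2 * ((t : ℝ) ^ ((H : ℝ) + H') + (s : ℝ) ^ ((H : ℝ) + H')
        - |(t : ℝ) - s| ^ ((H : ℝ) + H'))

/-- The filtration `F_t^H = σ(Z_H(r) : 0 ≤ r ≤ t)`. -/
def hurstFiltration {Ω : Type*} {mΩ : MeasurableSpace Ω} (Z : Hurst × ℝ≥0 → Ω → ℝ)
    (hZ : ∀ i, Measurable (Z i)) (H : Hurst) : Filtration ℝ≥0 mΩ :=
  Filtration.natural (fun t => Z (H, t)) (fun t => (hZ (H, t)).stronglyMeasurable)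

/-- `M_H(t) = E[Z_{1-H}(t) | F_t^H]`. -/
def doMartingale {Ω : Type*} {mΩ : MeasurableSpace Ω} (Z : Hurst × ℝ≥0 → Ω → ℝ)
    (hZ : ∀ i, Measurable (Z i)) (P : Measure Ω) (H : Hurst) (t : ℝ≥0) : Ω → ℝ :=
  P[Z (H.conj, t) | hurstFiltration Z hZ H t]

/-- `c_M = a_H² Γ(3/2-H) / (2H Γ(H+1/2) Γ(3-2H))`. -/
def cM (H : ℝ) : ℝ :=
  aConj H ^ 2 * Real.Gamma (3 / 2 - H)
    / (2 * H * Real.Gamma (H + 1 / 2) * Real.Gamma (3 - 2 * H))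

/-- `c_Ψ = 2H Γ(3-2H) Γ(H+1/2) / (a_H Γ(3/2-H))`. -/
def cPsi (H : ℝ) : ℝ :=
  2 * H * Real.Gamma (3 - 2 * H) * Real.Gamma (H + 1 / 2)
    / (aConj H * Real.Gamma (3 / 2 - H))

/-- `Ψ_H(t) = c_Ψ t^{2H-1}`. -/
def Psi (H : ℝ) (t : ℝ≥0) : ℝ := cPsi H * (t : ℝ) ^ (2 * H - 1)

/-- The Dobrić–Ojeda process `V_H(t) = Ψ_H(t) M_H(t)`; each `V_H(t)` is determined up to a null
set, as `M_H(t)` is a conditional expectation. -/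
def doProcess {Ω : Type*} {mΩ : MeasurableSpace Ω} (Z : Hurst × ℝ≥0 → Ω → ℝ)
    (hZ : ∀ i, Measurable (Z i)) (P : Measure Ω) (H : Hurst) (t : ℝ≥0) (ω : Ω) : ℝ :=
  Psi H t * doMartingale Z hZ P H t ω

/-- The constant `C = c_Ψ √(c_M (2 - 2H))`. -/
def diffusionConst (H : ℝ) : ℝ := cPsi H * √(cM H * (2 - 2 * H))

end

end DobricOjeda

open scoped RealInnerProductSpace

namespace DobricOjeda

/-! ### Beta integrals and an integral of Selberg type -/

/-! Everything happens in `L²`. There `Z_H` is a curve `z` with fractional Brownian covariance, and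
`Z_{1-H}` is a curve `z'` with `⟪z s, z' t⟫ = a_H s` for `s ≤ t`, because the two exponents add up
to 1. In a centered Gaussian space, projection on the closed span of the past is conditional
expectation and orthogonality is independence. Hence `M_H(t)` is the vector of the closed span of `z
r`, `r ≤ t`, whose pairing with each `z r` is `a_H r`. This vector is explicit: it is a multiple of
the Wiener integral of `(s (t - s))^(1/2 - H)` against `z` over `[0, t]`. That its pairing with `z
r` is linear in `r` rests on `integral_mul_signed_rpow`, which comes from a first-order equation
with a right-hand side symmetric under `r ↦ 1 - r`. Pairing it with `z'` is a Beta integral, and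
`exists_fundamental_martingale` concludes that `⟪M s, M t⟫ = c_M min(s, t)^(2-2H)`. So `M` has
orthogonal increments with variance density `c_M (2-2H) s^(1-2H)`. Dividing out the square root of
this density, `W t = (c_M (2-2H))^(-1/2) ∫₀ᵗ s^(H-1/2) dM s` has covariance `min(s, t)`, and its
increments are orthogonal to the past. The product rule applied to `V t = c_Ψ t^(2H-1) M t` gives
`dV = c_Ψ t^(2H-1) dM + (2H-1) t⁻¹ V dt`, and the first term is `C t^(H-1/2) dW`. All integrands are
deterministic, so no Itô formula is needed: integration by parts (`wienerPow`) defines the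
integrals, and covariances identify them. The way back from `L²` to paths uses Kolmogorov's theorem
(`exists_continuous_modification`), the agreement of pathwise and `L²` integrals
(`integral_ae_eq_of_integrable_Lp`), exactly adapted versions (`exists_adapted_of_ae_eq`) and the
isometry for step functions (`isItoIntegral_of_inner`). -/

theorem intervalIntegrable_rpow_mul_one_sub_rpow {a b : ℝ} (ha : -1 < a) (hb : -1 < b) :
    IntervalIntegrable (fun x : ℝ => x ^ a * (1 - x) ^ b) volume 0 1 := by
  have h := Complex.betaIntegral_convergent (u := ((a + 1 : ℝ) : ℂ)) (v := ((b + 1 : ℝ) : ℂ))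
    (by rw [Complex.ofReal_re]; linarith) (by rw [Complex.ofReal_re]; linarith)
  rw [intervalIntegrable_iff_integrableOn_Ioc_of_le zero_le_one] at h ⊢
  refine (integrableOn_congr_fun ?_ measurableSet_Ioc).mp (Integrable.re h)
  intro x hx
  have h1 : (0 : ℝ) ≤ 1 - x := by linarith [hx.2]
  have e : (x : ℂ) ^ (((a + 1 : ℝ) : ℂ) - 1) * (1 - (x : ℂ)) ^ (((b + 1 : ℝ) : ℂ) - 1)
      = ((x ^ a * (1 - x) ^ b : ℝ) : ℂ) := by
    rw [Complex.ofReal_mul, Complex.ofReal_cpow hx.1.le, Complex.ofReal_cpow h1]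
    push_cast
    ring_nf
  simp only [e, RCLike.re_to_complex, Complex.ofReal_re]

theorem integral_rpow_mul_one_sub_rpow {a b : ℝ} (ha : -1 < a) (hb : -1 < b) :
    ∫ x in (0 : ℝ)..1, x ^ a * (1 - x) ^ b
      = Real.Gamma (a + 1) * Real.Gamma (b + 1) / Real.Gamma (a + b + 2) := by
  have h := beta_eq_betaIntegralReal (a + 1) (b + 1) (by linarith) (by linarith)
  rw [beta, show a + 1 + (b + 1) = a + b + 2 by ring] at h
  rw [h, Complex.betaIntegral]
  have : ∫ x in (0 : ℝ)..1, (x : ℂ) ^ (((a + 1 : ℝ) : ℂ) - 1)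
      * (1 - (x : ℂ)) ^ (((b + 1 : ℝ) : ℂ) - 1)
      = ∫ x in (0 : ℝ)..1, ((x ^ a * (1 - x) ^ b : ℝ) : ℂ) := by
    refine intervalIntegral.integral_congr fun x hx => ?_
    rw [Set.uIcc_of_le zero_le_one] at hx
    have h1 : (0 : ℝ) ≤ 1 - x := by linarith [hx.2]
    rw [Complex.ofReal_mul, Complex.ofReal_cpow hx.1, Complex.ofReal_cpow h1]
    push_cast
    ring_nf
  rw [this, intervalIntegral.integral_ofReal, Complex.ofReal_re]

/-- The fractional integral `∫₀ʳ (s (1 - s))^p (r - s)^(-2p) ds`. -/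
noncomputable def fracBeta (p r : ℝ) : ℝ :=
  ∫ s in (0 : ℝ)..r, (s * (1 - s)) ^ p * (r - s) ^ (-2 * p)

/-- The substitution `s = r v` fixes the interval, so that continuity in `r` becomes a matter of
dominated convergence. -/
theorem fracBeta_eq_scaled {p r : ℝ} (hp : p < 1 / 2) (h0 : 0 ≤ r) (h1 : r ≤ 1) :
    fracBeta p r = r ^ (1 - p) *
      ∫ v in (0 : ℝ)..1, v ^ p * (1 - v) ^ (-2 * p) * (1 - r * v) ^ p := by
  rcases h0.eq_or_lt with rfl | h0
  · simp [fracBeta, Real.zero_rpow (show 1 - p ≠ 0 by linarith)]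
  have h := intervalIntegral.integral_comp_mul_left (a := 0) (b := 1)
    (fun s => (s * (1 - s)) ^ p * (r - s) ^ (-2 * p)) h0.ne'
  rw [mul_zero, mul_one] at h
  have h' : fracBeta p r = r * ∫ v in (0 : ℝ)..1,
      ((r * v) * (1 - r * v)) ^ p * (r - r * v) ^ (-2 * p) := by
    rw [h, smul_eq_mul, ← mul_assoc, mul_inv_cancel₀ h0.ne', one_mul, fracBeta]
  rw [h', ← intervalIntegral.integral_const_mul, ← intervalIntegral.integral_const_mul]
  refine intervalIntegral.integral_congr fun v hv => ?_
  rw [Set.uIcc_of_le zero_le_one] at hv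
  have hv1 : 0 ≤ 1 - v := by linarith [hv.2]
  have hrv : 0 ≤ 1 - r * v := by nlinarith [hv.1, hv.2]
  rw [show r - r * v = r * (1 - v) by ring, Real.mul_rpow (mul_nonneg h0.le hv.1) hrv,
    Real.mul_rpow h0.le hv.1, Real.mul_rpow h0.le hv1]
  have : r ^ (1 - p) = r * r ^ p * r ^ (-2 * p) := by
    rw [mul_comm r, ← Real.rpow_add_one h0.ne', ← Real.rpow_add h0]
    ring_nf
  rw [this]
  ring

/-- `1 - r v` lies between `1 - v` and `1`, so one of the two ends dominates its power, whatever the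
sign of `p`. The bound is uniform in `r`. -/
theorem one_sub_mul_rpow_le {p r v : ℝ} (h0 : 0 ≤ r) (h1 : r ≤ 1) (hv0 : 0 ≤ v) (hv1 : v < 1) :
    (1 - r * v) ^ p ≤ 1 + (1 - v) ^ p := by
  have hle : 1 - v ≤ 1 - r * v := by nlinarith
  have hle1 : 1 - r * v ≤ 1 := by nlinarith
  rcases le_total 0 p with hp | hp
  · have := Real.rpow_le_one (by linarith) hle1 hp
    have := Real.rpow_nonneg (show 0 ≤ 1 - v by linarith) p
    linarith
  · have := Real.rpow_le_rpow_of_nonpos (show 0 < 1 - v by linarith) hle hp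
    linarith

/-- Continuity up to `r = 1` is what later allows a constant of integration to be read off at that
endpoint. -/
theorem continuousOn_fracBeta {p : ℝ} (hp : -(1 / 2) < p) (hp' : p < 1 / 2) :
    ContinuousOn (fracBeta p) (Set.Icc 0 1) := by
  have key : ContinuousOn (fun r => r ^ (1 - p) *
      ∫ v in (0 : ℝ)..1, v ^ p * (1 - v) ^ (-2 * p) * (1 - r * v) ^ p) (Set.Icc 0 1) := by
    refine ContinuousOn.mul (fun r _ => (Real.continuousAt_rpow_const r _
      (Or.inr (by linarith))).continuousWithinAt) fun r hr => ?_
    refine intervalIntegral.continuousWithinAt_of_dominated_interval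
      (bound := fun v => v ^ p * (1 - v) ^ (-2 * p) + v ^ p * (1 - v) ^ (-p)) ?_ ?_ ?_ ?_
    · exact Eventually.of_forall fun r => (by fun_prop : Measurable _).aestronglyMeasurable
    · filter_upwards [self_mem_nhdsWithin] with r hr
      have : ∀ᵐ v : ℝ, v ≠ 1 := by simp [ae_iff]
      filter_upwards [this] with v hv1 hv
      rw [Set.uIoc_of_le zero_le_one] at hv
      have hv2 : v < 1 := lt_of_le_of_ne hv.2 hv1
      have hm : 0 ≤ v ^ p * (1 - v) ^ (-2 * p) :=
        mul_nonneg (Real.rpow_nonneg hv.1.le _) (Real.rpow_nonneg (by linarith) _)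
      rw [Real.norm_of_nonneg (mul_nonneg hm (Real.rpow_nonneg (by nlinarith [hr.1, hr.2, hv.1]) _))]
      refine (mul_le_mul_of_nonneg_left
        (one_sub_mul_rpow_le hr.1 hr.2 hv.1.le hv2) hm).trans_eq ?_
      rw [mul_add, mul_one, mul_assoc, ← Real.rpow_add (by linarith)]
      ring_nf
    · exact (intervalIntegrable_rpow_mul_one_sub_rpow (by linarith) (by linarith)).add
        (intervalIntegrable_rpow_mul_one_sub_rpow (by linarith) (by linarith))
    · have : ∀ᵐ v : ℝ, v ≠ 1 := by simp [ae_iff]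
      filter_upwards [this] with v hv1 hv
      rw [Set.uIoc_of_le zero_le_one] at hv
      have hv2 : v < 1 := lt_of_le_of_ne hv.2 hv1
      have hne : 1 - r * v ≠ 0 := by nlinarith [hr.1, hr.2, hv.1]
      exact (continuousAt_const.mul ((by fun_prop : ContinuousAt (fun r : ℝ => 1 - r * v) r).rpow_const
        (Or.inl hne))).continuousWithinAt
  exact key.congr fun r hr => fracBeta_eq_scaled hp' hr.1 hr.2

theorem fracBeta_zero (p : ℝ) : fracBeta p 0 = 0 := by simp [fracBeta]

theorem fracBeta_one {p : ℝ} (hp : -(1 / 2) < p) (hp' : p < 1 / 2) :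
    fracBeta p 1 = Real.Gamma (1 + p) * Real.Gamma (1 - p) := by
  have h := integral_rpow_mul_one_sub_rpow (a := p) (b := -p) (by linarith) (by linarith)
  rw [show p + -p + 2 = 2 by ring, Real.Gamma_two, div_one] at h
  rw [add_comm 1 p, show 1 - p = -p + 1 by ring, ← h, fracBeta]
  refine intervalIntegral.integral_congr_ae ?_
  have : ∀ᵐ v : ℝ, v ≠ 1 := by simp [ae_iff]
  filter_upwards [this] with v hv1 hv
  rw [Set.uIoc_of_le zero_le_one] at hv
  have hv2 : 0 < 1 - v := sub_pos.2 (lt_of_le_of_ne hv.2 hv1)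
  rw [Real.mul_rpow hv.1.le hv2.le, mul_assoc, ← Real.rpow_add hv2]
  ring_nf

/-- The rational-kernel integral `∫₀¹ u^p (1 - u)^(-2p) (1 - r (1 - u))^(-2) du`. -/
noncomputable def fracKernel (p r : ℝ) : ℝ :=
  ∫ u in (0 : ℝ)..1, u ^ p * (1 - u) ^ (-2 * p) * ((1 - r * (1 - u)) ^ 2)⁻¹

/-- The derivative of `fracKernel p`. -/
noncomputable def fracKernelDeriv (p r : ℝ) : ℝ :=
  ∫ u in (0 : ℝ)..1, u ^ p * (1 - u) ^ (-2 * p) * (2 * (1 - u) * ((1 - r * (1 - u)) ^ 3)⁻¹)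

/-- The Möbius substitution `s = r u / (1 - r (1 - u))` carries `[0, 1]` onto `[0, r]`. The
fractional powers of the denominator cancel, so inside the integral `r` survives only in a rational
factor, which can be differentiated. -/
theorem fracBeta_eq_fracKernel {p r : ℝ} (h0 : 0 < r) (h1 : r < 1) :
    fracBeta p r = (r * (1 - r)) ^ (1 - p) * fracKernel p r := by
  have hq : 0 < 1 - r := by linarith
  have hd : ∀ u ∈ Set.Icc (0 : ℝ) 1, 0 < 1 - r * (1 - u) := fun u hu => by nlinarith [hu.1, hu.2]
  have hder : ∀ u ∈ Set.Icc (0 : ℝ) 1, HasDerivAt (fun u => r * u / (1 - r * (1 - u)))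
      (r * (1 - r) / (1 - r * (1 - u)) ^ 2) u := fun u hu => by
    have hd1 : HasDerivAt (fun u : ℝ => 1 - r * (1 - u)) r u := by
      simpa using (((hasDerivAt_id u).const_sub 1).const_mul r).const_sub 1
    have hn1 : HasDerivAt (fun u : ℝ => r * u) r u := by
      simpa using (hasDerivAt_id u).const_mul r
    refine (hn1.div hd1 (hd u hu).ne').congr_deriv ?_
    congr 1
    ring
  have h := intervalIntegral.integral_comp_mul_deriv_of_deriv_nonneg (a := 0) (b := 1)
    (f := fun u => r * u / (1 - r * (1 - u))) (f' := fun u => r * (1 - r) / (1 - r * (1 - u)) ^ 2)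
    (g := fun s => (s * (1 - s)) ^ p * (r - s) ^ (-2 * p))
    (fun u hu => by
      rw [Set.uIcc_of_le zero_le_one] at hu
      exact (hder u hu).continuousAt.continuousWithinAt)
    (fun u hu => by
      rw [min_eq_left zero_le_one, max_eq_right zero_le_one] at hu
      exact hder u ⟨hu.1.le, hu.2.le⟩)
    (fun u _ => by positivity)
  simp only [mul_zero, zero_div, mul_one, sub_self, sub_zero, div_one, Function.comp_def] at h
  rw [fracBeta, ← h, fracKernel, ← intervalIntegral.integral_const_mul]
  refine intervalIntegral.integral_congr fun u hu => ?_
  rw [Set.uIcc_of_le zero_le_one] at hu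
  have hd0 := hd u hu
  have hu1 : 0 ≤ 1 - u := by linarith [hu.2]
  set d := 1 - r * (1 - u) with hdd
  have e1 : r * u / d * (1 - r * u / d) = (r * (1 - r)) * u * (d⁻¹) ^ 2 := by
    field_simp
    rw [hdd]; ring
  have e2 : r - r * u / d = (r * (1 - r)) * (1 - u) * d⁻¹ := by
    field_simp
    rw [hdd]; ring
  have hrq : 0 < r * (1 - r) := by positivity
  have hdi : 0 < d⁻¹ := by positivity
  rw [e1, e2, Real.mul_rpow (mul_nonneg hrq.le hu.1) (by positivity), Real.mul_rpow hrq.le hu.1,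
    Real.mul_rpow (mul_nonneg hrq.le hu1) hdi.le, Real.mul_rpow hrq.le hu1,
    ← Real.rpow_natCast d⁻¹ 2, ← Real.rpow_mul hdi.le]
  have e3 : (d⁻¹ : ℝ) ^ (((2 : ℕ) : ℝ) * p) * d⁻¹ ^ (-2 * p) = 1 := by
    rw [← Real.rpow_add hdi]; push_cast; ring_nf; exact Real.rpow_zero _
  have e4 : (r * (1 - r)) ^ (1 - p) = (r * (1 - r)) ^ p * (r * (1 - r)) ^ (-2 * p) * (r * (1 - r)) := by
    rw [← Real.rpow_add hrq, ← Real.rpow_add_one hrq.ne']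
    ring_nf
  rw [e4, div_eq_mul_inv]
  calc _ = (d⁻¹ ^ (((2 : ℕ) : ℝ) * p) * d⁻¹ ^ (-2 * p)) * ((r * (1 - r)) ^ p *
        (r * (1 - r)) ^ (-2 * p) * (r * (1 - r)) * (u ^ p * (1 - u) ^ (-2 * p) * (d ^ 2)⁻¹)) := by
        ring
    _ = _ := by rw [e3, one_mul]

theorem one_sub_mul_pos {r u : ℝ} (h0 : 0 < r) (h1 : r < 1) (hu : u ∈ Set.Icc (0 : ℝ) 1) :
    0 < 1 - r * (1 - u) := by nlinarith [hu.1, hu.2]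

theorem hasDerivAt_fracKernel {p r : ℝ} (hp : -(1 / 2) < p) (hp' : p < 1 / 2)
    (h0 : 0 < r) (h1 : r < 1) :
    IntervalIntegrable (fun u : ℝ => u ^ p * (1 - u) ^ (-2 * p) *
      (2 * (1 - u) * ((1 - r * (1 - u)) ^ 3)⁻¹)) volume 0 1 ∧
    HasDerivAt (fracKernel p) (fracKernelDeriv p r) r := by
  have hm := intervalIntegrable_rpow_mul_one_sub_rpow (a := p) (b := -2 * p) (by linarith)
    (by linarith)
  -- Below the midpoint of `r` and `1` the denominators are bounded away from zero uniformly in `u`,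
  -- since `1 - x (1 - u) ≥ 1 - x`.
  have hd : ∀ x ∈ Set.Ioo 0 ((1 + r) / 2), ∀ u ∈ Set.Ioc (0 : ℝ) 1,
      (1 - r) / 2 ≤ 1 - x * (1 - u) := fun x hx u hu => by nlinarith [hu.1, hu.2, hx.1, hx.2]
  refine intervalIntegral.hasDerivAt_integral_of_dominated_loc_of_deriv_le
    (F := fun x u => u ^ p * (1 - u) ^ (-2 * p) * ((1 - x * (1 - u)) ^ 2)⁻¹)
    (F' := fun x u => u ^ p * (1 - u) ^ (-2 * p) * (2 * (1 - u) * ((1 - x * (1 - u)) ^ 3)⁻¹))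
    (s := Set.Ioo 0 ((1 + r) / 2))
    (bound := fun u => u ^ p * (1 - u) ^ (-2 * p) * (2 * (((1 - r) / 2) ^ 3)⁻¹))
    (Ioo_mem_nhds h0 (by linarith)) ?_ ?_ ?_ ?_ ?_ ?_
  · exact Eventually.of_forall fun x => (by fun_prop : Measurable _).aestronglyMeasurable
  · refine hm.mul_continuousOn ?_
    rw [Set.uIcc_of_le zero_le_one]
    exact ContinuousOn.inv₀ (by fun_prop)
      fun u hu => pow_ne_zero 2 (one_sub_mul_pos h0 h1 hu).ne'
  · exact (by fun_prop : Measurable _).aestronglyMeasurable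
  · refine Eventually.of_forall fun u hu x hx => ?_
    rw [Set.uIoc_of_le zero_le_one] at hu
    have h2 := hd x hx u hu
    have h3 : 0 < (1 - r) / 2 := by linarith
    have h4 : 0 ≤ 1 - u := by linarith [hu.2]
    have h5 : 0 ≤ u ^ p * (1 - u) ^ (-2 * p) :=
      mul_nonneg (Real.rpow_nonneg hu.1.le _) (Real.rpow_nonneg h4 _)
    have h6 : 0 < 1 - x * (1 - u) := h3.trans_le h2
    rw [Real.norm_of_nonneg (by positivity)]
    have h7 : ((1 - x * (1 - u)) ^ 3)⁻¹ ≤ (((1 - r) / 2) ^ 3)⁻¹ := by gcongr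
    have h8 : 2 * (1 - u) * ((1 - x * (1 - u)) ^ 3)⁻¹ ≤ 2 * (((1 - r) / 2) ^ 3)⁻¹ := by
      refine mul_le_mul (by linarith [hu.1]) h7 (by positivity) (by norm_num)
    exact mul_le_mul_of_nonneg_left h8 h5
  · exact hm.mul_const _
  · refine Eventually.of_forall fun u hu x hx => ?_
    rw [Set.uIoc_of_le zero_le_one] at hu
    have h6 : 0 < 1 - x * (1 - u) := lt_of_lt_of_le (by linarith) (hd x hx u hu)
    have e1 : HasDerivAt (fun x : ℝ => 1 - x * (1 - u)) (-(1 - u)) x := by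
      simpa using ((hasDerivAt_id x).mul_const (1 - u)).const_sub 1
    refine (((e1.pow 2).inv (pow_ne_zero 2 h6.ne')).const_mul _).congr_deriv ?_
    simp only [Pi.pow_apply]
    generalize 1 - x * (1 - u) = d at h6 ⊢
    have := h6.ne'
    push_cast
    field_simp

/-- The combination of `fracKernel` and its derivative that is constant in `r`. -/
theorem fracKernel_ode {p r : ℝ} (hp : -(1 / 2) < p) (hp' : p < 1 / 2)
    (h0 : 0 < r) (h1 : r < 1) :
    (1 - 2 * r) * ((1 - p) * (1 - 2 * r) * fracKernel p r + r * (1 - r) * fracKernelDeriv p r)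
      + 2 * (r * (1 - r)) * fracKernel p r
      = (1 - p) * ∫ u in (0 : ℝ)..1, u ^ p * (1 - u) ^ (-2 * p) := by
  have hm := intervalIntegrable_rpow_mul_one_sub_rpow (a := p) (b := -2 * p) (by linarith)
    (by linarith)
  have hK : IntervalIntegrable (fun u : ℝ => u ^ p * (1 - u) ^ (-2 * p) *
      ((1 - r * (1 - u)) ^ 2)⁻¹) volume 0 1 := by
    refine hm.mul_continuousOn ?_
    rw [Set.uIcc_of_le zero_le_one]
    exact ContinuousOn.inv₀ (by fun_prop)
      fun u hu => pow_ne_zero 2 (one_sub_mul_pos h0 h1 hu).ne'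
  have hK' := (hasDerivAt_fracKernel hp hp' h0 h1).1
  set D : ℝ → ℝ := fun u =>
    (1 - 2 * r) * ((1 - p) * (1 - 2 * r) * (u ^ p * (1 - u) ^ (-2 * p) *
      ((1 - r * (1 - u)) ^ 2)⁻¹) + r * (1 - r) * (u ^ p * (1 - u) ^ (-2 * p) *
      (2 * (1 - u) * ((1 - r * (1 - u)) ^ 3)⁻¹)))
      + 2 * (r * (1 - r)) * (u ^ p * (1 - u) ^ (-2 * p) * ((1 - r * (1 - u)) ^ 2)⁻¹)
      - (1 - p) * (u ^ p * (1 - u) ^ (-2 * p)) with hD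
  have hDint : IntervalIntegrable D volume 0 1 :=
    ((((hK.const_mul _).add (hK'.const_mul _)).const_mul _).add (hK.const_mul _)).sub
      (hm.const_mul _)
  have hDval : ∫ u in (0 : ℝ)..1, D u =
      (1 - 2 * r) * ((1 - p) * (1 - 2 * r) * fracKernel p r + r * (1 - r) * fracKernelDeriv p r)
      + 2 * (r * (1 - r)) * fracKernel p r
      - (1 - p) * ∫ u in (0 : ℝ)..1, u ^ p * (1 - u) ^ (-2 * p) := by
    rw [hD, intervalIntegral.integral_sub ((((hK.const_mul _).add (hK'.const_mul _)).const_mul _).add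
      (hK.const_mul _)) (hm.const_mul _), intervalIntegral.integral_add
      (((hK.const_mul _).add (hK'.const_mul _)).const_mul _) (hK.const_mul _),
      intervalIntegral.integral_const_mul, intervalIntegral.integral_add (hK.const_mul _)
      (hK'.const_mul _)]
    simp only [intervalIntegral.integral_const_mul, fracKernel, fracKernelDeriv]
  rw [← sub_eq_zero, ← hDval]
  -- `Q` is an explicit primitive of `D`. It vanishes at both ends because the exponents `p + 1` and
  -- `1 - 2p` are positive.
  set Q : ℝ → ℝ := fun u => r * (u ^ (p + 1) * (1 - u) ^ (1 - 2 * p) *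
    ((1 - 2 * r) * ((1 - r * (1 - u)) ^ 2)⁻¹ + (1 - r * (1 - u))⁻¹)) with hQ
  have hcont : ContinuousOn Q (Set.Icc 0 1) := by
    refine continuousOn_const.mul (ContinuousOn.mul (ContinuousOn.mul ?_ ?_) ?_)
    · exact continuousOn_id.rpow_const fun _ _ => Or.inr (by linarith)
    · exact (by fun_prop : ContinuousOn (fun u : ℝ => 1 - u) _).rpow_const
        fun _ _ => Or.inr (by linarith)
    · exact (continuousOn_const.mul (ContinuousOn.inv₀ (by fun_prop)
        fun u hu => pow_ne_zero 2 (one_sub_mul_pos h0 h1 hu).ne')).add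
        (ContinuousOn.inv₀ (by fun_prop) fun u hu => (one_sub_mul_pos h0 h1 hu).ne')
  have hder : ∀ u ∈ Set.Ioo (0 : ℝ) 1, HasDerivAt Q (D u) u := fun u hu => by
    have hu1 : 0 < 1 - u := by linarith [hu.2]
    have hd0 := one_sub_mul_pos h0 h1 ⟨hu.1.le, hu.2.le⟩
    have d1 : HasDerivAt (fun u : ℝ => 1 - r * (1 - u)) r u := by
      simpa using (((hasDerivAt_id u).const_sub 1).const_mul r).const_sub 1
    have d2 : HasDerivAt (fun u : ℝ => u ^ (p + 1)) ((p + 1) * u ^ p) u := by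
      simpa using Real.hasDerivAt_rpow_const (p := p + 1) (Or.inl hu.1.ne')
    have d3 : HasDerivAt (fun u : ℝ => (1 - u) ^ (1 - 2 * p))
        (-(1 - 2 * p) * (1 - u) ^ (-2 * p)) u := by
      have := ((hasDerivAt_id u).const_sub 1).rpow_const (p := 1 - 2 * p) (Or.inl hu1.ne')
      refine this.congr_deriv ?_
      simp only [id]
      rw [show 1 - 2 * p - 1 = -2 * p by ring]
      ring
    refine (((d2.mul d3).mul (((d1.pow 2).inv (pow_ne_zero 2 hd0.ne')).const_mul
      (1 - 2 * r) |>.add (d1.inv hd0.ne'))).const_mul r).congr_deriv ?_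
    have e1 : u ^ (p + 1) = u ^ p * u := Real.rpow_add_one hu.1.ne' p
    have e2 : (1 - u) ^ (1 - 2 * p) = (1 - u) ^ (-2 * p) * (1 - u) := by
      rw [← Real.rpow_add_one hu1.ne']; ring_nf
    simp only [hD, e1, e2, Pi.add_apply, Pi.mul_apply, Pi.pow_apply, Pi.inv_apply]
    generalize u ^ p = x
    generalize (1 - u) ^ (-2 * p) = y
    field_simp
    ring
  rw [intervalIntegral.integral_eq_sub_of_hasDerivAt_of_le zero_le_one hcont hder hDint]
  simp [hQ, Real.zero_rpow (show p + 1 ≠ 0 by linarith), Real.zero_rpow (show 1 - 2 * p ≠ 0 by linarith)]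

/-- What matters is that the right-hand side is invariant under `r ↦ 1 - r`; the value of `c` is
never needed. -/
theorem exists_hasDerivAt_fracBeta {p : ℝ} (hp : -(1 / 2) < p) (hp' : p < 1 / 2) :
    ∃ (f' : ℝ → ℝ) (c : ℝ), ∀ r ∈ Set.Ioo (0 : ℝ) 1, HasDerivAt (fracBeta p) (f' r) r ∧
      (1 - 2 * r) * f' r + 2 * fracBeta p r = c * (r * (1 - r)) ^ (-p) := by
  refine ⟨fun r => (1 - p) * (r * (1 - r)) ^ (-p) * (1 - 2 * r) * fracKernel p r +
    (r * (1 - r)) ^ (1 - p) * fracKernelDeriv p r,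
    (1 - p) * ∫ u in (0 : ℝ)..1, u ^ p * (1 - u) ^ (-2 * p), fun r hr => ?_⟩
  have hq : 0 < r * (1 - r) := mul_pos hr.1 (by linarith [hr.2])
  have e1 : (r * (1 - r)) ^ (1 - p) = (r * (1 - r)) ^ (-p) * (r * (1 - r)) := by
    rw [← Real.rpow_add_one hq.ne']; ring_nf
  constructor
  · have h1 : HasDerivAt (fun r : ℝ => r * (1 - r)) (1 - 2 * r) r := by
      refine ((hasDerivAt_id r).mul ((hasDerivAt_id r).const_sub 1)).congr_deriv ?_
      simp only [id]
      ring
    have h2 := (h1.rpow_const (p := 1 - p) (Or.inl hq.ne')).mul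
      (hasDerivAt_fracKernel hp hp' hr.1 hr.2).2
    refine (h2.congr_of_eventuallyEq ?_).congr_deriv ?_
    · filter_upwards [Ioo_mem_nhds hr.1 hr.2] with x hx
      exact fracBeta_eq_fracKernel hx.1 hx.2
    · rw [show 1 - p - 1 = -p by ring]
      ring
  · beta_reduce
    rw [← fracKernel_ode hp hp' hr.1 hr.2, fracBeta_eq_fracKernel hr.1 hr.2, e1]
    ring

/-- Subtracting the equations at `r` and at `1 - r` cancels their right-hand sides, so the
difference `T` solves `(1 - 2r) T' + 2 T = 0`. Hence `T / (2r - 1)` is constant to the right of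
`1/2`, where the denominator does not vanish, and it is evaluated at `1`. -/
theorem fracBeta_sub_fracBeta_one_sub_of_half_lt {p r : ℝ} (hp : -(1 / 2) < p) (hp' : p < 1 / 2)
    (hr : 1 / 2 < r) (hr1 : r ≤ 1) :
    fracBeta p r - fracBeta p (1 - r) = fracBeta p 1 * (2 * r - 1) := by
  obtain ⟨f', c, hf⟩ := exists_hasDerivAt_fracBeta hp hp'
  set T : ℝ → ℝ := fun r => fracBeta p r - fracBeta p (1 - r) with hT
  have hcont : ContinuousOn T (Set.Icc 0 1) := (continuousOn_fracBeta hp hp').sub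
    ((continuousOn_fracBeta hp hp').comp (by fun_prop)
      fun x hx => ⟨by linarith [hx.2], by linarith [hx.1]⟩)
  have hne : ∀ x ∈ Set.Icc r 1, 2 * x - 1 ≠ 0 := fun x hx => by linarith [hx.1]
  have hder : ∀ x ∈ Set.Ioo (1 / 2 : ℝ) 1, HasDerivAt (fun x => T x / (2 * x - 1)) 0 x := by
    intro x hx
    obtain ⟨h1, h2⟩ := hf x ⟨by linarith [hx.1], hx.2⟩
    obtain ⟨h3, h4⟩ := hf (1 - x) ⟨by linarith [hx.2], by linarith [hx.1]⟩
    have h5 : HasDerivAt (fun x => fracBeta p (1 - x)) (-f' (1 - x)) x := by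
      have := h3.scomp x ((hasDerivAt_id x).const_sub 1)
      simpa [Function.comp_def] using this
    have h6 : HasDerivAt (fun x : ℝ => 2 * x - 1) 2 x := by
      simpa using ((hasDerivAt_id x).const_mul 2).sub_const 1
    have h7 : 2 * x - 1 ≠ 0 := by linarith [hx.1]
    refine ((h1.sub h5).div h6 h7).congr_deriv ?_
    rw [sub_sub_cancel, mul_comm (1 - x) x] at h4
    rw [div_eq_zero_iff]
    left
    simp only [Pi.sub_apply]
    linear_combination h4 - h2
  have hconst : ∀ x ∈ Set.Icc r 1, (fun x => T x / (2 * x - 1)) x = (fun x => T x / (2 * x - 1)) r := by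
    refine constant_of_has_deriv_right_zero ?_ fun x hx => (hder x ⟨by linarith [hx.1], hx.2⟩).hasDerivWithinAt
    exact (hcont.mono (Set.Icc_subset_Icc (by linarith) le_rfl)).div (by fun_prop) hne
  have h1 := hconst 1 ⟨hr1, le_rfl⟩
  simp only [hT, sub_self, fracBeta_zero, sub_zero] at h1
  have := hne r ⟨le_rfl, hr1⟩
  field_simp at h1
  rw [← sub_eq_zero] at h1 ⊢
  norm_num at h1
  linarith

theorem fracBeta_sub_fracBeta_one_sub {p r : ℝ} (hp : -(1 / 2) < p) (hp' : p < 1 / 2)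
    (hr : r ∈ Set.Icc (0 : ℝ) 1) :
    fracBeta p r - fracBeta p (1 - r) = fracBeta p 1 * (2 * r - 1) := by
  rcases lt_trichotomy r (1 / 2) with h | rfl | h
  · have := fracBeta_sub_fracBeta_one_sub_of_half_lt (r := 1 - r) hp hp' (by linarith)
      (by linarith [hr.1])
    rw [sub_sub_cancel] at this
    linear_combination -this
  · norm_num
  · exact fracBeta_sub_fracBeta_one_sub_of_half_lt hp hp' h hr.2

theorem intervalIntegrable_rpow_mul_sub_rpow {a b c : ℝ} (ha : -1 < a) (hb : -1 < b)
    (hc : 0 ≤ c) : IntervalIntegrable (fun x : ℝ => x ^ a * (c - x) ^ b) volume 0 c := by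
  rcases hc.eq_or_lt with rfl | hc
  · exact IntervalIntegrable.refl
  have h := ((intervalIntegrable_rpow_mul_one_sub_rpow ha hb).comp_mul_left (c := c⁻¹)).const_mul
    (c ^ a * c ^ b)
  simp only [zero_div, one_div, inv_inv] at h
  rw [intervalIntegrable_iff_integrableOn_Ioc_of_le hc.le] at h ⊢
  refine (integrableOn_congr_fun (fun x hx => ?_) measurableSet_Ioc).mp h
  have h1 : 0 ≤ c - x := by linarith [hx.2]
  have e : 1 - c⁻¹ * x = c⁻¹ * (c - x) := by field_simp
  rw [e, Real.mul_rpow (by positivity) hx.1.le, Real.mul_rpow (by positivity) h1,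
    Real.inv_rpow hc.le, Real.inv_rpow hc.le]
  have := (Real.rpow_pos_of_pos hc a).ne'
  have := (Real.rpow_pos_of_pos hc b).ne'
  field_simp

theorem intervalIntegrable_fracBeta_integrand {p t r : ℝ} (hp : -(1 / 2) < p) (hp' : p < 1 / 2)
    (hr0 : 0 ≤ r) (hrt : r ≤ t) :
    IntervalIntegrable (fun s : ℝ => (s * (t - s)) ^ p * (r - s) ^ (-2 * p)) volume 0 r := by
  have h1 := (intervalIntegrable_rpow_mul_sub_rpow (a := p) (b := -2 * p) (c := r) (by linarith)
    (by linarith) hr0).const_mul (t ^ p)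
  have h2 := intervalIntegrable_rpow_mul_sub_rpow (a := p) (b := -p) (c := r) (by linarith)
    (by linarith) hr0
  refine (h1.add h2).mono_fun (by fun_prop : Measurable _).aestronglyMeasurable ?_
  have : ∀ᵐ v : ℝ, v ≠ r := by simp [ae_iff]
  filter_upwards [ae_restrict_mem measurableSet_uIoc, ae_restrict_of_ae this] with s hs hsr
  rw [Set.uIoc_of_le hr0] at hs
  have hs1 : 0 < r - s := sub_pos.2 (lt_of_le_of_ne hs.2 hsr)
  have hts : r - s ≤ t - s := by linarith
  have hts0 : 0 < t - s := by linarith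
  have ht0 : 0 < t := by linarith [hs.1]
  have n1 := Real.rpow_pos_of_pos hs.1 p
  have n2 := Real.rpow_pos_of_pos hs1 (-2 * p)
  have n3 := Real.rpow_pos_of_pos hts0 p
  have n4 := Real.rpow_pos_of_pos ht0 p
  have n5 := Real.rpow_pos_of_pos hs1 (-p)
  rw [Real.mul_rpow hs.1.le hts0.le, Real.norm_of_nonneg (by positivity),
    Real.norm_of_nonneg (by positivity)]
  -- Splitting this factor leaves two Beta-type integrands, with exponents `-2p` and `-p` at `r`;
  -- both exceed `-1`.
  have key : (t - s) ^ p ≤ t ^ p + (r - s) ^ p := by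
    have n6 := Real.rpow_pos_of_pos hs1 p
    rcases le_total 0 p with h | h
    · have := Real.rpow_le_rpow hts0.le (show t - s ≤ t by linarith [hs.1]) h
      linarith
    · have := Real.rpow_le_rpow_of_nonpos hs1 hts h
      linarith
  have e : (r - s) ^ (-p) = (r - s) ^ p * (r - s) ^ (-2 * p) := by
    rw [← Real.rpow_add hs1]; ring_nf
  rw [e]
  calc _ = (s ^ p * (r - s) ^ (-2 * p)) * (t - s) ^ p := by ring
    _ ≤ (s ^ p * (r - s) ^ (-2 * p)) * (t ^ p + (r - s) ^ p) := by gcongr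
    _ = _ := by ring

theorem integral_fracBeta_integrand {p t r : ℝ} (ht : 0 < t) (hr0 : 0 ≤ r) (hrt : r ≤ t) :
    ∫ s in (0 : ℝ)..r, (s * (t - s)) ^ p * (r - s) ^ (-2 * p) = t * fracBeta p (r / t) := by
  have h := intervalIntegral.integral_comp_mul_left (a := 0) (b := r / t)
    (fun s => (s * (t - s)) ^ p * (r - s) ^ (-2 * p)) ht.ne'
  rw [mul_zero, mul_div_cancel₀ _ ht.ne', smul_eq_mul] at h
  rw [← mul_right_inj' (inv_ne_zero ht.ne'), ← h, inv_mul_cancel_left₀ ht.ne', fracBeta]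
  refine intervalIntegral.integral_congr fun v hv => ?_
  rw [Set.uIcc_of_le (by positivity)] at hv
  have h1 : r / t ≤ 1 := (div_le_one ht).2 hrt
  have h2 : 0 ≤ 1 - v := by linarith [hv.2]
  have h3 : 0 ≤ r / t - v := by linarith [hv.2]
  have e1 : t * v * (t - t * v) = (t ^ 2) * (v * (1 - v)) := by ring
  have e2 : r - t * v = t * (r / t - v) := by field_simp
  rw [e1, e2, Real.mul_rpow (by positivity) (mul_nonneg hv.1 h2), Real.mul_rpow ht.le h3,
    ← Real.rpow_natCast t 2, ← Real.rpow_mul ht.le]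
  have : t ^ (((2 : ℕ) : ℝ) * p) * t ^ (-2 * p) = 1 := by
    rw [← Real.rpow_add ht]; push_cast; ring_nf; exact Real.rpow_zero _
  linear_combination ((v * (1 - v)) ^ p * (r / t - v) ^ (-2 * p)) * this

/-- The function `s ↦ (s (t - s))^p` integrates the signed power kernel to an affine function. -/
theorem integral_mul_signed_rpow {p t r : ℝ} (hp : -(1 / 2) < p) (hp' : p < 1 / 2) (ht : 0 < t)
    (hr0 : 0 ≤ r) (hrt : r ≤ t) :
    IntervalIntegrable (fun s : ℝ => (s * (t - s)) ^ p * (Real.sign (r - s) * |r - s| ^ (-2 * p)))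
      volume 0 t ∧
    ∫ s in (0 : ℝ)..t, (s * (t - s)) ^ p * (Real.sign (r - s) * |r - s| ^ (-2 * p))
      = Real.Gamma (1 + p) * Real.Gamma (1 - p) * (2 * r - t) := by
  set F : ℝ → ℝ := fun s => (s * (t - s)) ^ p * (Real.sign (r - s) * |r - s| ^ (-2 * p)) with hF
  have hne : ∀ᵐ v : ℝ, v ≠ r := by simp [ae_iff]
  have c1 : ∀ᵐ s : ℝ, s ∈ Set.uIoc 0 r → (s * (t - s)) ^ p * (r - s) ^ (-2 * p) = F s := by
    filter_upwards [hne] with s hsr hs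
    rw [Set.uIoc_of_le hr0] at hs
    have hs1 : 0 < r - s := sub_pos.2 (lt_of_le_of_ne hs.2 hsr)
    rw [hF]
    simp only [Real.sign_of_pos hs1, abs_of_pos hs1, one_mul]
  -- To the right of `r`, the reflection `s ↦ t - s` gives the same fractional integral with `t - r`
  -- in place of `r`, and the sign function supplies the minus sign.
  have c2 : ∀ᵐ s : ℝ, s ∈ Set.uIoc r t →
      -(((t - s) * (t - (t - s))) ^ p * ((t - r) - (t - s)) ^ (-2 * p)) = F s := by
    filter_upwards [hne] with s hsr hs
    rw [Set.uIoc_of_le hrt] at hs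
    have hs1 : r - s < 0 := by linarith [hs.1]
    rw [hF]
    simp only [Real.sign_of_neg hs1, abs_of_neg hs1]
    ring_nf
  have i1 : IntervalIntegrable F volume 0 r :=
    (intervalIntegrable_fracBeta_integrand hp hp' hr0 hrt).congr_ae
      ((ae_restrict_iff' measurableSet_uIoc).2 c1)
  have i2' := (intervalIntegrable_fracBeta_integrand (t := t) (r := t - r) hp hp' (by linarith)
    (by linarith)).comp_sub_left t
  rw [sub_zero, sub_sub_cancel] at i2'
  have i2 : IntervalIntegrable F volume r t :=
    (i2'.symm.neg).congr_ae ((ae_restrict_iff' measurableSet_uIoc).2 c2)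
  refine ⟨i1.trans i2, ?_⟩
  rw [← intervalIntegral.integral_add_adjacent_intervals i1 i2,
    ← intervalIntegral.integral_congr_ae c1, ← intervalIntegral.integral_congr_ae c2,
    integral_fracBeta_integrand ht hr0 hrt, intervalIntegral.integral_neg,
    intervalIntegral.integral_comp_sub_left
      (fun s => (s * (t - s)) ^ p * ((t - r) - s) ^ (-2 * p)) t, sub_self,
    integral_fracBeta_integrand ht (by linarith) (by linarith), ← fracBeta_one hp hp',
    show (t - r) / t = 1 - r / t by field_simp]
  have h := fracBeta_sub_fracBeta_one_sub (r := r / t) hp hp'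
    ⟨by positivity, (div_le_one ht).2 hrt⟩
  have h2 : t * (2 * (r / t) - 1) = 2 * r - t := by field_simp
  linear_combination t * h + fracBeta p 1 * h2

/-! ### Integration by parts against the weight `(s (t - s))^p` -/

/-- The derivative of `s ↦ (s (t - s))^p`. -/
noncomputable def bumpDeriv (p t s : ℝ) : ℝ := p * (s * (t - s)) ^ (p - 1) * (t - 2 * s)

theorem abs_bumpDeriv_le {p t s : ℝ} (hp' : p < 1 / 2) (hs : s ∈ Set.Ioc 0 (t / 2)) :
    |bumpDeriv p t s| ≤ |p| * (t / 2) ^ (p - 1) * t * s ^ (p - 1) := by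
  have ht : 0 < t := by linarith [hs.1, hs.2]
  have h1 : t / 2 ≤ t - s := by linarith [hs.2]
  have h2 : 0 ≤ t - 2 * s := by linarith [hs.2]
  have n1 := Real.rpow_pos_of_pos hs.1 (p - 1)
  rw [bumpDeriv, abs_mul, abs_mul, abs_of_nonneg h2, Real.mul_rpow hs.1.le (by linarith),
    abs_of_nonneg (mul_nonneg n1.le (Real.rpow_nonneg (by linarith) _))]
  have h3 := Real.rpow_le_rpow_of_nonpos (z := p - 1) (by linarith) h1 (by linarith)
  have h4 : t - 2 * s ≤ t := by linarith [hs.1]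
  calc _ ≤ |p| * (s ^ (p - 1) * (t / 2) ^ (p - 1)) * t := by gcongr
    _ = _ := by ring

theorem measurable_bumpDeriv (p t : ℝ) : Measurable (bumpDeriv p t) := by
  unfold bumpDeriv; fun_prop

/-- Near `0` the derivative of the weight is only `O(s^(p-1))`, which need not be integrable. The
assumed decay of `D` improves the product to `O(s^(-1/2))`. -/
theorem intervalIntegrable_bumpDeriv_mul {p t K : ℝ} (hp' : p < 1 / 2) (ht : 0 < t)
    {D : ℝ → ℝ} (hD : ContinuousOn D (Set.Icc 0 t))
    (hb : ∀ s ∈ Set.Ioc 0 (t / 2), |D s| ≤ K * s ^ (1 / 2 - p)) :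
    IntervalIntegrable (fun s => bumpDeriv p t s * D s) volume 0 (t / 2) := by
  have h0 : (0 : ℝ) ≤ t / 2 := by linarith
  have hK : IntervalIntegrable (fun s : ℝ => |p| * (t / 2) ^ (p - 1) * t * K * s ^ (-(1 / 2) : ℝ))
      volume 0 (t / 2) := (intervalIntegral.intervalIntegrable_rpow' (by norm_num)).const_mul _
  refine hK.mono_fun ?_ ?_
  · refine (measurable_bumpDeriv p t).aestronglyMeasurable.mul ?_
    rw [Set.uIoc_of_le h0]
    exact (hD.mono fun s hs => ⟨hs.1.le, by linarith [hs.2]⟩).aestronglyMeasurable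
      measurableSet_Ioc
  · filter_upwards [ae_restrict_mem measurableSet_uIoc] with s hs
    rw [Set.uIoc_of_le h0] at hs
    refine le_trans ?_ (le_abs_self _)
    rw [norm_mul, Real.norm_eq_abs, Real.norm_eq_abs]
    have e : s ^ (-(1 / 2) : ℝ) = s ^ (p - 1) * s ^ (1 / 2 - p) := by
      rw [← Real.rpow_add hs.1]; ring_nf
    rw [e]
    calc _ ≤ (|p| * (t / 2) ^ (p - 1) * t * s ^ (p - 1)) * (K * s ^ (1 / 2 - p)) :=
          mul_le_mul (abs_bumpDeriv_le hp' hs) (hb s hs) (abs_nonneg _)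
            ((abs_nonneg _).trans (abs_bumpDeriv_le hp' hs))
      _ = _ := by ring

/-- Integration by parts against `s ↦ (s (t - s))^p`, with the singularities at both endpoints
resolved by symmetrisation. -/
theorem bump_integral_by_parts {p t K : ℝ} (hp' : p < 1 / 2) (ht : 0 < t)
    {φ φ' : ℝ → ℝ} (hφ0 : φ 0 = 0) (hφ : ContinuousOn φ (Set.Icc 0 t)) {c : Set ℝ}
    (hc : c.Countable) (hder : ∀ s ∈ Set.Ioo 0 t \ c, HasDerivAt φ (φ' s) s)
    (hint : IntervalIntegrable (fun s => (s * (t - s)) ^ p * φ' s) volume 0 t)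
    (hb : ∀ s ∈ Set.Ioc 0 (t / 2), |φ s - φ (t - s) + φ t| ≤ K * s ^ (1 / 2 - p)) :
    (t / 2 * (t / 2)) ^ p * φ t -
      ∫ s in (0 : ℝ)..(t / 2), bumpDeriv p t s * (φ s - φ (t - s) + φ t)
      = ∫ s in (0 : ℝ)..t, (s * (t - s)) ^ p * φ' s := by
  -- Pairing `s` with `t - s` folds both endpoint singularities onto `0`. There `D` vanishes, its
  -- derivative is `φ' s + φ' (t - s)`, and `D (t / 2) = φ t` gives the boundary term.
  set D : ℝ → ℝ := fun s => φ s - φ (t - s) + φ t with hDdef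
  have hD : ContinuousOn D (Set.Icc 0 t) :=
    (hφ.sub (hφ.comp (by fun_prop) fun s hs => ⟨by linarith [hs.2], by linarith [hs.1]⟩)).add
      continuousOn_const
  have h0 : (0 : ℝ) ≤ t / 2 := by linarith
  have hi1 := intervalIntegrable_bumpDeriv_mul hp' ht hD hb
  have hi2 : IntervalIntegrable (fun s => (s * (t - s)) ^ p * φ' s) volume 0 (t / 2) :=
    hint.mono_set (by
      rw [Set.uIcc_of_le h0, Set.uIcc_of_le ht.le]
      exact Set.Icc_subset_Icc le_rfl (by linarith))
  have hi3 : IntervalIntegrable (fun s => (s * (t - s)) ^ p * φ' s) volume (t / 2) t :=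
    hint.mono_set (by
      rw [Set.uIcc_of_le (by linarith), Set.uIcc_of_le ht.le]
      exact Set.Icc_subset_Icc h0 le_rfl)
  have hi4 : IntervalIntegrable (fun s => (s * (t - s)) ^ p * φ' (t - s)) volume 0 (t / 2) := by
    have := (hi3.comp_sub_left t).symm
    rw [sub_self, show t - t / 2 = t / 2 by ring] at this
    refine this.congr fun s _ => ?_
    rw [sub_sub_cancel, mul_comm (t - s) s]
  have e4 : ∫ s in (0 : ℝ)..(t / 2), (s * (t - s)) ^ p * φ' (t - s)
      = ∫ s in (t / 2)..t, (s * (t - s)) ^ p * φ' s := by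
    have := intervalIntegral.integral_comp_sub_left (a := 0) (b := t / 2)
      (fun s => (s * (t - s)) ^ p * φ' s) t
    rw [sub_zero, show t - t / 2 = t / 2 by ring] at this
    rw [← this]
    refine intervalIntegral.integral_congr fun s _ => ?_
    rw [sub_sub_cancel, mul_comm (t - s) s]
  have hFTC := integral_eq_of_hasDerivAt_off_countable_of_le
    (fun s => (s * (t - s)) ^ p * D s)
    (fun s => bumpDeriv p t s * D s + ((s * (t - s)) ^ p * φ' s + (s * (t - s)) ^ p * φ' (t - s)))
    h0 (s := c ∪ (fun s => t - s) ⁻¹' c) (hc.union (hc.preimage (sub_right_injective)))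
    ?_ ?_ (hi1.add (hi2.add hi4))
  · rw [intervalIntegral.integral_add hi1 (hi2.add hi4), intervalIntegral.integral_add hi2 hi4, e4,
      intervalIntegral.integral_add_adjacent_intervals hi2 hi3] at hFTC
    have d0 : D 0 = 0 := by simp [hDdef, hφ0]
    have d1 : D (t / 2) = φ t := by
      rw [hDdef]
      beta_reduce
      rw [show t - t / 2 = t / 2 by ring]; ring
    rw [d0, d1, mul_zero, sub_zero, show t - t / 2 = t / 2 by ring] at hFTC
    rw [← hFTC]
    ring
  · intro s hs
    rcases hs.1.eq_or_lt with rfl | hs0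
    · have d0 : D 0 = 0 := by simp [hDdef, hφ0]
      -- At `0` the weight may blow up, but its product with `D` is `O(s^(1/2))`.
      have hlim : Tendsto (fun s : ℝ => (t ^ p + (t / 2) ^ p) * K * s ^ (1 / 2 : ℝ))
          (𝓝[Set.Icc 0 (t / 2)] 0) (𝓝 0) := by
        have : ContinuousAt (fun s : ℝ => (t ^ p + (t / 2) ^ p) * K * s ^ (1 / 2 : ℝ)) 0 :=
          continuousAt_const.mul (Real.continuousAt_rpow_const _ _ (Or.inr (by norm_num)))
        have h := this.tendsto
        rw [Real.zero_rpow (by norm_num), mul_zero] at h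
        exact h.mono_left nhdsWithin_le_nhds
      rw [ContinuousWithinAt, d0, mul_zero]
      refine squeeze_zero_norm' ?_ hlim
      filter_upwards [self_mem_nhdsWithin] with s hs
      rcases hs.1.eq_or_lt with rfl | hs0
      · rw [d0, mul_zero, norm_zero, Real.zero_rpow (by norm_num), mul_zero]
      · have h1 : 0 < t - s := by linarith [hs.2]
        have n1 := Real.rpow_pos_of_pos hs0 p
        have n2 := Real.rpow_pos_of_pos h1 p
        have n3 := Real.rpow_pos_of_pos ht p
        have n4 := Real.rpow_pos_of_pos (show 0 < t / 2 by linarith) p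
        rw [Real.mul_rpow hs0.le h1.le, norm_mul, Real.norm_of_nonneg (by positivity),
          Real.norm_eq_abs]
        have key : (t - s) ^ p ≤ t ^ p + (t / 2) ^ p := by
          rcases le_total 0 p with h | h
          · have := Real.rpow_le_rpow h1.le (show t - s ≤ t by linarith) h
            linarith
          · have := Real.rpow_le_rpow_of_nonpos (show 0 < t / 2 by linarith)
              (show t / 2 ≤ t - s by linarith [hs.2]) h
            linarith
        have e : s ^ (1 / 2 : ℝ) = s ^ p * s ^ (1 / 2 - p) := by
          rw [← Real.rpow_add hs0]; ring_nf
        rw [e]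
        calc _ ≤ s ^ p * (t ^ p + (t / 2) ^ p) * (K * s ^ (1 / 2 - p)) := by
              gcongr
              exact hb s ⟨hs0, hs.2⟩
          _ = _ := by ring
    · have h1 : s * (t - s) ≠ 0 := (mul_pos hs0 (by linarith [hs.2])).ne'
      refine ContinuousWithinAt.mul ?_ ((hD s ⟨hs.1, by linarith [hs.2]⟩).mono
        (Set.Icc_subset_Icc le_rfl (by linarith)))
      exact ((by fun_prop : ContinuousAt (fun s => s * (t - s)) s).rpow_const
        (Or.inl h1)).continuousWithinAt
  · rintro s ⟨hs, hsc⟩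
    simp only [Set.mem_union, Set.mem_preimage, not_or] at hsc
    have h1 : s * (t - s) ≠ 0 := (mul_pos hs.1 (by linarith [hs.2])).ne'
    have d1 := hder s ⟨⟨hs.1, by linarith [hs.2]⟩, hsc.1⟩
    have d2 : HasDerivAt (fun s => φ (t - s)) (-φ' (t - s)) s := by
      have := (hder (t - s) ⟨⟨by linarith [hs.2], by linarith [hs.1]⟩, hsc.2⟩).scomp s
        ((hasDerivAt_id s).const_sub t)
      simpa [Function.comp_def] using this
    have d3 : HasDerivAt (fun s : ℝ => s * (t - s)) (t - 2 * s) s := by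
      refine ((hasDerivAt_id s).mul ((hasDerivAt_id s).const_sub t)).congr_deriv ?_
      simp only [id]; ring
    refine ((d3.rpow_const (p := p) (Or.inl h1)).mul ((d1.sub d2).add_const (φ t))).congr_deriv ?_
    simp only [hDdef, bumpDeriv, Pi.sub_apply]
    ring

/-! ### Fractional Brownian curves in a Hilbert space and their fundamental martingale -/

section Hilbert

variable {E : Type*} [NormedAddCommGroup E] [InnerProductSpace ℝ E]

/-- The closed linear span of `z r`, `0 ≤ r ≤ t`, as a double orthogonal complement. -/
noncomputable def pastSpan (z : ℝ → E) (t : ℝ) : Submodule ℝ E :=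
  (Submodule.span ℝ (z '' Set.Icc 0 t))ᗮᗮ

/-- This lets a vector-valued integral be placed in the past by testing it against vectors
orthogonal to the past, without approximating sums. -/
theorem mem_pastSpan_iff {z : ℝ → E} {t : ℝ} {x : E} :
    x ∈ pastSpan z t ↔ ∀ y, (∀ r ∈ Set.Icc 0 t, ⟪z r, y⟫ = 0) → ⟪x, y⟫ = 0 := by
  rw [pastSpan, Submodule.mem_orthogonal]
  refine forall_congr' fun y => ?_
  rw [Submodule.mem_orthogonal, real_inner_comm]
  refine imp_congr_left ⟨fun h r hr => h _ (Submodule.subset_span ⟨r, hr, rfl⟩), fun h u hu => ?_⟩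
  induction hu using Submodule.span_induction with
  | mem x hx => obtain ⟨r, hr, rfl⟩ := hx; exact h r hr
  | zero => exact inner_zero_left _
  | add x y _ _ hx hy => rw [inner_add_left, hx, hy, add_zero]
  | smul a x _ hx => rw [real_inner_smul_left, hx, mul_zero]

theorem pastSpan_le [CompleteSpace E] {z : ℝ → E} {t : ℝ} {L : Submodule ℝ E}
    (hL : IsClosed (L : Set E)) (h : ∀ r ∈ Set.Icc 0 t, z r ∈ L) : pastSpan z t ≤ L := by
  have : CompleteSpace L := hL.completeSpace_coe
  have h1 : Submodule.span ℝ (z '' Set.Icc 0 t) ≤ L := by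
    rw [Submodule.span_le]
    rintro _ ⟨r, hr, rfl⟩
    exact h r hr
  have h2 := Submodule.orthogonal_le (Submodule.orthogonal_le h1)
  rwa [Submodule.orthogonal_orthogonal L] at h2

/-- `z` is a fractional Brownian curve of Hurst index `H`. -/
def IsFractionalCurve (H : ℝ) (z : ℝ → E) : Prop :=
  ∀ s r : ℝ, 0 ≤ s → 0 ≤ r →
    ⟪z s, z r⟫ = (s ^ (2 * H) + r ^ (2 * H) - |s - r| ^ (2 * H)) / 2

namespace IsFractionalCurve

variable {H : ℝ} {z : ℝ → E}

theorem norm_eq (hz : IsFractionalCurve H z) (hH : 0 < H) {s : ℝ} (hs : 0 ≤ s) :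
    ‖z s‖ = s ^ H := by
  have h := hz s s hs hs
  rw [sub_self, abs_zero, Real.zero_rpow (by linarith), real_inner_self_eq_norm_sq] at h
  have e : s ^ (2 * H) = (s ^ H) ^ 2 := by
    rw [← Real.rpow_natCast, ← Real.rpow_mul hs]; push_cast; ring_nf
  rw [e] at h
  exact (sq_eq_sq₀ (norm_nonneg _) (Real.rpow_nonneg hs _)).1 (by linarith)

theorem norm_sub_eq (hz : IsFractionalCurve H z) (hH : 0 < H) {s r : ℝ} (hs : 0 ≤ s)
    (hr : 0 ≤ r) : ‖z s - z r‖ = |s - r| ^ H := by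
  have h : ‖z s - z r‖ ^ 2 = |s - r| ^ (2 * H) := by
    rw [norm_sub_sq_real, hz s r hs hr, hz.norm_eq hH hs, hz.norm_eq hH hr, ← Real.rpow_natCast,
      ← Real.rpow_natCast, ← Real.rpow_mul hs, ← Real.rpow_mul hr]
    push_cast
    ring_nf
  have e : |s - r| ^ (2 * H) = (|s - r| ^ H) ^ 2 := by
    rw [← Real.rpow_natCast, ← Real.rpow_mul (abs_nonneg _)]; push_cast; ring_nf
  rw [e] at h
  exact (sq_eq_sq₀ (norm_nonneg _) (Real.rpow_nonneg (abs_nonneg _) _)).1 h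

theorem continuousOn (hz : IsFractionalCurve H z) (hH : 0 < H) :
    ContinuousOn z (Set.Ici 0) := by
  intro r hr
  rw [ContinuousWithinAt, tendsto_iff_norm_sub_tendsto_zero]
  have h : Tendsto (fun s : ℝ => |s - r| ^ H) (𝓝[Set.Ici 0] r) (𝓝 0) := by
    have : ContinuousAt (fun s : ℝ => |s - r| ^ H) r :=
      (by fun_prop : ContinuousAt (fun s : ℝ => |s - r|) r).rpow_const (Or.inr hH.le)
    have h := this.tendsto
    rw [sub_self, abs_zero, Real.zero_rpow hH.ne'] at h
    exact h.mono_left nhdsWithin_le_nhds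
  refine h.congr' ?_
  filter_upwards [self_mem_nhdsWithin] with s hs
  exact (hz.norm_sub_eq hH hs hr).symm

/-- `z s` and `z t - z (t - s)` are both increments over a length `s`. The order `s^H` is the decay
`s^(1/2 - p)` required for `p = 1/2 - H`. -/
theorem norm_symm_le (hz : IsFractionalCurve H z) (hH : 0 < H) {s t : ℝ} (hs : 0 ≤ s)
    (hst : s ≤ t) : ‖z s - z (t - s) + z t‖ ≤ 2 * s ^ H := by
  have h1 : z s - z (t - s) + z t = z s + (z t - z (t - s)) := by abel
  rw [h1]
  refine (norm_add_le _ _).trans ?_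
  rw [hz.norm_eq hH hs, hz.norm_sub_eq hH (hs.trans hst) (by linarith), sub_sub_cancel,
    abs_of_nonneg hs]
  linarith

theorem intervalIntegrable_bump (hz : IsFractionalCurve H z) (hH : 0 < H) {t : ℝ}
    (ht : 0 < t) :
    IntervalIntegrable (fun s => bumpDeriv (1 / 2 - H) t s • (z s - z (t - s) + z t))
      volume 0 (t / 2) := by
  have h0 : (0 : ℝ) ≤ t / 2 := by linarith
  have hc : ContinuousOn (fun s => z s - z (t - s) + z t) (Set.Icc 0 t) :=
    (((hz.continuousOn hH).mono fun s hs => hs.1).sub ((hz.continuousOn hH).comp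
      (by fun_prop) fun s hs => by simpa using hs.2)).add continuousOn_const
  have h := intervalIntegrable_bumpDeriv_mul (p := 1 / 2 - H) (K := 2) (by linarith) ht hc.norm
    fun s hs => by
      rw [abs_of_nonneg (norm_nonneg _), show 1 / 2 - (1 / 2 - H) = H by ring]
      exact hz.norm_symm_le hH hs.1.le (by linarith [hs.2])
  refine h.mono_fun ?_ (Eventually.of_forall fun s => ?_)
  · refine (measurable_bumpDeriv _ t).aestronglyMeasurable.smul ?_
    rw [Set.uIoc_of_le h0]
    exact (hc.mono fun s hs => ⟨hs.1.le, by linarith [hs.2]⟩).aestronglyMeasurable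
      measurableSet_Ioc
  · beta_reduce
    rw [norm_smul, norm_mul, norm_norm]

end IsFractionalCurve

/-- The Wiener integral `∫₀ᵗ (s (t - s))^(1/2 - H) dz s`, integrated by parts. -/
noncomputable def bumpWiener (H : ℝ) (z : ℝ → E) (t : ℝ) : E :=
  (t / 2 * (t / 2)) ^ (1 / 2 - H) • z t -
    ∫ s in (0 : ℝ)..(t / 2), bumpDeriv (1 / 2 - H) t s • (z s - z (t - s) + z t)

variable [CompleteSpace E]

namespace IsFractionalCurve

variable {H : ℝ} {z : ℝ → E}

theorem inner_bumpWiener (hz : IsFractionalCurve H z) (hH : 0 < H) {t : ℝ} (ht : 0 < t) (y : E) :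
    ⟪bumpWiener H z t, y⟫ = (t / 2 * (t / 2)) ^ (1 / 2 - H) * ⟪z t, y⟫ -
      ∫ s in (0 : ℝ)..(t / 2), bumpDeriv (1 / 2 - H) t s *
        (⟪z s, y⟫ - ⟪z (t - s), y⟫ + ⟪z t, y⟫) := by
  rw [bumpWiener, inner_sub_left, real_inner_smul_left, real_inner_comm, real_inner_comm y,
    ← innerSL_apply_apply ℝ y (∫ s in (0 : ℝ)..(t / 2), _),
    ← ContinuousLinearMap.intervalIntegral_comp_comm _ (hz.intervalIntegrable_bump hH ht)]
  congr 1
  refine intervalIntegral.integral_congr fun s _ => ?_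
  simp only [innerSL_apply_apply, real_inner_smul_right, inner_add_right, inner_sub_right,
    real_inner_comm y]

theorem bumpWiener_mem (hz : IsFractionalCurve H z) (hH : 0 < H) {t : ℝ} (ht : 0 < t) :
    bumpWiener H z t ∈ pastSpan z t := by
  rw [mem_pastSpan_iff]
  intro y hy
  rw [hz.inner_bumpWiener hH ht, hy t ⟨ht.le, le_rfl⟩, mul_zero, zero_sub, neg_eq_zero]
  refine intervalIntegral.integral_zero_ae (Eventually.of_forall fun s hs => ?_)
  rw [Set.uIoc_of_le (by linarith)] at hs
  rw [hy s ⟨hs.1.le, by linarith [hs.2]⟩, hy (t - s) ⟨by linarith [hs.2], by linarith [hs.1]⟩]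
  ring

/-- The curve is not assumed differentiable, but its pairing with `y` may be, and then the
integration by parts can be undone. The countable set `c` leaves room for the kink of the covariance
at `s = r`. -/
theorem inner_bumpWiener_eq_integral (hz : IsFractionalCurve H z) (hH : 0 < H) {t : ℝ}
    (ht : 0 < t) (y : E) {φ' : ℝ → ℝ} {c : Set ℝ} (hc : c.Countable)
    (hder : ∀ s ∈ Set.Ioo 0 t \ c, HasDerivAt (fun s => ⟪z s, y⟫) (φ' s) s)
    (hint : IntervalIntegrable (fun s => (s * (t - s)) ^ (1 / 2 - H) * φ' s) volume 0 t) :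
    ⟪bumpWiener H z t, y⟫ = ∫ s in (0 : ℝ)..t, (s * (t - s)) ^ (1 / 2 - H) * φ' s := by
  rw [hz.inner_bumpWiener hH ht]
  have h0 : z 0 = 0 := by
    rw [← norm_eq_zero, hz.norm_eq hH le_rfl, Real.zero_rpow hH.ne']
  refine bump_integral_by_parts (K := 2 * ‖y‖) (by linarith) ht (φ := fun s => ⟪z s, y⟫)
    (by simp [h0]) ?_ hc hder hint fun s hs => ?_
  · exact ((hz.continuousOn hH).mono fun s hs => hs.1).inner continuousOn_const
  · rw [← inner_sub_left, ← inner_add_left, show 1 / 2 - (1 / 2 - H) = H by ring]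
    refine (abs_real_inner_le_norm _ _).trans ?_
    calc _ ≤ (2 * s ^ H) * ‖y‖ := by
          gcongr
          exact hz.norm_symm_le hH hs.1.le (by linarith [hs.2, hs.1])
      _ = _ := by ring

/-- The `s`-derivative of the covariance is `H` times the difference of the signed kernels centred
at `r` and at `0`. `integral_mul_signed_rpow` sends these to multiples of `2r - t` and `-t`, and the
dependence on `t` cancels. -/
theorem inner_bumpWiener_self (hz : IsFractionalCurve H z) (hH : 0 < H) (hH1 : H < 1) {r t : ℝ}
    (ht : 0 < t) (hr : 0 ≤ r) (hrt : r ≤ t) :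
    ⟪bumpWiener H z t, z r⟫ =
      2 * H * (Real.Gamma (3 / 2 - H) * Real.Gamma (H + 1 / 2)) * r := by
  have hp : -(1 / 2) < 1 / 2 - H := by linarith
  have hp' : 1 / 2 - H < 1 / 2 := by linarith
  obtain ⟨i0, e0⟩ := integral_mul_signed_rpow hp hp' ht le_rfl ht.le
  obtain ⟨i1, e1⟩ := integral_mul_signed_rpow hp hp' ht hr hrt
  rw [hz.inner_bumpWiener_eq_integral hH ht (z r)
    (φ' := fun s => H * (Real.sign (r - s) * |r - s| ^ (-2 * (1 / 2 - H)))
      - H * (Real.sign (0 - s) * |0 - s| ^ (-2 * (1 / 2 - H))))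
    (c := {r}) (Set.countable_singleton r) ?_ ?_]
  · have : ∀ s : ℝ, (s * (t - s)) ^ (1 / 2 - H) *
        (H * (Real.sign (r - s) * |r - s| ^ (-2 * (1 / 2 - H)))
          - H * (Real.sign (0 - s) * |0 - s| ^ (-2 * (1 / 2 - H)))) =
        H * ((s * (t - s)) ^ (1 / 2 - H) * (Real.sign (r - s) * |r - s| ^ (-2 * (1 / 2 - H)))) -
        H * ((s * (t - s)) ^ (1 / 2 - H) * (Real.sign (0 - s) * |0 - s| ^ (-2 * (1 / 2 - H)))) :=
      fun s => by ring
    simp_rw [this]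
    rw [intervalIntegral.integral_sub (i1.const_mul _) (i0.const_mul _),
      intervalIntegral.integral_const_mul, intervalIntegral.integral_const_mul, e0, e1,
      show 1 + (1 / 2 - H) = 3 / 2 - H by ring, show 1 - (1 / 2 - H) = H + 1 / 2 by ring]
    ring
  · rintro s ⟨hs, hsr⟩
    rw [Set.mem_singleton_iff] at hsr
    have d1 : HasDerivAt (fun s : ℝ => (s ^ (2 * H) + r ^ (2 * H) - |s - r| ^ (2 * H)) / 2)
        (H * (Real.sign (r - s) * |r - s| ^ (-2 * (1 / 2 - H)))
      - H * (Real.sign (0 - s) * |0 - s| ^ (-2 * (1 / 2 - H)))) s := by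
      have d2 : HasDerivAt (fun s : ℝ => s ^ (2 * H)) (2 * H * s ^ (2 * H - 1)) s :=
        Real.hasDerivAt_rpow_const (Or.inl hs.1.ne')
      have d3 : HasDerivAt (fun s : ℝ => |s - r|) (-(Real.sign (r - s))) s := by
        rcases lt_or_gt_of_ne hsr with h | h
        · rw [Real.sign_of_pos (by linarith)]
          refine (((hasDerivAt_id s).const_sub r).congr_of_eventuallyEq ?_).congr_deriv rfl
          filter_upwards [Iio_mem_nhds h] with x hx
          rw [abs_of_neg (by linarith [Set.mem_Iio.1 hx])]; simp
        · rw [Real.sign_of_neg (by linarith)]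
          refine (((hasDerivAt_id s).sub_const r).congr_of_eventuallyEq ?_).congr_deriv (by simp)
          filter_upwards [Ioi_mem_nhds h] with x hx
          rw [abs_of_pos (by linarith [Set.mem_Ioi.1 hx])]; simp
      have d4 := d3.rpow_const (p := 2 * H) (Or.inl (abs_pos.2 (sub_ne_zero.2 hsr)).ne')
      refine (((d2.add_const (r ^ (2 * H))).sub d4).div_const 2).congr_deriv ?_
      rw [Real.sign_of_neg (show 0 - s < 0 by linarith [hs.1]), abs_of_neg (show 0 - s < 0 by
        linarith [hs.1]), show -2 * (1 / 2 - H) = 2 * H - 1 by ring, abs_sub_comm r s]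
      ring_nf
    refine d1.congr_of_eventuallyEq ?_
    filter_upwards [Ioi_mem_nhds hs.1] with x hx
    exact hz x r (le_of_lt hx) hr
  · refine ((i1.const_mul H).sub (i0.const_mul H)).congr fun s _ => ?_
    ring

/-- The pairing has constant derivative `a`, so what remains is the Beta integral of the weight
itself. -/
theorem inner_bumpWiener_linear (hz : IsFractionalCurve H z) (hH : 0 < H) (hH1 : H < 1) {t a : ℝ}
    (ht : 0 < t) {y : E} (hy : ∀ s ∈ Set.Icc 0 t, ⟪z s, y⟫ = a * s) :
    ⟪bumpWiener H z t, y⟫ =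
      a * (Real.Gamma (3 / 2 - H) ^ 2 / Real.Gamma (3 - 2 * H)) * t ^ (2 - 2 * H) := by
  have hi := intervalIntegrable_rpow_mul_sub_rpow (a := 1 / 2 - H) (b := 1 / 2 - H) (c := t)
    (by linarith) (by linarith) ht.le
  have hc : ∀ s ∈ Set.uIcc 0 t, s ^ (1 / 2 - H) * (t - s) ^ (1 / 2 - H) * a =
      (s * (t - s)) ^ (1 / 2 - H) * a := fun s hs => by
    rw [Set.uIcc_of_le ht.le] at hs
    rw [Real.mul_rpow hs.1 (by linarith [hs.2])]
  rw [hz.inner_bumpWiener_eq_integral hH ht y (φ' := fun _ => a) (c := ∅) Set.countable_empty ?_ ?_]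
  · have h := intervalIntegral.integral_comp_mul_left (a := 0) (b := 1)
      (fun s => (s * (t - s)) ^ (1 / 2 - H) * a) ht.ne'
    rw [mul_zero, mul_one, smul_eq_mul] at h
    rw [← mul_right_inj' (inv_ne_zero ht.ne'), ← h]
    have e : ∀ s ∈ Set.uIcc (0 : ℝ) 1, (t * s * (t - t * s)) ^ (1 / 2 - H) * a =
        (a * t ^ (1 - 2 * H)) * (s ^ (1 / 2 - H) * (1 - s) ^ (1 / 2 - H)) := fun s hs => by
      rw [Set.uIcc_of_le zero_le_one] at hs
      have h1 : 0 ≤ 1 - s := by linarith [hs.2]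
      rw [show t * s * (t - t * s) = t ^ 2 * (s * (1 - s)) by ring,
        Real.mul_rpow (by positivity) (mul_nonneg hs.1 h1), Real.mul_rpow hs.1 h1,
        ← Real.rpow_natCast, ← Real.rpow_mul ht.le]
      push_cast
      rw [show 2 * (1 / 2 - H) = 1 - 2 * H by ring]
      ring
    rw [intervalIntegral.integral_congr e, intervalIntegral.integral_const_mul,
      integral_rpow_mul_one_sub_rpow (by linarith) (by linarith),
      show 1 / 2 - H + 1 = 3 / 2 - H by ring, show 1 / 2 - H + (1 / 2 - H) + 2 = 3 - 2 * H by ring,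
      show 2 - 2 * H = (1 - 2 * H) + 1 by ring, Real.rpow_add_one ht.ne']
    field_simp
  · rintro s ⟨hs, -⟩
    have d : HasDerivAt (fun s : ℝ => a * s) a s := by
      simpa using (hasDerivAt_id s).const_mul a
    refine d.congr_of_eventuallyEq ?_
    filter_upwards [Ioo_mem_nhds hs.1 hs.2] with x hx
    exact hy x ⟨hx.1.le, hx.2.le⟩
  · exact (hi.mul_const a).congr fun s hs => hc s (Set.uIoc_subset_uIcc hs)

/-- The fundamental martingale of a fractional Brownian curve: the projection on the past of a
family `z'` with `⟪z s, z' t⟫ = a s` for `s ≤ t`. -/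
theorem exists_fundamental_martingale (hz : IsFractionalCurve H z) (hH : 0 < H) (hH1 : H < 1)
    {z' : ℝ → E} {a : ℝ} (hz' : ∀ s t, 0 ≤ s → s ≤ t → ⟪z s, z' t⟫ = a * s) :
    ∃ M : ℝ → E, (∀ t, 0 ≤ t → M t ∈ pastSpan z t) ∧
      (∀ r t, 0 ≤ r → r ≤ t → ⟪M t, z r⟫ = a * r) ∧
      ∀ s t, 0 ≤ s → s ≤ t → ⟪M s, M t⟫ = a ^ 2 * Real.Gamma (3 / 2 - H)
        / (2 * H * Real.Gamma (H + 1 / 2) * Real.Gamma (3 - 2 * H)) * s ^ (2 - 2 * H) := by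
  have g1 := Real.Gamma_pos_of_pos (show 0 < 3 / 2 - H by linarith)
  have g2 := Real.Gamma_pos_of_pos (show 0 < H + 1 / 2 by linarith)
  have g3 := Real.Gamma_pos_of_pos (show 0 < 3 - 2 * H by linarith)
  -- The slope found in `inner_bumpWiener_self`; the factor `a / κ` turns it into `a`.
  set κ := 2 * H * (Real.Gamma (3 / 2 - H) * Real.Gamma (H + 1 / 2)) with hκ
  have hκ0 : κ ≠ 0 := by positivity
  set M : ℝ → E := fun t => if 0 < t then (a / κ) • bumpWiener H z t else 0 with hM
  have hMpos : ∀ t, 0 < t → M t = (a / κ) • bumpWiener H z t := fun t ht => if_pos ht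
  have hM0 : M 0 = 0 := if_neg (lt_irrefl _)
  have h1 : ∀ t, 0 ≤ t → M t ∈ pastSpan z t := fun t ht => by
    rcases ht.eq_or_lt with rfl | ht
    · rw [hM0]; exact Submodule.zero_mem _
    · rw [hMpos t ht]
      exact Submodule.smul_mem _ _ (hz.bumpWiener_mem hH ht)
  have h2 : ∀ r t, 0 ≤ r → r ≤ t → ⟪M t, z r⟫ = a * r := fun r t hr hrt => by
    rcases (hr.trans hrt).eq_or_lt with rfl | ht
    · rw [le_antisymm hrt hr, hM0, inner_zero_left, mul_zero]
    · rw [hMpos t ht, real_inner_smul_left, hz.inner_bumpWiener_self hH hH1 ht hr hrt, ← hκ]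
      field_simp
  refine ⟨M, h1, h2, fun s t hs hst => ?_⟩
  rcases hs.eq_or_lt with rfl | hs'
  · rw [hM0, inner_zero_left, Real.zero_rpow (by linarith), mul_zero]
  -- `M t` and `z' s` have the same pairing `a r` with `z r` for `r ≤ s`. Their difference is
  -- therefore orthogonal to the past of `s`, which contains `M s`.
  · have e1 : ⟪M s, M t⟫ = ⟪M s, z' s⟫ := by
      rw [← sub_eq_zero, ← inner_sub_right]
      refine mem_pastSpan_iff.1 (h1 s hs) _ fun r hr => ?_
      rw [inner_sub_right, hz' r s hr.1 hr.2, real_inner_comm, h2 r t hr.1 (hr.2.trans hst), sub_self]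
    rw [e1, hMpos s hs', real_inner_smul_left, hz.inner_bumpWiener_linear hH hH1 hs'
      fun r hr => hz' r s hr.1 hr.2, hκ]
    field_simp

end IsFractionalCurve

end Hilbert

/-! ### Wiener integrals of powers, and the Brownian curve of a martingale curve -/

section WienerPow

/-- The left side is `∫₀ᵗ s^e d(min(s, u)^γ)` integrated by parts. The integrator stops moving at
`u`, so this is the integral of `γ s^(γ+e-1)` up to `min t u`. -/
theorem rpow_mul_min_rpow_sub_integral {e γ t u : ℝ} (hγ : 0 < γ) (heγ : 0 < γ + e) (ht : 0 ≤ t)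
    (hu : 0 ≤ u) :
    t ^ e * min t u ^ γ - e * ∫ s in (0 : ℝ)..t, s ^ (e - 1) * min s u ^ γ
      = γ / (γ + e) * min t u ^ (γ + e) := by
  have key : ∀ v, 0 ≤ v → v ≤ u → ∫ s in (0 : ℝ)..v, s ^ (e - 1) * min s u ^ γ
      = v ^ (γ + e) / (γ + e) := fun v hv hvu => by
    have : ∫ s in (0 : ℝ)..v, s ^ (e - 1) * min s u ^ γ = ∫ s in (0 : ℝ)..v, s ^ (γ + e - 1) := by
      refine intervalIntegral.integral_congr_ae (Eventually.of_forall fun s hs => ?_)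
      rw [Set.uIoc_of_le hv] at hs
      rw [min_eq_left (hs.2.trans hvu), ← Real.rpow_add hs.1]
      ring_nf
    rw [this, integral_rpow (Or.inl (by linarith)), sub_add_cancel, Real.zero_rpow heγ.ne', sub_zero]
  rcases le_total t u with h | h
  · rw [key t ht h, min_eq_left h]
    rcases ht.eq_or_lt with rfl | ht
    · rw [Real.zero_rpow hγ.ne', Real.zero_rpow heγ.ne']; simp
    · rw [← Real.rpow_add ht, add_comm e γ]
      field_simp
      ring
  · rw [min_eq_right h]
    rcases hu.eq_or_lt with rfl | hu
    · have : ∫ s in (0 : ℝ)..t, s ^ (e - 1) * min s 0 ^ γ = 0 := by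
        refine intervalIntegral.integral_zero_ae (Eventually.of_forall fun s hs => ?_)
        rw [Set.uIoc_of_le ht] at hs
        rw [min_eq_right hs.1.le, Real.zero_rpow hγ.ne', mul_zero]
      rw [this, Real.zero_rpow hγ.ne', Real.zero_rpow heγ.ne']; simp
    · have i1 : IntervalIntegrable (fun s => s ^ (e - 1) * min s u ^ γ) volume 0 u := by
        have : IntervalIntegrable (fun s : ℝ => s ^ (γ + e - 1)) volume 0 u :=
          intervalIntegral.intervalIntegrable_rpow' (by linarith)
        refine this.congr fun s hs => ?_
        rw [Set.uIoc_of_le hu.le] at hs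
        rw [min_eq_left hs.2, ← Real.rpow_add hs.1]
        ring_nf
      have hc : ∀ s ∈ Set.uIcc u t, s ^ (e - 1) * min s u ^ γ = s ^ (e - 1) * u ^ γ := fun s hs => by
        rw [Set.uIcc_of_le h] at hs
        rw [min_eq_right hs.1]
      have h0 : (0 : ℝ) ∉ Set.uIcc u t := by
        rw [Set.uIcc_of_le h]; exact fun h => absurd h.1 (not_le.2 hu)
      have i2 : IntervalIntegrable (fun s => s ^ (e - 1) * min s u ^ γ) volume u t :=
        ((intervalIntegral.intervalIntegrable_rpow (Or.inr h0)).mul_const _).congr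
          fun s hs => (hc s (Set.uIoc_subset_uIcc hs)).symm
      rw [← intervalIntegral.integral_add_adjacent_intervals i1 i2, key u hu.le le_rfl,
        intervalIntegral.integral_congr hc, intervalIntegral.integral_mul_const]
      rcases eq_or_ne e 0 with rfl | he
      · rw [add_zero, Real.rpow_zero]; field_simp; ring
      · rw [integral_rpow (Or.inr ⟨by simpa [sub_eq_iff_eq_add] using he, h0⟩), sub_add_cancel,
          Real.rpow_add hu]
        field_simp
        ring

variable {E : Type*} [NormedAddCommGroup E] [InnerProductSpace ℝ E]

/-- The Wiener integral `∫₀ᵗ s^e dX s`, integrated by parts. -/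
noncomputable def wienerPow (e : ℝ) (X : ℝ → E) (t : ℝ) : E :=
  t ^ e • X t - e • ∫ s in (0 : ℝ)..t, s ^ (e - 1) • X s

theorem intervalIntegrable_rpow_smul {e γ K t : ℝ} {X : ℝ → E} (hX : ContinuousOn X (Set.Ici 0))
    (hb : ∀ s, 0 ≤ s → ‖X s‖ ≤ K * s ^ γ) (heγ : 0 < γ + e) (ht : 0 ≤ t) :
    IntervalIntegrable (fun s => s ^ (e - 1) • X s) volume 0 t := by
  have h : IntervalIntegrable (fun s : ℝ => K * s ^ (γ + e - 1)) volume 0 t :=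
    (intervalIntegral.intervalIntegrable_rpow' (by linarith)).const_mul _
  refine h.mono_fun ?_ ?_
  · refine (by fun_prop : Measurable _).aestronglyMeasurable.smul ?_
    rw [Set.uIoc_of_le ht]
    exact (hX.mono fun s hs => hs.1.le).aestronglyMeasurable measurableSet_Ioc
  · filter_upwards [ae_restrict_mem measurableSet_uIoc] with s hs
    rw [Set.uIoc_of_le ht] at hs
    have n1 := Real.rpow_pos_of_pos hs.1 (e - 1)
    rw [norm_smul, Real.norm_of_nonneg n1.le]
    refine le_trans ?_ (le_abs_self _)
    rw [show γ + e - 1 = (e - 1) + γ by ring, Real.rpow_add hs.1]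
    calc _ ≤ s ^ (e - 1) * (K * s ^ γ) := by gcongr; exact hb s hs.1.le
      _ = _ := by ring

theorem inner_wienerPow [CompleteSpace E] {e t : ℝ} {X : ℝ → E}
    (hX : IntervalIntegrable (fun s => s ^ (e - 1) • X s) volume 0 t) (y : E) :
    ⟪wienerPow e X t, y⟫ = t ^ e * ⟪X t, y⟫ - e * ∫ s in (0 : ℝ)..t, s ^ (e - 1) * ⟪X s, y⟫ := by
  rw [wienerPow, inner_sub_left, real_inner_smul_left, real_inner_smul_left,
    real_inner_comm y (∫ s in (0 : ℝ)..t, _),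
    ← innerSL_apply_apply ℝ y (∫ s in (0 : ℝ)..t, _),
    ← ContinuousLinearMap.intervalIntegral_comp_comm _ hX]
  simp only [innerSL_apply_apply, real_inner_smul_right, real_inner_comm y]

/-- Integrating `s^e` in one factor keeps the form of the kernel, raises its exponent by `e` and
multiplies it by `γ / (γ + e)`. All covariances below follow by applying this to one factor and then
to the other. -/
theorem inner_wienerPow_eq [CompleteSpace E] {e γ c t u : ℝ} {X : ℝ → E} {y : E}
    (hX : IntervalIntegrable (fun s => s ^ (e - 1) • X s) volume 0 t)
    (hγ : 0 < γ) (heγ : 0 < γ + e) (ht : 0 ≤ t) (hu : 0 ≤ u)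
    (hy : ∀ s ∈ Set.Icc 0 t, ⟪X s, y⟫ = c * min s u ^ γ) :
    ⟪wienerPow e X t, y⟫ = c * γ / (γ + e) * min t u ^ (γ + e) := by
  have : ∫ s in (0 : ℝ)..t, s ^ (e - 1) * ⟪X s, y⟫ =
      c * ∫ s in (0 : ℝ)..t, s ^ (e - 1) * min s u ^ γ := by
    rw [← intervalIntegral.integral_const_mul]
    refine intervalIntegral.integral_congr fun s hs => ?_
    rw [Set.uIcc_of_le ht] at hs
    rw [hy s hs]
    ring
  rw [inner_wienerPow hX, this, hy t ⟨ht, le_rfl⟩]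
  have h := rpow_mul_min_rpow_sub_integral hγ heγ ht hu
  linear_combination c * h

theorem wienerPow_mem [CompleteSpace E] {e t : ℝ} {X z : ℝ → E}
    (hX : IntervalIntegrable (fun s => s ^ (e - 1) • X s) volume 0 t) (ht : 0 ≤ t)
    (h : ∀ s ∈ Set.Icc 0 t, X s ∈ pastSpan z s) : wienerPow e X t ∈ pastSpan z t := by
  rw [mem_pastSpan_iff]
  intro y hy
  have h0 : ∀ s ∈ Set.Icc 0 t, ⟪X s, y⟫ = 0 := fun s hs =>
    mem_pastSpan_iff.1 (h s hs) y fun r hr => hy r ⟨hr.1, hr.2.trans hs.2⟩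
  -- With `c = 0` any `γ` serves; `|e| + 1` makes both `γ` and `γ + e` positive.
  rw [inner_wienerPow_eq (c := 0) (γ := |e| + 1) (u := 0) hX (by positivity)
    (by linarith [neg_abs_le e]) ht le_rfl fun s hs => by rw [h0 s hs, zero_mul]]
  simp

/-- A curve with orthogonal increments and variance `c t^(2-2H)`. -/
structure IsPowerMartingaleCurve (H c : ℝ) (M : ℝ → E) : Prop where
  pos : 0 < H
  lt_one : H < 1
  const_pos : 0 < c
  inner_eq : ∀ s t, 0 ≤ s → 0 ≤ t → ⟪M s, M t⟫ = c * min s t ^ (2 - 2 * H)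

namespace IsPowerMartingaleCurve

variable {H c : ℝ} {M : ℝ → E}

theorem norm_sq (hM : IsPowerMartingaleCurve H c M) {t : ℝ} (ht : 0 ≤ t) :
    ‖M t‖ ^ 2 = c * t ^ (2 - 2 * H) := by
  rw [← real_inner_self_eq_norm_sq, hM.inner_eq t t ht ht, min_self]

theorem norm_le (hM : IsPowerMartingaleCurve H c M) {t : ℝ} (ht : 0 ≤ t) :
    ‖M t‖ ≤ √c * t ^ (1 - H) := by
  have hc := hM.const_pos
  refine abs_le_of_sq_le_sq' ?_ (by positivity) |>.2
  rw [hM.norm_sq ht, mul_pow, Real.sq_sqrt hc.le, ← Real.rpow_natCast, ← Real.rpow_mul ht]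
  push_cast
  ring_nf
  rfl

theorem norm_sub_sq (hM : IsPowerMartingaleCurve H c M) {s t : ℝ} (hs : 0 ≤ s) (ht : s ≤ t) :
    ‖M t - M s‖ ^ 2 = c * (t ^ (2 - 2 * H) - s ^ (2 - 2 * H)) := by
  rw [norm_sub_sq_real, hM.norm_sq hs, hM.norm_sq (hs.trans ht), hM.inner_eq t s (hs.trans ht) hs,
    min_eq_right ht]
  ring

theorem continuousOn (hM : IsPowerMartingaleCurve H c M) : ContinuousOn M (Set.Ici 0) := by
  intro r hr
  have hc := hM.const_pos
  have hr : 0 ≤ r := hr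
  rw [ContinuousWithinAt, tendsto_iff_norm_sub_tendsto_zero]
  have h : Tendsto (fun s : ℝ => √(c * |s ^ (2 - 2 * H) - r ^ (2 - 2 * H)|))
      (𝓝[Set.Ici 0] r) (𝓝 0) := by
    have : ContinuousAt (fun s : ℝ => √(c * |s ^ (2 - 2 * H) - r ^ (2 - 2 * H)|)) r := by
      have h1 : ContinuousAt (fun s : ℝ => s ^ (2 - 2 * H)) r :=
        Real.continuousAt_rpow_const _ _ (Or.inr (by linarith [hM.lt_one]))
      fun_prop
    have h := this.tendsto
    simp only [sub_self, abs_zero, mul_zero, Real.sqrt_zero] at h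
    exact h.mono_left nhdsWithin_le_nhds
  refine h.congr' ?_
  filter_upwards [self_mem_nhdsWithin] with s hs
  have hs : 0 ≤ s := hs
  rw [eq_comm, ← Real.sqrt_sq (norm_nonneg (M s - M r))]
  congr 1
  have hmono : ∀ x y : ℝ, 0 ≤ x → x ≤ y → x ^ (2 - 2 * H) ≤ y ^ (2 - 2 * H) := fun x y hx hxy =>
    Real.rpow_le_rpow hx hxy (by linarith [hM.lt_one])
  rcases le_total r s with h | h
  · rw [hM.norm_sub_sq hr h, abs_of_nonneg (sub_nonneg.2 (hmono _ _ hr h))]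
  · rw [norm_sub_rev, hM.norm_sub_sq hs h, abs_of_nonpos (sub_nonpos.2 (hmono _ _ hs h)), neg_sub]

theorem intervalIntegrable (hM : IsPowerMartingaleCurve H c M) {e t : ℝ} (he : 0 < 1 - H + e)
    (ht : 0 ≤ t) : IntervalIntegrable (fun s => s ^ (e - 1) • M s) volume 0 t :=
  intervalIntegrable_rpow_smul hM.continuousOn (fun _ hs => hM.norm_le hs) he ht

/-- The Brownian curve driving `M`. -/
noncomputable def brownianCurve (H c : ℝ) (M : ℝ → E) (t : ℝ) : E :=
  (√(c * (2 - 2 * H)))⁻¹ • wienerPow (H - 1 / 2) M t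

variable [CompleteSpace E]

theorem inner_brownianCurve_left (hM : IsPowerMartingaleCurve H c M) {t u : ℝ} (ht : 0 ≤ t)
    (hu : 0 ≤ u) : ⟪brownianCurve H c M t, M u⟫ =
      √(c * (2 - 2 * H)) / (3 / 2 - H) * min t u ^ (3 / 2 - H) := by
  have h1 := hM.pos
  have h2 := hM.lt_one
  have hc := hM.const_pos
  have h3 : 0 < c * (2 - 2 * H) := mul_pos hc (by linarith)
  rw [brownianCurve, real_inner_smul_left, inner_wienerPow_eq (c := c) (γ := 2 - 2 * H) (u := u)
    (hM.intervalIntegrable (by linarith) ht) (by linarith) (by linarith) ht hu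
    fun s hs => hM.inner_eq s u hs.1 hu, show 2 - 2 * H + (H - 1 / 2) = 3 / 2 - H by ring]
  have h4 : 3 / 2 - H ≠ 0 := by linarith
  have h5 := (Real.sqrt_pos.2 h3).ne'
  have h6 := Real.sq_sqrt h3.le
  generalize √(c * (2 - 2 * H)) = q at h5 h6 ⊢
  rw [← h6]
  generalize 3 / 2 - H = d at h4 ⊢
  field_simp

/-- The exponent goes from `2 - 2H` through `3/2 - H` to `1`, gaining `H - 1/2` from each factor.
The normalising constant makes the final coefficient `1`. -/
theorem inner_brownianCurve (hM : IsPowerMartingaleCurve H c M) {t u : ℝ} (ht : 0 ≤ t)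
    (hu : 0 ≤ u) : ⟪brownianCurve H c M t, brownianCurve H c M u⟫ = min t u := by
  have h1 := hM.pos
  have h2 := hM.lt_one
  have hc := hM.const_pos
  have h3 : 0 < c * (2 - 2 * H) := mul_pos hc (by linarith)
  nth_rw 1 [brownianCurve]
  rw [real_inner_smul_left, inner_wienerPow_eq (c := √(c * (2 - 2 * H)) / (3 / 2 - H))
    (γ := 3 / 2 - H) (u := u)
    (hM.intervalIntegrable (by linarith) ht) (by linarith) (by linarith) ht hu
    fun s hs => by rw [real_inner_comm, hM.inner_brownianCurve_left hu hs.1, min_comm],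
    show 3 / 2 - H + (H - 1 / 2) = 1 by ring, Real.rpow_one]
  have h4 : 3 / 2 - H ≠ 0 := by linarith
  have h5 := (Real.sqrt_pos.2 h3).ne'
  generalize √(c * (2 - 2 * H)) = q at h5 ⊢
  generalize 3 / 2 - H = d at h4 ⊢
  field_simp

/-- The right side is `∫ √(c (2-2H)) s^(H-1/2) ds` over `[0, min t u]`. Together with
`norm_sq_wienerPow` it identifies `∫ s^(2H-1) dM` with the Wiener integral of that integrand against
the Brownian curve. -/
theorem inner_wienerPow_brownianCurve (hM : IsPowerMartingaleCurve H c M) {t u : ℝ} (ht : 0 ≤ t)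
    (hu : 0 ≤ u) : ⟪wienerPow (2 * H - 1) M t, brownianCurve H c M u⟫ =
      √(c * (2 - 2 * H)) * (min t u ^ (H + 1 / 2) / (H + 1 / 2)) := by
  have h1 := hM.pos
  have h2 := hM.lt_one
  rw [inner_wienerPow_eq (c := √(c * (2 - 2 * H)) / (3 / 2 - H)) (γ := 3 / 2 - H) (u := u)
    (hM.intervalIntegrable (by linarith) ht) (by linarith) (by linarith) ht hu
    fun s hs => by rw [real_inner_comm, hM.inner_brownianCurve_left hu hs.1, min_comm],
    show 3 / 2 - H + (2 * H - 1) = H + 1 / 2 by ring]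
  have h4 : 3 / 2 - H ≠ 0 := by linarith
  generalize 3 / 2 - H = d at h4 ⊢
  field_simp

theorem norm_sq_wienerPow (hM : IsPowerMartingaleCurve H c M) {t : ℝ} (ht : 0 ≤ t) :
    ‖wienerPow (2 * H - 1) M t‖ ^ 2 = c * (2 - 2 * H) * (t ^ (2 * H) / (2 * H)) := by
  have h1 := hM.pos
  have h2 := hM.lt_one
  have hi := hM.intervalIntegrable (e := 2 * H - 1) (by linarith) ht
  rw [← real_inner_self_eq_norm_sq, inner_wienerPow_eq (c := c * (2 - 2 * H)) (γ := 1)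
    (u := t) hi one_pos (by linarith) ht ht fun s hs => ?_]
  · rw [min_self, show 1 + (2 * H - 1) = 2 * H by ring]
    ring
  · rw [real_inner_comm, inner_wienerPow_eq (c := c) (γ := 2 - 2 * H) (u := s) hi
      (by linarith) (by linarith) ht hs.1 fun r hr => hM.inner_eq r s hr.1 hs.1,
      show 2 - 2 * H + (2 * H - 1) = 1 by ring, div_one, min_comm]

end IsPowerMartingaleCurve

end WienerPow

/-! ### The Gaussian space: laws, independence and conditional expectation -/

section Gaussian

variable {Ω : Type*} {mΩ : MeasurableSpace Ω} {P : Measure Ω}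

theorem norm_sq_eq_variance (f : Lp ℝ 2 P) (h0 : ∫ ω, f ω ∂P = 0) :
    ‖f‖ ^ 2 = Var[f; P] := by
  rw [variance_of_integral_eq_zero (Lp.aestronglyMeasurable f).aemeasurable h0,
    ← real_inner_self_eq_norm_sq, L2.inner_def]
  refine integral_congr_ae (Eventually.of_forall fun ω => ?_)
  simp [pow_two]

theorem covariance_congr_ae {X X' Y Y' : Ω → ℝ} (hX : X =ᵐ[P] X') (hY : Y =ᵐ[P] Y') :
    cov[X, Y; P] = cov[X', Y'; P] := by
  unfold covariance
  rw [integral_congr_ae hX, integral_congr_ae hY]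
  refine integral_congr_ae ?_
  filter_upwards [hX, hY] with ω h1 h2
  rw [h1, h2]

variable {ι : Type*} {Z : ι → Ω → ℝ}

/-- The closed linear span in `L²` of a family of square integrable random variables. -/
noncomputable def gaussianSpan (hZ : ∀ i, MemLp (Z i) 2 P) : Submodule ℝ (Lp ℝ 2 P) :=
  (Submodule.span ℝ (Set.range fun i => (hZ i).toLp (Z i))).topologicalClosure

theorem toLp_mem_gaussianSpan (hZ : ∀ i, MemLp (Z i) 2 P) (i : ι) :
    (hZ i).toLp (Z i) ∈ gaussianSpan hZ :=
  Submodule.le_topologicalClosure _ (Submodule.subset_span ⟨i, rfl⟩)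

variable [IsProbabilityMeasure P]

theorem integrable_exp_mul_I (f : Lp ℝ 2 P) (t : ℝ) :
    Integrable (fun ω => Complex.exp (Complex.I * ((t * f ω : ℝ) : ℂ))) P := by
  refine Integrable.of_bound (C := 1) ?_ (Eventually.of_forall fun ω => ?_)
  · refine Complex.continuous_exp.comp_aestronglyMeasurable (AEStronglyMeasurable.const_mul ?_ _)
    exact Complex.continuous_ofReal.comp_aestronglyMeasurable
      ((Lp.aestronglyMeasurable f).const_mul t)
  · rw [mul_comm, Complex.norm_exp_ofReal_mul_I]

theorem norm_exp_I_mul_sub_le (x y : ℝ) :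
    ‖Complex.exp (Complex.I * (x : ℂ)) - Complex.exp (Complex.I * (y : ℂ))‖ ≤ |x - y| := by
  have h : Complex.exp (Complex.I * (x : ℂ)) - Complex.exp (Complex.I * (y : ℂ))
      = Complex.exp (Complex.I * (y : ℂ)) * (Complex.exp (Complex.I * ((x - y : ℝ) : ℂ)) - 1) := by
    rw [mul_sub, mul_one, ← Complex.exp_add]
    push_cast
    ring_nf
  rw [h, norm_mul, mul_comm Complex.I (y : ℂ), Complex.norm_exp_ofReal_mul_I, one_mul]
  exact Real.norm_exp_I_mul_ofReal_sub_one_le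

theorem integral_abs_le_norm (f : Lp ℝ 2 P) : ∫ ω, |f ω| ∂P ≤ ‖f‖ := by
  have h1 : eLpNorm f 1 P ≤ eLpNorm f 2 P :=
    eLpNorm_le_eLpNorm_of_exponent_le (by norm_num) (Lp.aestronglyMeasurable f)
  have h2 := ENNReal.toReal_mono (Lp.eLpNorm_ne_top f) h1
  rw [← Lp.norm_def, eLpNorm_one_eq_lintegral_enorm] at h2
  refine le_trans (le_of_eq ?_) h2
  rw [← integral_norm_eq_lintegral_enorm (Lp.aestronglyMeasurable f)]
  rfl

/-- The map is Lipschitz, since `x ↦ exp (i x)` is and the `L¹` norm is at most the `L²` norm.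
Continuity lets Gaussian characteristic functions pass to `L²` limits. -/
theorem continuous_integral_exp_mul_I (t : ℝ) :
    Continuous fun f : Lp ℝ 2 P => ∫ ω, Complex.exp (Complex.I * ((t * f ω : ℝ) : ℂ)) ∂P := by
  have hL : LipschitzWith (Real.toNNReal |t|)
      fun f : Lp ℝ 2 P => ∫ ω, Complex.exp (Complex.I * ((t * f ω : ℝ) : ℂ)) ∂P := by
    refine LipschitzWith.of_dist_le_mul fun f g => ?_
    rw [Real.coe_toNNReal _ (abs_nonneg t), dist_eq_norm, dist_eq_norm,
      ← integral_sub (integrable_exp_mul_I f t) (integrable_exp_mul_I g t)]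
    have hfg : Integrable (fun ω => |(f - g) ω|) P :=
      ((Lp.memLp (f - g)).integrable (by norm_num)).abs
    calc _ ≤ ∫ ω, |t| * |(f - g) ω| ∂P := by
          refine norm_integral_le_of_norm_le (hfg.const_mul _) ?_
          filter_upwards [Lp.coeFn_sub f g] with ω hω
          refine (norm_exp_I_mul_sub_le _ _).trans_eq ?_
          rw [hω, ← abs_mul, Pi.sub_apply, mul_sub]
      _ = |t| * ∫ ω, |(f - g) ω| ∂P := integral_const_mul _ _
      _ ≤ |t| * ‖f - g‖ := by gcongr; exact integral_abs_le_norm _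
  exact hL.continuous

theorem hasGaussianLaw_of_mem_span (hZ : ∀ i, MemLp (Z i) 2 P) (hG : IsGaussianProcess Z P)
    (h0 : ∀ i, ∫ ω, Z i ω ∂P = 0) {f : Lp ℝ 2 P}
    (hf : f ∈ Submodule.span ℝ (Set.range fun i => (hZ i).toLp (Z i))) :
    HasGaussianLaw f P ∧ ∫ ω, f ω ∂P = 0 := by
  obtain ⟨c, rfl⟩ := Finsupp.mem_span_range_iff_exists_finsupp.1 hf
  have hae : (fun ω => ∑ i ∈ c.support, c i • Z i ω) =ᵐ[P]
      ((c.sum fun i a => a • (hZ i).toLp (Z i) : Lp ℝ 2 P) : Ω → ℝ) := by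
    rw [Finsupp.sum]
    refine EventuallyEq.symm ((Lp.coeFn_finsetSum _ _).trans ?_)
    have : ∀ᵐ ω ∂P, ∀ i ∈ c.support, (c i • (hZ i).toLp (Z i) : Lp ℝ 2 P) ω = c i • Z i ω := by
      rw [Filter.eventually_all_finset]
      intro i _
      filter_upwards [Lp.coeFn_smul (c i) ((hZ i).toLp (Z i)), (hZ i).coeFn_toLp] with ω h1 h2
      rw [h1, Pi.smul_apply, h2]
    filter_upwards [this] with ω hω
    simp only [Finset.sum_apply]
    exact Finset.sum_congr rfl hω
  constructor
  · exact ((hG.smul c).hasGaussianLaw_fun_sum (I := c.support)).congr hae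
  · rw [← integral_congr_ae hae, integral_finsetSum (f := fun i ω => c i • Z i ω) _ fun i _ =>
      ((hZ i).integrable (by norm_num)).smul (c i)]
    refine Finset.sum_eq_zero fun i _ => ?_
    rw [integral_smul, h0 i, smul_zero]

/-- Elements of the closed linear span of a centered Gaussian process are centered Gaussian. -/
theorem map_eq_gaussianReal_of_mem (hZ : ∀ i, MemLp (Z i) 2 P) (hG : IsGaussianProcess Z P)
    (h0 : ∀ i, ∫ ω, Z i ω ∂P = 0) {f : Lp ℝ 2 P} (hf : f ∈ gaussianSpan hZ) :
    P.map f = gaussianReal 0 (‖f‖₊ ^ 2) := by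
  -- Having the characteristic function of `N(0, ‖f‖²)` is, for each `t`, an equality of continuous
  -- functions of `f`. It holds on the span, hence on its closure.
  have hclosed : IsClosed {f : Lp ℝ 2 P | ∀ t : ℝ,
      ∫ ω, Complex.exp (Complex.I * ((t * f ω : ℝ) : ℂ)) ∂P
        = Complex.exp (((-(‖f‖ ^ 2 * t ^ 2 / 2) : ℝ)) : ℂ)} := by
    simp only [Set.ofPred_forall]
    refine isClosed_iInter fun t => isClosed_eq (continuous_integral_exp_mul_I t) ?_
    fun_prop
  have hcf : ∀ (g : Lp ℝ 2 P) (t : ℝ), charFun (P.map g) t =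
      ∫ ω, Complex.exp (Complex.I * ((t * g ω : ℝ) : ℂ)) ∂P := fun g t => by
    rw [charFun_apply_real, integral_map (Lp.aestronglyMeasurable g).aemeasurable (by fun_prop)]
    refine integral_congr_ae (Eventually.of_forall fun ω => ?_)
    push_cast
    ring_nf
  have hsub : (Submodule.span ℝ (Set.range fun i => (hZ i).toLp (Z i)) : Set (Lp ℝ 2 P)) ⊆
      {f : Lp ℝ 2 P | ∀ t : ℝ, ∫ ω, Complex.exp (Complex.I * ((t * f ω : ℝ) : ℂ)) ∂P
        = Complex.exp (((-(‖f‖ ^ 2 * t ^ 2 / 2) : ℝ)) : ℂ)} := by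
    intro g hg t
    obtain ⟨h1, h2⟩ := hasGaussianLaw_of_mem_span hZ hG h0 hg
    rw [← hcf, h1.map_eq_gaussianReal, charFun_gaussianReal, h2, norm_sq_eq_variance g h2,
      Real.coe_toNNReal _ (variance_nonneg _ _)]
    congr 1
    push_cast
    ring
  have hmem := closure_minimal hsub hclosed hf
  have := Measure.isProbabilityMeasure_map (μ := P) (Lp.aestronglyMeasurable f).aemeasurable
  refine Measure.ext_of_charFun (funext fun t => ?_)
  rw [hcf, hmem t, charFun_gaussianReal]
  congr 1
  push_cast
  ring

theorem integral_eq_zero_of_mem (hZ : ∀ i, MemLp (Z i) 2 P) (hG : IsGaussianProcess Z P)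
    (h0 : ∀ i, ∫ ω, Z i ω ∂P = 0) {f : Lp ℝ 2 P} (hf : f ∈ gaussianSpan hZ) :
    ∫ ω, f ω ∂P = 0 := by
  have h : ∫ x, x ∂(P.map f) = 0 := by
    rw [map_eq_gaussianReal_of_mem hZ hG h0 hf, integral_id_gaussianReal]
  rwa [integral_map (Lp.aestronglyMeasurable f).aemeasurable (by fun_prop)] at h

theorem covariance_eq_inner (hZ : ∀ i, MemLp (Z i) 2 P) (hG : IsGaussianProcess Z P)
    (h0 : ∀ i, ∫ ω, Z i ω ∂P = 0) {f g : Lp ℝ 2 P} (hf : f ∈ gaussianSpan hZ)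
    (_ : g ∈ gaussianSpan hZ) : cov[f, g; P] = ⟪f, g⟫ := by
  rw [covariance_eq_sub (Lp.memLp f) (Lp.memLp g), integral_eq_zero_of_mem hZ hG h0 hf, zero_mul,
    sub_zero, L2.inner_def]
  refine integral_congr_ae (Eventually.of_forall fun ω => ?_)
  simp [mul_comm]

/-- Any family in the closed linear span of a centered Gaussian process is a Gaussian process. -/
theorem isGaussianProcess_of_mem (hZ : ∀ i, MemLp (Z i) 2 P) (hG : IsGaussianProcess Z P)
    (h0 : ∀ i, ∫ ω, Z i ω ∂P = 0) {T : Type*} {X : T → Lp ℝ 2 P}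
    (hX : ∀ t, X t ∈ gaussianSpan hZ) : IsGaussianProcess (fun t ω => X t ω) P where
  hasGaussianLaw I := by
    classical
    have hm : AEMeasurable (fun ω => I.restrict (fun t => X t ω)) P :=
      aemeasurable_pi_lambda _ fun i => (Lp.aestronglyMeasurable (X i)).aemeasurable
    refine ⟨isGaussian_of_map_eq_gaussianReal fun L => ?_⟩
    -- Cramér–Wold: a linear functional of finitely many coordinates is again an element of the
    -- Gaussian space.
    set g : Lp ℝ 2 P := ∑ i : I, L (Pi.single i 1) • X i with hg
    have hgm : g ∈ gaussianSpan hZ :=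
      Submodule.sum_mem _ fun i _ => Submodule.smul_mem _ _ (hX i)
    refine ⟨0, ‖g‖₊ ^ 2, ?_⟩
    rw [← map_eq_gaussianReal_of_mem hZ hG h0 hgm, AEMeasurable.map_map_of_aemeasurable
      L.continuous.measurable.aemeasurable hm]
    refine Measure.map_congr ?_
    have h1 : (g : Ω → ℝ) =ᵐ[P] fun ω => ∑ i : I, L (Pi.single i 1) * X i ω := by
      refine (Lp.coeFn_finsetSum _ _).trans ?_
      have : ∀ᵐ ω ∂P, ∀ i : I, (L (Pi.single i 1) • X i : Lp ℝ 2 P) ω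
          = L (Pi.single i 1) * X i ω := ae_all_iff.2 fun i => by
        filter_upwards [Lp.coeFn_smul (L (Pi.single i 1)) (X i)] with ω h
        rw [h, Pi.smul_apply, smul_eq_mul]
      filter_upwards [this] with ω hω
      simp only [Finset.sum_apply, hω]
    filter_upwards [h1] with ω hω
    rw [hω, Function.comp_apply]
    conv_lhs => rw [pi_eq_sum_univ' (I.restrict fun t => X t ω)]
    rw [map_sum]
    refine Finset.sum_congr rfl fun i _ => ?_
    rw [map_smul, smul_eq_mul, mul_comm]
    rfl

/-- Orthogonality to a subfamily implies independence of the σ-algebra it generates. -/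
theorem indep_of_inner_eq_zero (hZ : ∀ i, MemLp (Z i) 2 P) (hG : IsGaussianProcess Z P)
    (h0 : ∀ i, ∫ ω, Z i ω ∂P = 0) {f : Lp ℝ 2 P} (hf : f ∈ gaussianSpan hZ) {T : Type*}
    (j : T → ι) (hj : ∀ t, ⟪f, (hZ (j t)).toLp (Z (j t))⟫ = 0) {g : Ω → ℝ} (hg : g =ᵐ[P] f) :
    Indep (MeasurableSpace.comap g inferInstance)
      (MeasurableSpace.comap (fun ω t => Z (j t) ω) MeasurableSpace.pi) P := by
  -- Adjoining `f` to the subfamily as one more coordinate gives a jointly Gaussian family, for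
  -- which zero covariance means independence.
  set Y : Unit ⊕ T → Lp ℝ 2 P := Sum.elim (fun _ => f) fun t => (hZ (j t)).toLp (Z (j t)) with hY
  have hYm : ∀ x, Y x ∈ gaussianSpan hZ := by
    rintro (_ | t)
    · exact hf
    · exact toLp_mem_gaussianSpan hZ (j t)
  have hgp : IsGaussianProcess (Sum.elim (fun (_ : Unit) => g) fun t => Z (j t)) P := by
    refine (isGaussianProcess_of_mem hZ hG h0 hYm).congr ?_
    rintro (_ | t)
    · exact hg.symm
    · exact (hZ (j t)).coeFn_toLp
  have hgm : AEMeasurable g P := (Lp.aestronglyMeasurable f).aemeasurable.congr hg.symm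
  have hind := hgp.indepFun_of_covariance_eq_zero (fun _ => hgm) (fun t => hG.aemeasurable (j t))
    fun _ t => by
      rw [covariance_congr_ae hg (hZ (j t)).coeFn_toLp.symm,
        covariance_eq_inner hZ hG h0 hf (toLp_mem_gaussianSpan hZ (j t)), hj t]
  have h2 : IndepFun g (fun ω t => Z (j t) ω) P :=
    hind.comp (φ := fun x : Unit → ℝ => x ()) (ψ := id) (by fun_prop) measurable_id
  exact h2

/-- If `Y` differs from a square integrable `m`-measurable variable `f` in the Gaussian space by
an element orthogonal to the generators of `m`, then `f` is the conditional expectation. -/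
theorem condExp_ae_eq_of_inner_eq_zero (hZ : ∀ i, MemLp (Z i) 2 P) (hG : IsGaussianProcess Z P)
    (hmeas : ∀ i, Measurable (Z i)) (h0 : ∀ i, ∫ ω, Z i ω ∂P = 0) {f : Lp ℝ 2 P}
    (hf : f ∈ gaussianSpan hZ) {T : Type*} (j : T → ι)
    (hfm : AEStronglyMeasurable[MeasurableSpace.comap (fun ω t => Z (j t) ω) MeasurableSpace.pi]
      f P) (i : ι) (hi : ∀ t, ⟪(hZ i).toLp (Z i) - f, (hZ (j t)).toLp (Z (j t))⟫ = 0) :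
    P[Z i | MeasurableSpace.comap (fun ω t => Z (j t) ω) MeasurableSpace.pi] =ᵐ[P] f := by
  have hle : MeasurableSpace.comap (fun ω t => Z (j t) ω) MeasurableSpace.pi ≤ mΩ :=
    (measurable_pi_lambda _ fun t => hmeas (j t)).comap_le
  set d : Lp ℝ 2 P := (hZ i).toLp (Z i) - f with hd
  have hdm : d ∈ gaussianSpan hZ := Submodule.sub_mem _ (toLp_mem_gaussianSpan hZ i) hf
  -- A genuinely measurable representative is taken because the generated σ-algebra depends on the
  -- function itself and not on its class.
  obtain ⟨d', hd', hdd'⟩ := (Lp.aestronglyMeasurable d)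
  have hind := indep_of_inner_eq_zero hZ hG h0 hdm j hi hdd'.symm
  have hdint : Integrable d' P := ((Lp.memLp d).integrable (by norm_num)).congr hdd'
  have hfint : Integrable f P := (Lp.memLp f).integrable (by norm_num)
  have h1 : Z i =ᵐ[P] f + d' := by
    filter_upwards [(hZ i).coeFn_toLp, Lp.coeFn_sub ((hZ i).toLp (Z i)) f, hdd'] with ω h1 h2 h3
    rw [Pi.add_apply, ← h3, h2, Pi.sub_apply, h1]
    ring
  have h2 := condExp_indep_eq hd'.measurable.comap_le hle
    (comap_measurable d').stronglyMeasurable hind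
  have h3 : ∫ ω, d' ω ∂P = 0 := by
    rw [← integral_congr_ae hdd', integral_eq_zero_of_mem hZ hG h0 hdm]
  filter_upwards [condExp_congr_ae h1, condExp_add hfint hdint _,
    condExp_of_aestronglyMeasurable' hle hfm hfint, h2] with ω e1 e2 e3 e4
  rw [e1, e2, Pi.add_apply, e3, e4, h3, add_zero]

/-- Elements of the closed span of `m`-measurable variables are `m`-measurable up to null sets. -/
theorem aestronglyMeasurable_of_mem_pastSpan {Ω : Type*} {m mΩ : MeasurableSpace Ω}
    {P : Measure Ω} (hm : m ≤ mΩ)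
    {z : ℝ → Lp ℝ 2 P} {t : ℝ} (hz : ∀ r ∈ Set.Icc 0 t, AEStronglyMeasurable[m] (z r) P)
    {x : Lp ℝ 2 P} (hx : x ∈ pastSpan z t) : AEStronglyMeasurable[m] x P := by
  have : Fact (m ≤ mΩ) := ⟨hm⟩
  have hL : IsClosed (lpMeas ℝ ℝ m 2 P : Set (Lp ℝ 2 P)) :=
    isClosed_aestronglyMeasurable hm
  exact mem_lpMeas_iff_aestronglyMeasurable.1 (pastSpan_le (L := lpMeas ℝ ℝ m 2 P) hL
    (fun r hr => mem_lpMeas_iff_aestronglyMeasurable.2 (hz r hr)) hx)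

end Gaussian

/-! ### Kolmogorov's continuity theorem and adapted continuous versions -/

section Continuity

/-- The largest dyadic number of level `n` below `t`. -/
noncomputable def dyadicFloor (n : ℕ) (t : ℝ≥0) : ℝ≥0 := (⌊2 ^ n * t⌋₊ : ℝ≥0) / 2 ^ n

theorem dyadicFloor_le (n : ℕ) (t : ℝ≥0) : dyadicFloor n t ≤ t := by
  rw [dyadicFloor, div_le_iff₀ (by positivity), mul_comm]
  exact Nat.floor_le (by positivity)

theorem le_dyadicFloor_add (n : ℕ) (t : ℝ≥0) : t ≤ dyadicFloor n t + 1 / 2 ^ n := by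
  rw [dyadicFloor, ← add_div, le_div_iff₀ (by positivity), mul_comm]
  exact (Nat.lt_floor_add_one _).le

theorem tendsto_dyadicFloor (t : ℝ≥0) : Tendsto (fun n => dyadicFloor n t) atTop (𝓝 t) := by
  have h : Tendsto (fun n : ℕ => t - 1 / 2 ^ n) atTop (𝓝 (t - 0)) := by
    refine Tendsto.sub tendsto_const_nhds ?_
    have := tendsto_pow_atTop_nhds_zero_of_lt_one (r := (1 / 2 : ℝ≥0))
      (by norm_num) (by rw [← NNReal.coe_lt_coe]; norm_num)
    simpa only [div_pow, one_pow] using this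
  rw [tsub_zero] at h
  refine tendsto_of_tendsto_of_tendsto_of_le_of_le h tendsto_const_nhds (fun n => ?_)
    fun n => dyadicFloor_le n t
  exact tsub_le_iff_right.2 (le_dyadicFloor_add n t)

/-- If the increments of `x` over dyadic intervals of level `n` decay geometrically, then `x`
coincides along dyadic approximations with a continuous function. -/
theorem exists_continuous_of_dyadic_increments {x : ℝ≥0 → ℝ} {r : ℝ} (hr0 : 0 < r) (hr : r < 1)
    (h : ∀ K : ℕ, ∃ C : ℝ, ∀ n i : ℕ, i < K * 2 ^ n →
      |x (((i + 1 : ℕ) : ℝ≥0) / 2 ^ n) - x ((i : ℝ≥0) / 2 ^ n)| ≤ C * r ^ n) :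
    ∃ y : ℝ≥0 → ℝ, Continuous y ∧
      ∀ t, Tendsto (fun n => x (dyadicFloor n t)) atTop (𝓝 (y t)) := by
  choose C hC using h
  have hfl : ∀ (K n : ℕ) (t : ℝ≥0), t < K → ⌊2 ^ n * t⌋₊ < K * 2 ^ n := fun K n t ht => by
    rw [Nat.floor_lt (by positivity)]
    push_cast
    rw [mul_comm]
    gcongr
  have hC0 : ∀ K : ℕ, 0 < K → 0 ≤ C K := fun K hK => by
    have := (abs_nonneg _).trans (hC K 0 0 (by simpa using hK))
    simpa using this
  -- Successive dyadic approximations of `t` either agree or are the two ends of one cell of level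
  -- `n + 1`, so they form a geometric Cauchy sequence.
  have hstep : ∀ (K : ℕ) (t : ℝ≥0), t < K → ∀ n,
      dist (x (dyadicFloor n t)) (x (dyadicFloor (n + 1) t)) ≤ C K * r * r ^ n := by
    intro K t ht n
    have hK : 0 < K := Nat.pos_of_ne_zero fun h0 => by simp [h0] at ht
    have h2 : ((2 * ⌊2 ^ n * t⌋₊ : ℕ) : ℝ≥0) / 2 ^ (n + 1) = dyadicFloor n t := by
      rw [dyadicFloor, pow_succ]
      push_cast
      rw [mul_comm (2 : ℝ≥0), mul_div_mul_right _ _ two_ne_zero]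
    have hlow : 2 * ⌊2 ^ n * t⌋₊ ≤ ⌊2 ^ (n + 1) * t⌋₊ := by
      refine Nat.le_floor ?_
      push_cast
      rw [pow_succ, mul_comm _ (2 : ℝ≥0), mul_assoc]
      gcongr
      exact Nat.floor_le (by positivity)
    have hup : ⌊2 ^ (n + 1) * t⌋₊ < 2 * ⌊2 ^ n * t⌋₊ + 2 := by
      rw [Nat.floor_lt (by positivity)]
      push_cast
      rw [pow_succ, mul_comm _ (2 : ℝ≥0), mul_assoc]
      have := Nat.lt_floor_add_one (2 ^ n * t)
      calc 2 * (2 ^ n * t) < 2 * ((⌊2 ^ n * t⌋₊ : ℝ≥0) + 1) := by gcongr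
        _ = _ := by ring
    have hK' := hfl K (n + 1) t ht
    rcases (show ⌊2 ^ (n + 1) * t⌋₊ = 2 * ⌊2 ^ n * t⌋₊ ∨
      ⌊2 ^ (n + 1) * t⌋₊ = 2 * ⌊2 ^ n * t⌋₊ + 1 by omega) with he | he
    · have : dyadicFloor (n + 1) t = dyadicFloor n t := by rw [← h2, dyadicFloor, he]
      rw [this, dist_self]
      have := hC0 K hK
      positivity
    · have h3 : dyadicFloor (n + 1) t = ((2 * ⌊2 ^ n * t⌋₊ + 1 : ℕ) : ℝ≥0) / 2 ^ (n + 1) := by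
        rw [dyadicFloor, he]
      rw [dist_comm, Real.dist_eq, h3, ← h2, mul_assoc, ← pow_succ']
      exact hC K (n + 1) _ (by omega)
  have hlim : ∀ t, ∃ y, Tendsto (fun n => x (dyadicFloor n t)) atTop (𝓝 y) := fun t => by
    obtain ⟨K, hK⟩ := exists_nat_gt t
    exact cauchySeq_tendsto_of_complete (cauchySeq_of_le_geometric r _ hr (hstep K t hK))
  choose y hy using hlim
  refine ⟨y, ?_, hy⟩
  have hdist : ∀ (K : ℕ) (t : ℝ≥0), t < K → ∀ n,
      dist (x (dyadicFloor n t)) (y t) ≤ C K * r * r ^ n / (1 - r) := fun K t ht n =>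
    dist_le_of_le_geometric_of_tendsto r _ hr (hstep K t ht) (hy t) n
  -- Points within `2⁻ⁿ` of each other have equal or adjacent dyadic approximations of level `n`.
  have hclose : ∀ (K n : ℕ) (s t : ℝ≥0), s ≤ t → t < K → t ≤ s + 1 / 2 ^ n →
      dist (x (dyadicFloor n s)) (x (dyadicFloor n t)) ≤ C K * r ^ n := by
    intro K n s t hst ht hts
    have hK : 0 < K := Nat.pos_of_ne_zero fun h0 => by simp [h0] at ht
    have h1 : ⌊2 ^ n * s⌋₊ ≤ ⌊2 ^ n * t⌋₊ := Nat.floor_mono (by gcongr)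
    have h2 : ⌊2 ^ n * t⌋₊ ≤ ⌊2 ^ n * s⌋₊ + 1 := by
      rw [← Nat.floor_add_one (by positivity)]
      refine Nat.floor_mono ?_
      calc 2 ^ n * t ≤ 2 ^ n * (s + 1 / 2 ^ n) := by gcongr
        _ = _ := by rw [mul_add, mul_one_div_cancel (by positivity)]
    rcases (show ⌊2 ^ n * t⌋₊ = ⌊2 ^ n * s⌋₊ ∨ ⌊2 ^ n * t⌋₊ = ⌊2 ^ n * s⌋₊ + 1 by omega)
      with he | he
    · rw [dyadicFloor, dyadicFloor, he, dist_self]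
      have := hC0 K hK
      positivity
    · rw [dyadicFloor, dyadicFloor, he, dist_comm, Real.dist_eq]
      exact hC K n _ (by have := hfl K n t ht; omega)
  have hmod : ∀ (K n : ℕ) (s t : ℝ≥0), s ≤ t → t < K → t ≤ s + 1 / 2 ^ n →
      dist (y s) (y t) ≤ (C K * r / (1 - r) + C K + C K * r / (1 - r)) * r ^ n := by
    intro K n s t hst ht hts
    calc dist (y s) (y t) ≤ dist (y s) (x (dyadicFloor n s))
          + dist (x (dyadicFloor n s)) (x (dyadicFloor n t))
          + dist (x (dyadicFloor n t)) (y t) := dist_triangle4 _ _ _ _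
      _ ≤ C K * r * r ^ n / (1 - r) + C K * r ^ n + C K * r * r ^ n / (1 - r) := by
          refine add_le_add (add_le_add ?_ (hclose K n s t hst ht hts)) (hdist K t ht n)
          rw [dist_comm]
          exact hdist K s (hst.trans_lt ht) n
      _ = _ := by ring
  refine continuous_iff_continuousAt.2 fun t => Metric.continuousAt_iff'.2 fun ε hε => ?_
  obtain ⟨K, hK⟩ := exists_nat_gt t
  have htend : Tendsto (fun n : ℕ => (C K * r / (1 - r) + C K + C K * r / (1 - r)) * r ^ n)
      atTop (𝓝 0) := by
    simpa using (tendsto_pow_atTop_nhds_zero_of_lt_one hr0.le hr).const_mul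
      (C K * r / (1 - r) + C K + C K * r / (1 - r))
  obtain ⟨n, hn⟩ := (htend.eventually (gt_mem_nhds hε)).exists
  have hpos : (0 : ℝ≥0) < 1 / 2 ^ n := by positivity
  have hup : ∀ᶠ s in 𝓝 t, s < t + 1 / 2 ^ n := gt_mem_nhds (lt_add_of_pos_right t hpos)
  have hlow : ∀ᶠ s in 𝓝 t, t < s + 1 / 2 ^ n :=
    ((continuous_id.add continuous_const).tendsto t).eventually
      (lt_mem_nhds (lt_add_of_pos_right t hpos))
  filter_upwards [gt_mem_nhds hK, hup, hlow] with s hsK h1 h2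
  rcases le_total s t with hst | hst
  · exact (hmod K n s t hst hK h2.le).trans_lt hn
  · rw [dist_comm]
    exact (hmod K n t s hst hsK h1.le).trans_lt hn

variable {Ω : Type*} {mΩ : MeasurableSpace Ω} {P : Measure Ω}

/-- Level `n` has `K 2^n` increments, each with moment of order `4^(-n)`. After weighting by
`(3/2)^n` the expected sums are of order `(3/4)^n` and summable, so the weighted total `S` is almost
surely finite and bounds every increment. -/
theorem ae_dyadic_increments_le {X : ℝ≥0 → Ω → ℝ} (hX : ∀ t, Measurable (X t)) {p : ℕ} {M : ℝ}
    (h : ∀ s t : ℝ≥0, s ≤ t → t ≤ s + 1 →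
      ∫⁻ ω, ‖X t ω - X s ω‖ₑ ^ p ∂P ≤ ENNReal.ofReal (M * ((t : ℝ) - s) ^ 2)) (K : ℕ) :
    ∀ᵐ ω ∂P, ∃ C : ℝ, ∀ n i : ℕ, i < K * 2 ^ n →
      |X (((i + 1 : ℕ) : ℝ≥0) / 2 ^ n) ω - X ((i : ℝ≥0) / 2 ^ n) ω| ^ p ≤ C * (2 / 3) ^ n := by
  set D : ℕ → ℕ → Ω → ℝ≥0∞ := fun n i ω =>
    ‖X (((i + 1 : ℕ) : ℝ≥0) / 2 ^ n) ω - X ((i : ℝ≥0) / 2 ^ n) ω‖ₑ ^ p with hD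
  have hDm : ∀ n i, Measurable (D n i) := fun n i =>
    ((hX _).sub (hX _)).enorm.pow_const p
  set S : Ω → ℝ≥0∞ := fun ω => ∑' n : ℕ, ENNReal.ofReal ((3 / 2) ^ n) *
    ∑ i ∈ Finset.range (K * 2 ^ n), D n i ω with hS
  have hSint : ∫⁻ ω, S ω ∂P ≠ ∞ := by
    have hle : ∫⁻ ω, S ω ∂P ≤ ∑' n : ℕ, ENNReal.ofReal (|M| * K * (3 / 4) ^ n) := by
      rw [hS, lintegral_tsum fun n => (Measurable.const_mul
        (Finset.measurable_fun_sum _ fun i _ => hDm n i) _).aemeasurable]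
      refine ENNReal.tsum_le_tsum fun n => ?_
      rw [lintegral_const_mul _ (Finset.measurable_fun_sum _ fun i _ => hDm n i),
        lintegral_finsetSum _ fun i _ => hDm n i]
      have hi : ∀ i ∈ Finset.range (K * 2 ^ n), ∫⁻ ω, D n i ω ∂P
          ≤ ENNReal.ofReal (|M| * (1 / 4) ^ n) := fun i _ => by
        have hdiff : ((((i + 1 : ℕ) : ℝ≥0) / 2 ^ n : ℝ≥0) : ℝ) - (((i : ℝ≥0) / 2 ^ n : ℝ≥0) : ℝ)
            = (1 / 2) ^ n := by
          push_cast
          rw [← sub_div, add_sub_cancel_left, div_pow, one_pow]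
        refine (h _ _ (by gcongr; simp) ?_).trans (ENNReal.ofReal_le_ofReal ?_)
        · rw [← NNReal.coe_le_coe, NNReal.coe_add, ← sub_le_iff_le_add', hdiff]
          exact pow_le_one₀ (by norm_num) (by norm_num)
        · rw [hdiff, ← pow_mul, mul_comm n 2, pow_mul]
          rw [show ((1 : ℝ) / 2) ^ 2 = 1 / 4 by norm_num]
          exact mul_le_mul_of_nonneg_right (le_abs_self M) (by positivity)
      calc _ ≤ ENNReal.ofReal ((3 / 2) ^ n) *
            ∑ i ∈ Finset.range (K * 2 ^ n), ENNReal.ofReal (|M| * (1 / 4) ^ n) :=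
            mul_le_mul' le_rfl (Finset.sum_le_sum hi)
        _ = _ := by
            rw [Finset.sum_const, Finset.card_range, nsmul_eq_mul, ← ENNReal.ofReal_natCast,
              ← ENNReal.ofReal_mul (by positivity), ← ENNReal.ofReal_mul (by positivity)]
            congr 1
            push_cast
            have : (3 / 4 : ℝ) ^ n = (3 / 2) ^ n * (2 ^ n * (1 / 4) ^ n) := by
              rw [← mul_pow, ← mul_pow]; norm_num
            rw [this]
            ring
    refine ne_top_of_le_ne_top ?_ hle
    have hs : Summable fun n : ℕ => |M| * K * (3 / 4 : ℝ) ^ n :=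
      (summable_geometric_of_lt_one (by norm_num) (by norm_num)).mul_left _
    exact hs.tsum_ofReal_ne_top
  have hSm : Measurable S := Measurable.tsum fun n => Measurable.const_mul
    (Finset.measurable_fun_sum _ fun i _ => hDm n i) _
  filter_upwards [ae_lt_top hSm hSint] with ω hω
  refine ⟨(S ω).toReal, fun n i hi => ?_⟩
  have h1 : ENNReal.ofReal ((3 / 2) ^ n) * D n i ω ≤ S ω := by
    refine le_trans ?_ (ENNReal.le_tsum n)
    gcongr
    exact Finset.single_le_sum (f := fun i => D n i ω) (fun _ _ => zero_le)
      (Finset.mem_range.2 hi)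
  have h2 := ENNReal.toReal_mono hω.ne h1
  rw [ENNReal.toReal_mul, ENNReal.toReal_ofReal (by positivity), hD] at h2
  simp only [ENNReal.toReal_pow, toReal_enorm, Real.norm_eq_abs] at h2
  calc _ = (3 / 2 : ℝ) ^ n * |X (((i + 1 : ℕ) : ℝ≥0) / 2 ^ n) ω - X ((i : ℝ≥0) / 2 ^ n) ω| ^ p
        * (2 / 3) ^ n := by
        rw [mul_right_comm, ← mul_pow]; norm_num
    _ ≤ _ := by gcongr

/-- **Kolmogorov's continuity theorem** on the half-line. -/
theorem exists_continuous_modification {X : ℝ≥0 → Ω → ℝ} (hX : ∀ t, Measurable (X t)) {p : ℕ}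
    (hp : p ≠ 0) {M : ℝ} (h : ∀ s t : ℝ≥0, s ≤ t → t ≤ s + 1 →
      ∫⁻ ω, ‖X t ω - X s ω‖ₑ ^ p ∂P ≤ ENNReal.ofReal (M * ((t : ℝ) - s) ^ 2)) :
    ∃ Y : ℝ≥0 → Ω → ℝ, (∀ ω, Continuous (Y · ω)) ∧ (∀ t, Measurable (Y t)) ∧
      ∀ t, Y t =ᵐ[P] X t := by
  have hgood : ∀ᵐ ω ∂P, ∃ y : ℝ≥0 → ℝ, Continuous y ∧
      ∀ t, Tendsto (fun n => X (dyadicFloor n t) ω) atTop (𝓝 (y t)) := by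
    filter_upwards [ae_all_iff.2 (ae_dyadic_increments_le hX h)] with ω hω
    -- The bound concerns `p`-th powers, so both the ratio `2/3` and the constant `C` enter through
    -- their `p`-th roots.
    refine exists_continuous_of_dyadic_increments (x := fun t => X t ω)
      (r := (2 / 3 : ℝ) ^ (p : ℝ)⁻¹) (by positivity)
      (Real.rpow_lt_one (by norm_num) (by norm_num) (by positivity)) fun K => ?_
    obtain ⟨C, hC⟩ := hω K
    refine ⟨|C| ^ (p : ℝ)⁻¹, fun n i hi => ?_⟩
    have h1 := (hC n i hi).trans (mul_le_mul_of_nonneg_right (le_abs_self C) (by positivity))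
    rw [← Real.rpow_natCast, ← Real.rpow_mul (by norm_num), mul_comm (p : ℝ)⁻¹,
      Real.rpow_mul (by norm_num), Real.rpow_natCast, ← Real.mul_rpow (abs_nonneg _)
      (by positivity), Real.le_rpow_inv_iff_of_pos (abs_nonneg _) (by positivity)
      (by positivity), Real.rpow_natCast]
    exact h1
  -- The exceptional set is enlarged to a measurable null set on which the process is replaced by
  -- zero. The limit then exists everywhere and is measurable.
  obtain ⟨N, hNsub, hNm, hN0⟩ := exists_measurable_superset_of_null hgood
  have hy : ∀ ω, ∃ y : ℝ≥0 → ℝ, Continuous y ∧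
      ∀ t, Tendsto (fun n => Nᶜ.indicator (fun ω => X (dyadicFloor n t) ω) ω) atTop
        (𝓝 (y t)) := by
    intro ω
    by_cases hω : ω ∈ N
    · exact ⟨fun _ => 0, continuous_const, fun t => by
        simp [Set.indicator, hω]⟩
    · obtain ⟨y, hy, hyt⟩ : ∃ y : ℝ≥0 → ℝ, Continuous y ∧
          ∀ t, Tendsto (fun n => X (dyadicFloor n t) ω) atTop (𝓝 (y t)) := by
        by_contra hcon
        exact hω (hNsub hcon)
      exact ⟨y, hy, fun t => by simpa [Set.indicator, hω] using hyt t⟩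
  choose y hyc hyt using hy
  refine ⟨fun t ω => y ω t, hyc, fun t => measurable_of_tendsto_metrizable
    (fun n => (hX (dyadicFloor n t)).indicator hNm.compl)
    (tendsto_pi_nhds.2 fun ω => hyt ω t), fun t => ?_⟩
  have hNae : ∀ᵐ ω ∂P, ω ∉ N := by rwa [ae_iff, show {ω | ¬ω ∉ N} = N by ext; simp]
  -- By Fatou along the dyadic approximations of `t`, the moment bound shows that the limit is still
  -- a version of `X t`.
  have hlim0 : ∫⁻ ω, ‖X t ω - y ω t‖ₑ ^ p ∂P = 0 := by
    have hconv : ∀ᵐ ω ∂P, ‖X t ω - y ω t‖ₑ ^ p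
        = liminf (fun n => ‖X t ω - X (dyadicFloor n t) ω‖ₑ ^ p) atTop := by
      filter_upwards [hNae] with ω hω
      have h1 : Tendsto (fun n => X (dyadicFloor n t) ω) atTop (𝓝 (y ω t)) := by
        simpa [Set.indicator, hω] using hyt ω t
      exact (((ENNReal.continuous_pow p).tendsto _).comp
        (h1.const_sub (X t ω)).enorm).liminf_eq.symm
    rw [lintegral_congr_ae hconv]
    refine le_antisymm ((lintegral_liminf_le fun n =>
      ((hX t).sub (hX _)).enorm.pow_const p).trans ?_) zero_le
    have hb : ∀ n, ∫⁻ ω, ‖X t ω - X (dyadicFloor n t) ω‖ₑ ^ p ∂P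
        ≤ ENNReal.ofReal (M * ((t : ℝ) - dyadicFloor n t) ^ 2) := fun n =>
      h _ _ (dyadicFloor_le n t) ((le_dyadicFloor_add n t).trans
        (by gcongr; exact div_le_one_of_le₀ (one_le_pow₀ one_le_two) (by positivity)))
    have h0 : Tendsto (fun n => ENNReal.ofReal (M * ((t : ℝ) - dyadicFloor n t) ^ 2)) atTop
        (𝓝 (ENNReal.ofReal (M * ((t : ℝ) - t) ^ 2))) :=
      ENNReal.tendsto_ofReal (((((NNReal.continuous_coe.tendsto t).comp
        (tendsto_dyadicFloor t)).const_sub (t : ℝ)).pow 2).const_mul M)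
    rw [sub_self, zero_pow two_ne_zero, mul_zero, ENNReal.ofReal_zero] at h0
    exact (liminf_le_liminf (Eventually.of_forall hb)).trans h0.liminf_eq.le
  have hym : Measurable fun ω => y ω t := measurable_of_tendsto_metrizable
    (fun n => (hX (dyadicFloor n t)).indicator hNm.compl)
    (tendsto_pi_nhds.2 fun ω => hyt ω t)
  have hlim1 := (lintegral_eq_zero_iff (((hX t).sub hym).enorm.pow_const p)).1 hlim0
  filter_upwards [hlim1] with ω hω
  have h1 : ‖X t ω - y ω t‖ₑ = 0 := pow_eq_zero_iff hp |>.1 hω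
  rw [enorm_eq_zero, sub_eq_zero] at h1
  exact h1.symm

/-- A process with almost surely continuous paths which at each time agrees almost surely with
an `F t`-measurable variable has an adapted modification, indistinguishable from it. -/
theorem exists_adapted_of_ae_eq {F : Filtration ℝ≥0 mΩ} {X Y : ℝ≥0 → Ω → ℝ}
    (hX : ∀ t, AEStronglyMeasurable[F t] (X t) P) (hXY : ∀ t, X t =ᵐ[P] Y t)
    (hY : ∀ᵐ ω ∂P, Continuous (Y · ω)) :
    ∃ V : ℝ≥0 → Ω → ℝ, StronglyAdapted F V ∧ ∀ᵐ ω ∂P, ∀ t, V t ω = Y t ω := by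
  choose X' hX' hXX' using hX
  -- `F` is not assumed to contain the null sets, so exact measurability is built in: only
  -- `F`-measurable representatives at dyadic times not exceeding `t` are used.
  refine ⟨fun t ω => limsup (fun n => X' (dyadicFloor n t) ω) atTop, fun t => ?_, ?_⟩
  · exact (Measurable.limsup fun n =>
      ((hX' (dyadicFloor n t)).mono (F.mono (dyadicFloor_le n t))).measurable).stronglyMeasurable
  · have hall : ∀ᵐ ω ∂P, ∀ n k : ℕ, X' ((k : ℝ≥0) / 2 ^ n) ω = Y ((k : ℝ≥0) / 2 ^ n) ω :=
      ae_all_iff.2 fun n => ae_all_iff.2 fun k => (hXX' _).symm.trans (hXY _)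
    filter_upwards [hall, hY] with ω hω hc t
    have : (fun n => X' (dyadicFloor n t) ω) = fun n => Y (dyadicFloor n t) ω :=
      funext fun n => hω n _
    simp only [this]
    exact ((hc.tendsto t).comp (tendsto_dyadicFloor t)).limsup_eq

/-- The absolute moments of a centered Gaussian variable. -/
theorem lintegral_enorm_pow_of_map_eq_gaussianReal {f : Ω → ℝ} (hf : AEMeasurable f P) {c : ℝ≥0}
    (h : P.map f = gaussianReal 0 (c ^ 2)) (p : ℕ) :
    ∫⁻ ω, ‖f ω‖ₑ ^ p ∂P = (c : ℝ≥0∞) ^ p * ∫⁻ x, ‖x‖ₑ ^ p ∂(gaussianReal 0 1) := by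
  have h1 : P.map f = (gaussianReal 0 1).map ((c : ℝ) * ·) := by
    rw [h, gaussianReal_map_const_mul, mul_zero, mul_one]
    rfl
  rw [← lintegral_map' (f := fun x : ℝ => ‖x‖ₑ ^ p) (by fun_prop) hf, h1,
    lintegral_map (by fun_prop) (by fun_prop), ← lintegral_const_mul _ (by fun_prop)]
  refine lintegral_congr fun x => ?_
  rw [enorm_mul, mul_pow]
  simp

theorem lintegral_enorm_pow_gaussianReal_ne_top (p : ℕ) :
    ∫⁻ x, ‖x‖ₑ ^ p ∂(gaussianReal 0 1) ≠ ∞ := by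
  rcases eq_or_ne p 0 with rfl | hp
  · simp
  have h := (memLp_id_gaussianReal' (μ := 0) (v := 1) (p : ℝ≥0∞) (by simp)).eLpNorm_lt_top
  rw [eLpNorm_lt_top_iff_lintegral_rpow_enorm_lt_top (by simpa using hp) (by simp)] at h
  simpa using h.ne

/-- A curve in a Gaussian space which is Hölder continuous in `L²` has a continuous modification. -/
theorem exists_continuous_modification_of_mem [IsProbabilityMeasure P] {ι : Type*}
    {Z : ι → Ω → ℝ} (hZ : ∀ i, MemLp (Z i) 2 P) (hG : IsGaussianProcess Z P)
    (h0 : ∀ i, ∫ ω, Z i ω ∂P = 0) {x : ℝ → Lp ℝ 2 P} (hx : ∀ t, 0 ≤ t → x t ∈ gaussianSpan hZ)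
    {K δ : ℝ} (hδ : 0 < δ)
    (h : ∀ s t, 0 ≤ s → s ≤ t → t ≤ s + 1 → ‖x t - x s‖ ^ 2 ≤ K * (t - s) ^ δ) :
    ∃ Y : ℝ≥0 → Ω → ℝ, (∀ ω, Continuous (Y · ω)) ∧ (∀ t, Measurable (Y t)) ∧
      ∀ t : ℝ≥0, Y t =ᵐ[P] x t := by
  -- A Gaussian moment of order `2k` is a constant times the `k`-th power of the variance, hence of
  -- order `(t - s)^(δ k)`. With `δ k ≥ 2` and `t - s ≤ 1` this is at most `(t - s)^2`.
  obtain ⟨k, hk⟩ := exists_nat_ge (2 / δ)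
  have hk2 : 2 ≤ δ * k := by rwa [div_le_iff₀' hδ] at hk
  have hk0 : k ≠ 0 := by
    rintro rfl
    norm_num at hk2
  set m := ∫⁻ x, ‖x‖ₑ ^ (2 * k) ∂(gaussianReal 0 1) with hm
  have hmt : m ≠ ∞ := lintegral_enorm_pow_gaussianReal_ne_top _
  refine exists_continuous_modification (X := fun t => x t)
    (fun t => (Lp.stronglyMeasurable (x t)).measurable) (p := 2 * k) (by omega)
    (M := |K| ^ k * m.toReal) fun s t hst hts => ?_
  have hst' : (s : ℝ) ≤ t := hst
  have hts' : (t : ℝ) ≤ s + 1 := hts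
  have h1 : ∫⁻ ω, ‖x t ω - x s ω‖ₑ ^ (2 * k) ∂P
      = ∫⁻ ω, ‖(x t - x s) ω‖ₑ ^ (2 * k) ∂P := by
    refine lintegral_congr_ae ?_
    filter_upwards [Lp.coeFn_sub (x t) (x s)] with ω hω
    rw [hω, Pi.sub_apply]
  rw [h1, lintegral_enorm_pow_of_map_eq_gaussianReal (Lp.aestronglyMeasurable _).aemeasurable
    (map_eq_gaussianReal_of_mem hZ hG h0
      (Submodule.sub_mem _ (hx t t.2) (hx s s.2))) (2 * k), ← hm, ← ENNReal.ofReal_toReal hmt]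
  have h2 : ((‖x t - x s‖₊ : ℝ≥0∞)) ^ (2 * k) = ENNReal.ofReal ((‖x t - x s‖ ^ 2) ^ k) := by
    rw [← pow_mul, ENNReal.ofReal_pow (norm_nonneg _), ofReal_norm, enorm_eq_nnnorm]
  rw [h2, ← ENNReal.ofReal_mul (by positivity)]
  refine ENNReal.ofReal_le_ofReal ?_
  have hd0 : 0 ≤ (t : ℝ) - s := sub_nonneg.2 hst'
  have h3 : (‖x t - x s‖ ^ 2) ^ k ≤ |K| ^ k * ((t : ℝ) - s) ^ 2 := by
    calc (‖x t - x s‖ ^ 2) ^ k ≤ (|K| * ((t : ℝ) - s) ^ δ) ^ k := by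
          gcongr
          exact (h s t s.2 hst' hts').trans (mul_le_mul_of_nonneg_right (le_abs_self K)
            (by positivity))
      _ = |K| ^ k * ((t : ℝ) - s) ^ (δ * k) := by
          rw [mul_pow, Real.rpow_mul_natCast hd0]
      _ ≤ |K| ^ k * ((t : ℝ) - s) ^ (2 : ℝ) := by
          gcongr ?_ * ?_
          rcases hd0.eq_or_lt with hz | hpos
          · rw [← hz, Real.zero_rpow (by positivity), Real.zero_rpow (by positivity)]
          · exact Real.rpow_le_rpow_of_exponent_ge hpos (by linarith) hk2
      _ = _ := by norm_num
  rw [ENNReal.toReal_ofReal ENNReal.toReal_nonneg]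
  calc _ ≤ |K| ^ k * ((t : ℝ) - s) ^ 2 * m.toReal := by gcongr
    _ = _ := by ring

end Continuity

/-! ### Pathwise integrals against integrals in `L²` -/

section PathwiseIntegral

variable {Ω : Type*} {mΩ : MeasurableSpace Ω} {P : Measure Ω} [IsProbabilityMeasure P]
  {S : Type*} [MeasurableSpace S] {μ : Measure S}

theorem integrable_uncurry_of_integrable_Lp {y : S → Ω → ℝ} (hy : Measurable (Function.uncurry y))
    {u : S → Lp ℝ 2 P} (hu : Integrable u μ) (hyu : ∀ᵐ s ∂μ, y s =ᵐ[P] u s) :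
    Integrable (Function.uncurry y) (μ.prod P) := by
  rw [integrable_prod_iff hy.aestronglyMeasurable]
  constructor
  · filter_upwards [hyu] with s hs
    exact ((Lp.memLp (u s)).integrable (by norm_num)).congr hs.symm
  · refine hu.norm.mono' hy.stronglyMeasurable.norm.integral_prod_right'.aestronglyMeasurable ?_
    filter_upwards [hyu] with s hs
    rw [Real.norm_of_nonneg (integral_nonneg fun _ => norm_nonneg _)]
    refine le_trans (le_of_eq (integral_congr_ae ?_)) (integral_abs_le_norm (u s))
    filter_upwards [hs] with ω hω
    rw [Function.uncurry_apply_pair, hω, Real.norm_eq_abs]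

/-- The pathwise integral of a process is a version of its integral in `L²`. -/
theorem integral_ae_eq_of_integrable_Lp [SFinite μ] {y : S → Ω → ℝ} (hy : Measurable (Function.uncurry y))
    {u : S → Lp ℝ 2 P} (hu : Integrable u μ) (hyu : ∀ᵐ s ∂μ, y s =ᵐ[P] u s) :
    (fun ω => ∫ s, y s ω ∂μ) =ᵐ[P] (∫ s, u s ∂μ : Lp ℝ 2 P) := by
  have hint := integrable_uncurry_of_integrable_Lp hy hu hyu
  refine Integrable.ae_eq_of_forall_setIntegral_eq _ _ hint.swap.integral_prod_left
    ((Lp.memLp _).integrable (by norm_num)) fun A hA hPA => ?_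
  have hintA : Integrable (Function.uncurry y) (μ.prod (P.restrict A)) := by
    rw [← Measure.restrict_univ (μ := μ), Measure.prod_restrict]
    exact hint.integrableOn
  -- Both sides are tested on an event `A`: pairing with its indicator commutes with the `L²`-valued
  -- integral, and Fubini handles the pathwise one.
  rw [← L2.inner_indicatorConstLp_one (𝕜 := ℝ) hA hPA.ne, ← integral_inner hu,
    ← integral_integral_swap hintA]
  refine integral_congr_ae ?_
  filter_upwards [hyu] with s hs
  rw [L2.inner_indicatorConstLp_one]
  exact setIntegral_congr_ae hA (hs.mono fun ω h _ => h)

end PathwiseIntegral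

/-! ### Continuous versions of `t^(2H-1) M t` and of the Brownian curve -/

namespace IsPowerMartingaleCurve

/-- For `H < 1/2` the factor `t^(2H-1)` blows up at `0`, so the product is estimated as a whole. Its
squared increment is `c (t^(2H) + s^(2H) - 2 t^(2H-1) s)`, at most `2c t^(2H-1) (t - s)`, and
`t^(2H-1) ≤ (t - s)^(2H-1)`. -/
theorem norm_rpow_smul_sub_sq_le {E : Type*} [NormedAddCommGroup E] [InnerProductSpace ℝ E]
    {H c : ℝ} {M : ℝ → E} (hM : IsPowerMartingaleCurve H c M) (hH : H ≤ 1 / 2) {s t : ℝ}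
    (hs : 0 ≤ s) (hst : s ≤ t) :
    ‖t ^ (2 * H - 1) • M t - s ^ (2 * H - 1) • M s‖ ^ 2 ≤ 2 * c * (t - s) ^ (2 * H) := by
  have h1 := hM.pos
  have hc := hM.const_pos
  have hsq : ∀ r, 0 ≤ r → (r ^ (2 * H - 1)) ^ 2 * (c * r ^ (2 - 2 * H)) = c * r ^ (2 * H) := by
    intro r hr
    rcases hr.eq_or_lt with rfl | hr
    · rw [Real.zero_rpow (x := 2 * H) (by positivity),
        Real.zero_rpow (x := 2 - 2 * H) (by linarith), mul_zero, mul_zero]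
    · rw [← Real.rpow_natCast, ← Real.rpow_mul hr.le, mul_left_comm, ← Real.rpow_add hr]
      congr 2
      push_cast
      ring
  rcases hs.eq_or_lt with rfl | hs
  · have h0 : M 0 = 0 := by
      rw [← norm_eq_zero, ← sq_eq_zero_iff, hM.norm_sq le_rfl, Real.zero_rpow (by linarith),
        mul_zero]
    rw [h0, smul_zero, sub_zero, sub_zero, norm_smul, mul_pow, hM.norm_sq hst, Real.norm_eq_abs,
      sq_abs, hsq t hst]
    have : 0 ≤ c * t ^ (2 * H) := by positivity
    linarith
  have ht : 0 < t := hs.trans_le hst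
  have hinner : ⟪t ^ (2 * H - 1) • M t, s ^ (2 * H - 1) • M s⟫ = c * (t ^ (2 * H - 1) * s) := by
    rw [real_inner_smul_left, real_inner_smul_right, hM.inner_eq t s ht.le hs.le,
      min_eq_right hst]
    have : s ^ (2 * H - 1) * s ^ (2 - 2 * H) = s := by
      rw [← Real.rpow_add hs]
      ring_nf
      exact Real.rpow_one s
    linear_combination c * t ^ (2 * H - 1) * this
  rw [norm_sub_sq_real, hinner, norm_smul, norm_smul, mul_pow, mul_pow, hM.norm_sq ht.le,
    hM.norm_sq hs.le, Real.norm_eq_abs, Real.norm_eq_abs, sq_abs, sq_abs, hsq t ht.le,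
    hsq s hs.le]
  have e1 : t ^ (2 * H) = t ^ (2 * H - 1) * t := by
    rw [Real.rpow_sub_one ht.ne', div_mul_cancel₀ _ ht.ne']
  have e2 : s ^ (2 * H) ≤ t ^ (2 * H) := by gcongr
  have e3 : t ^ (2 * H - 1) * (t - s) ≤ (t - s) ^ (2 * H) := by
    rcases hst.eq_or_lt with rfl | hlt
    · rw [sub_self, mul_zero]
      positivity
    · have hpos : 0 < t - s := sub_pos.2 hlt
      rw [← sub_add_cancel (2 * H) 1, Real.rpow_add_one hpos.ne', add_sub_cancel_right]
      gcongr ?_ * _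
      exact Real.rpow_le_rpow_of_nonpos hpos (by linarith) (by linarith)
  nlinarith

variable {Ω ι : Type*} {mΩ : MeasurableSpace Ω} {P : Measure Ω} [IsProbabilityMeasure P]
  {Z : ι → Ω → ℝ} {H c : ℝ} {M : ℝ → Lp ℝ 2 P}

theorem exists_continuous_rpow_smul (hM : IsPowerMartingaleCurve H c M)
    (hZ : ∀ i, MemLp (Z i) 2 P) (hG : IsGaussianProcess Z P) (h0 : ∀ i, ∫ ω, Z i ω ∂P = 0)
    (hmem : ∀ t, 0 ≤ t → M t ∈ gaussianSpan hZ) :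
    ∃ Y : ℝ≥0 → Ω → ℝ, (∀ ω, Continuous (Y · ω)) ∧ (∀ t, Measurable (Y t)) ∧
      ∀ t : ℝ≥0, Y t =ᵐ[P] ((t : ℝ) ^ (2 * H - 1) • M t : Lp ℝ 2 P) := by
  have h1 := hM.pos
  have h2 := hM.lt_one
  have hc := hM.const_pos
  rcases le_total H (1 / 2) with hH | hH
  · exact exists_continuous_modification_of_mem hZ hG h0 (x := fun t => t ^ (2 * H - 1) • M t)
      (fun t ht => Submodule.smul_mem _ _ (hmem t ht)) (δ := 2 * H) (by positivity)
      fun s t hs hst _ => hM.norm_rpow_smul_sub_sq_le hH hs hst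
  -- For `H ≥ 1/2` the deterministic factor is continuous, so a continuous version of `M` suffices.
  -- Its variance increments are controlled by subadditivity of `x ↦ x^(2-2H)`, whose exponent is at
  -- most `1`.
  · obtain ⟨Y, hYc, hYm, hY⟩ := exists_continuous_modification_of_mem hZ hG h0 hmem
      (K := c) (δ := 2 - 2 * H) (by linarith) fun s t hs hst _ => by
        rw [hM.norm_sub_sq hs hst]
        gcongr
        rw [sub_le_iff_le_add']
        simpa using Real.rpow_add_le_add_rpow hs (sub_nonneg.2 hst)
          (p := 2 - 2 * H) (by linarith) (by linarith)
    refine ⟨fun t ω => (t : ℝ) ^ (2 * H - 1) * Y t ω, fun ω => ?_, fun t => (hYm t).const_mul _,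
      fun t => ?_⟩
    · exact ((Real.continuous_rpow_const (by linarith)).comp NNReal.continuous_coe).mul (hYc ω)
    · filter_upwards [hY t, Lp.coeFn_smul ((t : ℝ) ^ (2 * H - 1)) (M t)] with ω hω h
      rw [h, Pi.smul_apply, smul_eq_mul, hω]

theorem exists_continuous_brownianCurve (hM : IsPowerMartingaleCurve H c M)
    (hZ : ∀ i, MemLp (Z i) 2 P) (hG : IsGaussianProcess Z P) (h0 : ∀ i, ∫ ω, Z i ω ∂P = 0)
    (hmem : ∀ t, 0 ≤ t → brownianCurve H c M t ∈ gaussianSpan hZ) :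
    ∃ Y : ℝ≥0 → Ω → ℝ, (∀ ω, Continuous (Y · ω)) ∧ (∀ t, Measurable (Y t)) ∧
      ∀ t : ℝ≥0, Y t =ᵐ[P] (brownianCurve H c M t : Lp ℝ 2 P) :=
  exists_continuous_modification_of_mem hZ hG h0 hmem (K := 1) one_pos fun s t hs hst _ => by
    have ht := hs.trans hst
    rw [norm_sub_sq_real, ← real_inner_self_eq_norm_sq, ← real_inner_self_eq_norm_sq,
      hM.inner_brownianCurve ht ht, hM.inner_brownianCurve ht hs, hM.inner_brownianCurve hs hs,
      min_self, min_self, min_eq_right hst, Real.rpow_one]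
    linarith

/-- The pathwise integral `∫₀ᵗ s⁻¹ V s ds` exists and represents the corresponding integral
in `L²`, where `V t = k t^(2H-1) M t`. -/
theorem integral_inv_mul_ae_eq (hM : IsPowerMartingaleCurve H c M) {k : ℝ}
    {Y : ℝ≥0 → Ω → ℝ} (hYc : ∀ ω, Continuous (Y · ω)) (hYm : ∀ t, Measurable (Y t))
    (hY : ∀ t : ℝ≥0, Y t =ᵐ[P] ((k * (t : ℝ) ^ (2 * H - 1)) • M t : Lp ℝ 2 P)) {t : ℝ}
    (ht : 0 ≤ t) :
    (∀ᵐ ω ∂P, IntervalIntegrable (fun s : ℝ => s⁻¹ * Y s.toNNReal ω) volume 0 t) ∧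
    (fun ω => ∫ s in (0 : ℝ)..t, s⁻¹ * Y s.toNNReal ω) =ᵐ[P]
      (k • ∫ s in (0 : ℝ)..t, s ^ (2 * H - 1 - 1) • M s : Lp ℝ 2 P) := by
  have h1 := hM.pos
  have hmeas : Measurable (Function.uncurry fun (s : ℝ) (ω : Ω) => s⁻¹ * Y s.toNNReal ω) := by
    have hYu : Measurable (Function.uncurry Y) :=
      measurable_uncurry_of_continuous_of_measurable hYc hYm
    exact measurable_fst.inv.mul (hYu.comp
      ((measurable_real_toNNReal.comp measurable_fst).prodMk measurable_snd))
  have hu : Integrable (fun s : ℝ => k • s ^ (2 * H - 1 - 1) • M s)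
      (volume.restrict (Set.Ioc 0 t)) :=
    ((intervalIntegrable_iff_integrableOn_Ioc_of_le ht).1
      (hM.intervalIntegrable (e := 2 * H - 1) (by linarith) ht)).smul k
  have hyu : ∀ᵐ s ∂(volume.restrict (Set.Ioc 0 t)), (fun ω => s⁻¹ * Y s.toNNReal ω) =ᵐ[P]
      (k • s ^ (2 * H - 1 - 1) • M s : Lp ℝ 2 P) := by
    refine (ae_restrict_iff' measurableSet_Ioc).2 (Eventually.of_forall fun s hs => ?_)
    have e : k • s ^ (2 * H - 1 - 1) • M s
        = s⁻¹ • (k * ((s.toNNReal : ℝ≥0) : ℝ) ^ (2 * H - 1)) • M (s.toNNReal : ℝ≥0) := by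
      rw [Real.coe_toNNReal _ hs.1.le, smul_smul, smul_smul, Real.rpow_sub_one hs.1.ne']
      congr 1
      ring
    rw [e]
    filter_upwards [hY s.toNNReal, Lp.coeFn_smul s⁻¹
      ((k * ((s.toNNReal : ℝ≥0) : ℝ) ^ (2 * H - 1)) • M (s.toNNReal : ℝ≥0))] with ω hω h
    rw [h, Pi.smul_apply, smul_eq_mul, hω]
  constructor
  · have := (integrable_uncurry_of_integrable_Lp hmeas hu hyu).prod_left_ae
    filter_upwards [this] with ω hω
    exact (intervalIntegrable_iff_integrableOn_Ioc_of_le ht).2 hω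
  · have := integral_ae_eq_of_integrable_Lp hmeas hu hyu
    rw [integral_smul, ← intervalIntegral.integral_of_le ht] at this
    simpa only [← intervalIntegral.integral_of_le ht] using this

end IsPowerMartingaleCurve

/-! ### Step integrals, their isometry and dyadic approximation of powers -/

section StepFunctions

/-- The step function with value `a i` on `(τ i, τ (i + 1)]` for `i < n`. -/
noncomputable def stepFun (n : ℕ) (τ a : ℕ → ℝ) (s : ℝ) : ℝ :=
  ∑ i ∈ Finset.range n, (Set.Ioc (τ i) (τ (i + 1))).indicator (fun _ => a i) s

/-- The integral of a step function over `[0, t]` against the increments of a curve `w`. -/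
noncomputable def stepIntegral {E : Type*} [AddCommGroup E] [Module ℝ E] (n : ℕ) (τ a : ℕ → ℝ)
    (w : ℝ → E) (t : ℝ) : E :=
  ∑ i ∈ Finset.range n, a i • (w (min (τ (i + 1)) t) - w (min (τ i) t))

variable {E : Type*} [NormedAddCommGroup E] [InnerProductSpace ℝ E] {n : ℕ} {τ a : ℕ → ℝ}

theorem stepFun_mul (h : ℝ → ℝ) (s : ℝ) : stepFun n τ a s * h s =
    ∑ i ∈ Finset.range n, (Set.Ioc (τ i) (τ (i + 1))).indicator (fun s => a i * h s) s := by
  rw [stepFun, Finset.sum_mul]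
  refine Finset.sum_congr rfl fun i _ => ?_
  by_cases hs : s ∈ Set.Ioc (τ i) (τ (i + 1)) <;> simp [hs]

theorem intervalIntegrable_stepFun_mul {h : ℝ → ℝ} {t : ℝ} (ht : 0 ≤ t)
    (hh : IntervalIntegrable h volume 0 t) :
    IntervalIntegrable (fun s => stepFun n τ a s * h s) volume 0 t := by
  rw [intervalIntegrable_iff_integrableOn_Ioc_of_le ht] at hh ⊢
  simp only [stepFun_mul]
  exact integrable_finsetSum _ fun i _ => (hh.const_mul (a i)).indicator measurableSet_Ioc

theorem intervalIntegrable_stepFun {t : ℝ} (ht : 0 ≤ t) :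
    IntervalIntegrable (stepFun n τ a) volume 0 t := by
  simpa using intervalIntegrable_stepFun_mul (n := n) (τ := τ) (a := a) ht
    (intervalIntegrable_const (c := (1 : ℝ)))

theorem integral_stepFun_mul (hτ : Monotone τ) (h0 : 0 ≤ τ 0) {h : ℝ → ℝ} {t : ℝ} (ht : 0 ≤ t)
    (hh : IntervalIntegrable h volume 0 t) :
    ∫ s in (0 : ℝ)..t, stepFun n τ a s * h s =
      ∑ i ∈ Finset.range n, a i * ((∫ s in (0 : ℝ)..(min (τ (i + 1)) t), h s)
        - ∫ s in (0 : ℝ)..(min (τ i) t), h s) := by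
  have hτ0 : ∀ i, 0 ≤ τ i := fun i => h0.trans (hτ (Nat.zero_le i))
  have hh' := (intervalIntegrable_iff_integrableOn_Ioc_of_le ht).1 hh
  simp only [stepFun_mul]
  rw [intervalIntegral.integral_of_le ht, integral_finsetSum _ fun i _ =>
    (hh'.const_mul (a i)).indicator measurableSet_Ioc]
  refine Finset.sum_congr rfl fun i _ => ?_
  have hsub : ∀ v, 0 ≤ v → IntervalIntegrable h volume 0 (min v t) := fun v hv =>
    hh.mono_set (by
      rw [Set.uIcc_of_le (le_min hv ht), Set.uIcc_of_le ht]
      exact Set.Icc_subset_Icc_right (min_le_right _ _))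
  have hset : Set.Ioc 0 t ∩ Set.Ioc (τ i) (τ (i + 1))
      = Set.Ioc (min (τ i) t) (min (τ (i + 1)) t) := by
    ext s
    simp only [Set.mem_inter_iff, Set.mem_Ioc, le_min_iff, min_lt_iff]
    constructor
    · rintro ⟨⟨_, h2⟩, h3, h4⟩
      exact ⟨Or.inl h3, h4, h2⟩
    · rintro ⟨h1 | h1, h2, h3⟩
      · exact ⟨⟨(hτ0 i).trans_lt h1, h3⟩, h1, h2⟩
      · exact absurd h3 (not_le.2 h1)
  rw [intervalIntegral.integral_interval_sub_left (hsub _ (hτ0 _)) (hsub _ (hτ0 _)),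
    setIntegral_indicator measurableSet_Ioc, integral_const_mul, hset,
    intervalIntegral.integral_of_le (min_le_min_right _ (hτ (Nat.le_succ i)))]

theorem inner_stepIntegral (hτ : Monotone τ) (h0 : 0 ≤ τ 0) {w : ℝ → E} {y : E} {h : ℝ → ℝ}
    {t : ℝ} (ht : 0 ≤ t) (hh : IntervalIntegrable h volume 0 t)
    (hy : ∀ v ∈ Set.Icc 0 t, ⟪w v, y⟫ = ∫ s in (0 : ℝ)..v, h s) :
    ⟪stepIntegral n τ a w t, y⟫ = ∫ s in (0 : ℝ)..t, stepFun n τ a s * h s := by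
  have hτ0 : ∀ i, 0 ≤ τ i := fun i => h0.trans (hτ (Nat.zero_le i))
  rw [integral_stepFun_mul hτ h0 ht hh, stepIntegral, sum_inner]
  refine Finset.sum_congr rfl fun i _ => ?_
  rw [real_inner_smul_left, inner_sub_left, hy _ ⟨le_min (hτ0 _) ht, min_le_right _ _⟩,
    hy _ ⟨le_min (hτ0 _) ht, min_le_right _ _⟩]

theorem intervalIntegrable_stepFun_sub_sq {φ : ℝ → ℝ} {t : ℝ} (ht : 0 ≤ t)
    (hφ : IntervalIntegrable φ volume 0 t)
    (hφ2 : IntervalIntegrable (fun s => φ s ^ 2) volume 0 t) :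
    IntervalIntegrable (fun s => (stepFun n τ a s - φ s) ^ 2) volume 0 t := by
  have hgg := intervalIntegrable_stepFun_mul (n := n) (τ := τ) (a := a) ht
    (intervalIntegrable_stepFun (n := n) (τ := τ) (a := a) ht)
  have hgφ := intervalIntegrable_stepFun_mul (n := n) (τ := τ) (a := a) ht hφ
  refine ((hgg.sub (hgφ.const_mul 2)).add hφ2).congr fun s _ => ?_
  ring

/-- The Itô isometry for the distance between a step integral and a Wiener integral. -/
theorem norm_stepIntegral_sub_sq (hτ : Monotone τ) (h0 : 0 ≤ τ 0) {w : ℝ → E}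
    (hw : ∀ u v, 0 ≤ u → 0 ≤ v → ⟪w u, w v⟫ = min u v) {φ : ℝ → ℝ} {x : E} {t : ℝ} (ht : 0 ≤ t)
    (hφ : IntervalIntegrable φ volume 0 t) (hφ2 : IntervalIntegrable (fun s => φ s ^ 2) volume 0 t)
    (hx : ∀ v ∈ Set.Icc 0 t, ⟪w v, x⟫ = ∫ s in (0 : ℝ)..v, φ s)
    (hxx : ‖x‖ ^ 2 = ∫ s in (0 : ℝ)..t, φ s ^ 2) :
    ‖stepIntegral n τ a w t - x‖ ^ 2 = ∫ s in (0 : ℝ)..t, (stepFun n τ a s - φ s) ^ 2 := by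
  -- Pairing with `w v` integrates the step function against the indicator of `(0, v]`. Thus the
  -- step integral satisfies the hypothesis on `y` in `inner_stepIntegral`, which then yields its
  -- own norm.
  have hself : ∀ v ∈ Set.Icc 0 t,
      ⟪w v, stepIntegral n τ a w t⟫ = ∫ s in (0 : ℝ)..v, stepFun n τ a s := by
    intro v hv
    have h1 : IntervalIntegrable ((Set.Ioc 0 v).indicator fun _ => (1 : ℝ)) volume 0 t := by
      rw [intervalIntegrable_iff_integrableOn_Ioc_of_le ht]
      exact (integrable_const (1 : ℝ)).indicator measurableSet_Ioc
    rw [real_inner_comm, inner_stepIntegral hτ h0 ht h1 fun u hu => ?_]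
    · rw [intervalIntegral.integral_of_le ht, intervalIntegral.integral_of_le hv.1]
      have : (fun s => stepFun n τ a s * (Set.Ioc 0 v).indicator (fun _ => (1 : ℝ)) s)
          = (Set.Ioc 0 v).indicator (stepFun n τ a) := by
        ext s
        by_cases hs : s ∈ Set.Ioc 0 v <;> simp [hs]
      rw [this, setIntegral_indicator measurableSet_Ioc, Set.Ioc_inter_Ioc, max_self,
        min_eq_right hv.2]
    · rw [hw u v hu.1 hv.1, intervalIntegral.integral_of_le hu.1,
        setIntegral_indicator measurableSet_Ioc, Set.Ioc_inter_Ioc, max_self, setIntegral_const]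
      simp [hu.1, hv.1]
  have hg := intervalIntegrable_stepFun (n := n) (τ := τ) (a := a) ht
  have hgg := intervalIntegrable_stepFun_mul (n := n) (τ := τ) (a := a) ht hg
  have hgφ := intervalIntegrable_stepFun_mul (n := n) (τ := τ) (a := a) ht hφ
  have hexp : ∀ s, (stepFun n τ a s - φ s) ^ 2
      = stepFun n τ a s * stepFun n τ a s - 2 * (stepFun n τ a s * φ s) + φ s ^ 2 := fun s => by
    ring
  simp only [hexp]
  rw [norm_sub_sq_real, ← real_inner_self_eq_norm_sq,
    inner_stepIntegral hτ h0 ht hg hself, inner_stepIntegral hτ h0 ht hφ hx, hxx,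
    intervalIntegral.integral_add (hgg.sub (hgφ.const_mul 2)) hφ2,
    intervalIntegral.integral_sub hgg (hgφ.const_mul 2), intervalIntegral.integral_const_mul]

/-- Lower dyadic step values of level `k` of the function `C s ^ e`. -/
noncomputable def dyadicCoef (C e : ℝ) (k i : ℕ) : ℝ :=
  C * min (((i : ℝ) / 2 ^ k) ^ e) ((((i + 1 : ℕ) : ℝ) / 2 ^ k) ^ e)

/-- The lower dyadic step function of level `k` on `(0, k]` of the function `C s ^ e`. -/
noncomputable def dyadicStep (C e : ℝ) (k : ℕ) : ℝ → ℝ :=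
  stepFun (k * 2 ^ k) (fun i => (i : ℝ) / 2 ^ k) (dyadicCoef C e k)

variable {C e : ℝ}

theorem dyadicCoef_nonneg (hC : 0 ≤ C) (k i : ℕ) : 0 ≤ dyadicCoef C e k i := by
  rw [dyadicCoef]
  positivity

/-- The cells are open on the left, hence the ceiling: the cell of `s > 0` has index `⌈2^k s⌉₊ - 1`.
-/
theorem mem_dyadic_Ioc_iff {k i : ℕ} {s : ℝ} :
    s ∈ Set.Ioc ((i : ℝ) / 2 ^ k) (((i + 1 : ℕ) : ℝ) / 2 ^ k) ↔ ⌈2 ^ k * s⌉₊ = i + 1 := by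
  have h2 : (0 : ℝ) < 2 ^ k := by positivity
  rw [Set.mem_Ioc, Nat.ceil_eq_iff (Nat.succ_ne_zero i), div_lt_iff₀ h2, le_div_iff₀ h2,
    mul_comm s]
  rfl

theorem dyadicStep_eq {k : ℕ} {s : ℝ} (hs : 0 < s) (hk : s ≤ k) :
    dyadicStep C e k s = dyadicCoef C e k (⌈2 ^ k * s⌉₊ - 1) := by
  have h2 : (0 : ℝ) < 2 ^ k := by positivity
  have hpos : 0 < ⌈2 ^ k * s⌉₊ := Nat.ceil_pos.2 (by positivity)
  have hle : ⌈2 ^ k * s⌉₊ ≤ k * 2 ^ k := by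
    rw [Nat.ceil_le]
    push_cast
    rw [mul_comm]
    gcongr
  rw [dyadicStep, stepFun, Finset.sum_eq_single (⌈2 ^ k * s⌉₊ - 1), Set.indicator_of_mem]
  · rw [mem_dyadic_Ioc_iff]
    omega
  · intro i _ hi
    refine Set.indicator_of_notMem (fun hmem => hi ?_) _
    rw [mem_dyadic_Ioc_iff] at hmem
    omega
  · intro hnot
    exact absurd (Finset.mem_range.2 (by omega)) hnot

theorem dyadicStep_eq_zero {k : ℕ} {s : ℝ} (hk : k < s) : dyadicStep C e k s = 0 := by
  have h2 : (0 : ℝ) < 2 ^ k := by positivity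
  rw [dyadicStep, stepFun]
  refine Finset.sum_eq_zero fun i hi => Set.indicator_of_notMem (fun hmem => ?_) _
  rw [mem_dyadic_Ioc_iff] at hmem
  have h1 : 2 ^ k * s ≤ (i + 1 : ℕ) := hmem ▸ Nat.le_ceil _
  have h3 : ((i + 1 : ℕ) : ℝ) ≤ (k * 2 ^ k : ℕ) := by
    exact_mod_cast Finset.mem_range.1 hi
  push_cast at h1 h3
  nlinarith

theorem dyadicStep_nonneg (hC : 0 ≤ C) (k : ℕ) (s : ℝ) : 0 ≤ dyadicStep C e k s := by
  rw [dyadicStep, stepFun]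
  exact Finset.sum_nonneg fun i _ => Set.indicator_nonneg (fun _ _ => dyadicCoef_nonneg hC k i) _

/-- The power is monotone, so the smaller of its two endpoint values lies below it throughout the
cell. For `e < 0` the convention `0 ^ e = 0` merely makes the first step zero. -/
theorem dyadicStep_le (hC : 0 ≤ C) (k : ℕ) {s : ℝ} (hs : 0 < s) :
    dyadicStep C e k s ≤ C * s ^ e := by
  rcases le_or_gt s k with hk | hk
  · rw [dyadicStep_eq hs hk, dyadicCoef]
    have hpos : 0 < ⌈2 ^ k * s⌉₊ := Nat.ceil_pos.2 (by positivity)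
    obtain ⟨h1, h2⟩ := mem_dyadic_Ioc_iff.2
      (show ⌈2 ^ k * s⌉₊ = (⌈2 ^ k * s⌉₊ - 1) + 1 by omega)
    gcongr
    rcases le_total 0 e with he | he
    · exact (min_le_left _ _).trans (Real.rpow_le_rpow (by positivity) h1.le he)
    · exact (min_le_right _ _).trans (Real.rpow_le_rpow_of_nonpos hs h2 he)
  · rw [dyadicStep_eq_zero hk]
    positivity

theorem tendsto_dyadicStep {s : ℝ} (hs : 0 < s) :
    Tendsto (fun k => dyadicStep C e k s) atTop (𝓝 (C * s ^ e)) := by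
  have hev : ∀ᶠ k : ℕ in atTop, C * min (((⌈2 ^ k * s⌉₊ - 1 : ℕ) / 2 ^ k : ℝ) ^ e)
      ((((⌈2 ^ k * s⌉₊ - 1 + 1 : ℕ) : ℝ) / 2 ^ k) ^ e) = dyadicStep C e k s := by
    obtain ⟨N, hN⟩ := exists_nat_ge s
    filter_upwards [eventually_ge_atTop N] with k hk
    rw [dyadicStep_eq hs (hN.trans (by exact_mod_cast hk)), dyadicCoef]
  refine Tendsto.congr' hev ?_
  have hpow : Tendsto (fun k : ℕ => (1 : ℝ) / 2 ^ k) atTop (𝓝 0) := by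
    simpa only [one_div, inv_pow] using
      tendsto_pow_atTop_nhds_zero_of_lt_one (r := (2⁻¹ : ℝ)) (by norm_num) (by norm_num)
  have hmem : ∀ k : ℕ, s ∈ Set.Ioc (((⌈2 ^ k * s⌉₊ - 1 : ℕ) : ℝ) / 2 ^ k)
      (((⌈2 ^ k * s⌉₊ - 1 + 1 : ℕ) : ℝ) / 2 ^ k) := fun k => by
    have hpos : 0 < ⌈2 ^ k * s⌉₊ := Nat.ceil_pos.2 (by positivity)
    rw [mem_dyadic_Ioc_iff]
    omega
  have hadd : ∀ k : ℕ, (((⌈2 ^ k * s⌉₊ - 1 + 1 : ℕ) : ℝ) / 2 ^ k)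
      = ((⌈2 ^ k * s⌉₊ - 1 : ℕ) : ℝ) / 2 ^ k + 1 / 2 ^ k := fun k => by
    push_cast
    rw [add_div]
  have hlow : Tendsto (fun k : ℕ => ((⌈2 ^ k * s⌉₊ - 1 : ℕ) : ℝ) / 2 ^ k) atTop (𝓝 s) := by
    refine tendsto_of_tendsto_of_tendsto_of_le_of_le
      (by simpa using hpow.const_sub s) tendsto_const_nhds (fun k => ?_) fun k => (hmem k).1.le
    have := (hmem k).2
    rw [hadd] at this
    simpa [sub_le_iff_le_add] using this
  have hup : Tendsto (fun k : ℕ => ((⌈2 ^ k * s⌉₊ - 1 + 1 : ℕ) : ℝ) / 2 ^ k) atTop (𝓝 s) := by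
    simp only [hadd]
    simpa using hlow.add hpow
  have := ((hlow.rpow_const (p := e) (Or.inl hs.ne')).min
    (hup.rpow_const (p := e) (Or.inl hs.ne'))).const_mul C
  rwa [min_self] at this

theorem intervalIntegrable_const_mul_rpow_sq (he : -1 / 2 < e) {t : ℝ} (ht : 0 ≤ t) :
    IntervalIntegrable (fun s : ℝ => (C * s ^ e) ^ 2) volume 0 t := by
  have h : IntervalIntegrable (fun s : ℝ => C ^ 2 * s ^ (2 * e)) volume 0 t :=
    (intervalIntegral.intervalIntegrable_rpow' (by linarith)).const_mul _
  refine h.congr fun s hs => ?_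
  rw [Set.uIoc_of_le ht] at hs
  rw [mul_pow, ← Real.rpow_natCast (s ^ e), ← Real.rpow_mul hs.1.le, mul_comm 2 e]
  norm_num

theorem intervalIntegrable_const_mul_rpow (he : -1 / 2 < e) {t : ℝ} :
    IntervalIntegrable (fun s : ℝ => C * s ^ e) volume 0 t :=
  (intervalIntegral.intervalIntegrable_rpow' (by linarith)).const_mul _

theorem intervalIntegrable_dyadicStep_sub_sq (he : -1 / 2 < e) (k : ℕ) {t : ℝ} (ht : 0 ≤ t) :
    IntervalIntegrable (fun s => (dyadicStep C e k s - C * s ^ e) ^ 2) volume 0 t :=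
  intervalIntegrable_stepFun_sub_sq ht (intervalIntegrable_const_mul_rpow he)
    (intervalIntegrable_const_mul_rpow_sq he ht)

/-- The step functions lie between `0` and `C s^e`, whose square is integrable because `2e > -1`;
dominated convergence applies. -/
theorem tendsto_integral_dyadicStep_sub_sq (hC : 0 ≤ C) (he : -1 / 2 < e) {t : ℝ} (ht : 0 ≤ t) :
    Tendsto (fun k => ∫ s in (0 : ℝ)..t, (dyadicStep C e k s - C * s ^ e) ^ 2) atTop (𝓝 0) := by
  have h := intervalIntegral.tendsto_integral_filter_of_dominated_convergence
    (F := fun k s => (dyadicStep C e k s - C * s ^ e) ^ 2) (f := fun _ => (0 : ℝ)) (a := 0) (b := t)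
    (l := atTop) (μ := volume) (fun s => (C * s ^ e) ^ 2) ?_ ?_
    (intervalIntegrable_const_mul_rpow_sq he ht) ?_
  · simpa using h
  · refine Eventually.of_forall fun k => Measurable.aestronglyMeasurable ?_
    have : Measurable (dyadicStep C e k) := by
      unfold dyadicStep stepFun
      exact Finset.measurable_fun_sum _ fun i _ => measurable_const.indicator measurableSet_Ioc
    fun_prop
  · refine Eventually.of_forall fun k => Eventually.of_forall fun s hs => ?_
    rw [Set.uIoc_of_le ht] at hs
    rw [Real.norm_of_nonneg (sq_nonneg _)]
    have h1 := dyadicStep_nonneg (e := e) hC k s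
    have h2 := dyadicStep_le (e := e) hC k hs.1
    exact sq_le_sq' (by linarith) (by linarith)
  · refine Eventually.of_forall fun s hs => ?_
    rw [Set.uIoc_of_le ht] at hs
    simpa using ((tendsto_dyadicStep (C := C) (e := e) hs.1).sub_const (C * s ^ e)).pow 2

end StepFunctions

/-! ### Wiener integrals of powers as Itô integrals -/

section ItoIntegral

variable {Ω : Type*} {mΩ : MeasurableSpace Ω} {P : Measure Ω} {F : Filtration ℝ≥0 mΩ}

/-- The deterministic dyadic step approximation of `C s ^ e` as a simple process. -/
noncomputable def dyadicProcess (F : Filtration ℝ≥0 mΩ) (C e : ℝ) (k : ℕ) : SimpleProcess F where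
  n := k * 2 ^ k
  time i := (i : ℝ≥0) / 2 ^ k
  coef i _ := dyadicCoef C e k i
  mono i j hij := by
    have : (i : ℝ≥0) ≤ j := by exact_mod_cast hij
    exact div_le_div_of_nonneg_right this zero_le
  measurable _ := stronglyMeasurable_const
  bounded i := ⟨|dyadicCoef C e k i|, fun _ => le_rfl⟩

theorem dyadicProcess_eval {C e : ℝ} (k : ℕ) {s : ℝ} (hs : 0 ≤ s) (ω : Ω) :
    (dyadicProcess F C e k).eval s.toNNReal ω = dyadicStep C e k s := by
  rw [SimpleProcess.eval, dyadicStep, stepFun]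
  refine Finset.sum_congr rfl fun i _ => ?_
  have : s.toNNReal ∈ Set.Ioc ((i : ℝ≥0) / 2 ^ k) (((i + 1 : ℕ) : ℝ≥0) / 2 ^ k) ↔
      s ∈ Set.Ioc ((i : ℝ) / 2 ^ k) (((i + 1 : ℕ) : ℝ) / 2 ^ k) := by
    rw [Set.mem_Ioc, Set.mem_Ioc, ← NNReal.coe_lt_coe, ← NNReal.coe_le_coe,
      Real.coe_toNNReal s hs]
    push_cast
    rfl
  simp only [dyadicProcess, Set.indicator, this]

theorem dyadicProcess_integral_ae_eq [IsProbabilityMeasure P] {C e : ℝ} {W : ℝ≥0 → Ω → ℝ}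
    {w : ℝ → Lp ℝ 2 P} (hW : ∀ t : ℝ≥0, W t =ᵐ[P] w t) (k : ℕ) (t : ℝ≥0) :
    (stepIntegral (k * 2 ^ k) (fun i => (i : ℝ) / 2 ^ k) (dyadicCoef C e k) w t : Lp ℝ 2 P)
      =ᵐ[P] (dyadicProcess F C e k).integral W t := by
  have hW' : ∀ i : ℕ, W (min ((i : ℝ≥0) / 2 ^ k) t) =ᵐ[P] w (min ((i : ℝ) / 2 ^ k) t) := fun i => by
    have := hW (min ((i : ℝ≥0) / 2 ^ k) t)
    rwa [NNReal.coe_min, NNReal.coe_div, NNReal.coe_pow, NNReal.coe_natCast, NNReal.coe_ofNat]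
      at this
  refine (Lp.coeFn_finsetSum _ _).trans ?_
  have hterm : ∀ᵐ ω ∂P, ∀ i : ℕ, (dyadicCoef C e k i • (w (min (((i + 1 : ℕ) : ℝ) / 2 ^ k) t)
      - w (min ((i : ℝ) / 2 ^ k) t)) : Lp ℝ 2 P) ω
      = dyadicCoef C e k i * (W (min (((i + 1 : ℕ) : ℝ≥0) / 2 ^ k) t) ω
        - W (min ((i : ℝ≥0) / 2 ^ k) t) ω) := ae_all_iff.2 fun i => by
    filter_upwards [hW' i, hW' (i + 1), Lp.coeFn_smul (dyadicCoef C e k i)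
      (w (min (((i + 1 : ℕ) : ℝ) / 2 ^ k) t) - w (min ((i : ℝ) / 2 ^ k) t)),
      Lp.coeFn_sub (w (min (((i + 1 : ℕ) : ℝ) / 2 ^ k) t)) (w (min ((i : ℝ) / 2 ^ k) t))]
      with ω h1 h2 h3 h4
    rw [h3, Pi.smul_apply, h4, Pi.sub_apply, h1, h2, smul_eq_mul]
  filter_upwards [hterm] with ω hω
  rw [Finset.sum_apply]
  exact Finset.sum_congr rfl fun i _ => hω i

/-- A continuous adapted version of the Wiener integral of `C s ^ e`, characterised by its
covariances, is the Itô integral. -/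
theorem isItoIntegral_of_inner [IsProbabilityMeasure P] {C e : ℝ} (hC : 0 ≤ C) (he : -1 / 2 < e)
    {W I : ℝ≥0 → Ω → ℝ} {w x : ℝ → Lp ℝ 2 P}
    (hw : ∀ u v, 0 ≤ u → 0 ≤ v → ⟪w u, w v⟫ = min u v) (hW : ∀ t : ℝ≥0, W t =ᵐ[P] w t)
    (hx : ∀ u t, 0 ≤ u → u ≤ t → ⟪w u, x t⟫ = C * (u ^ (e + 1) / (e + 1)))
    (hxx : ∀ t, 0 ≤ t → ‖x t‖ ^ 2 = C ^ 2 * (t ^ (2 * e + 1) / (2 * e + 1)))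
    (hI : ∀ t : ℝ≥0, I t =ᵐ[P] x t) (hIa : StronglyAdapted F I)
    (hIc : ∀ᵐ ω ∂P, Continuous (I · ω)) :
    IsItoIntegral F W (fun s _ => C * (s : ℝ) ^ e) I P where
  progressive t := by
    exact (((measurable_subtype_coe.comp measurable_fst).coe_nnreal_real.pow_const e).const_mul
      C).stronglyMeasurable
  sq_integrable := Eventually.of_forall fun ω t => by
    have h := (intervalIntegrable_iff_integrableOn_Ioc_of_le t.coe_nonneg).1
      (intervalIntegrable_const_mul_rpow_sq (C := C) he t.coe_nonneg)
    refine lt_of_le_of_lt (le_of_eq ?_) h.2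
    refine setLIntegral_congr_fun measurableSet_Ioc fun s hs => ?_
    rw [Real.coe_toNNReal s hs.1.le, enorm_pow]
  adapted := hIa
  continuous := hIc
  approx := by
    refine ⟨dyadicProcess F C e, fun t => ⟨fun ε hε => ?_, ?_⟩⟩
    -- Integrand and approximations are deterministic, so the event in question is empty for all
    -- large `k`.
    · have hlim := ENNReal.tendsto_ofReal (tendsto_integral_dyadicStep_sub_sq hC he t.coe_nonneg)
      rw [ENNReal.ofReal_zero] at hlim
      refine tendsto_const_nhds.congr' ?_
      filter_upwards [hlim.eventually (gt_mem_nhds hε)] with k hk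
      rw [eq_comm, ← measure_empty (μ := P)]
      congr 1
      refine Set.eq_empty_of_forall_notMem fun ω hω => not_lt.2 (Set.mem_ofPred_eq ▸ hω) ?_
      refine lt_of_le_of_lt (le_of_eq ?_) hk
      have hint := (intervalIntegrable_iff_integrableOn_Ioc_of_le t.coe_nonneg).1
        (intervalIntegrable_dyadicStep_sub_sq (C := C) he k t.coe_nonneg)
      rw [intervalIntegral.integral_of_le t.coe_nonneg, ofReal_integral_eq_lintegral_ofReal hint
        (Eventually.of_forall fun _ => sq_nonneg _)]
      refine setLIntegral_congr_fun measurableSet_Ioc fun s hs => ?_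
      rw [dyadicProcess_eval k hs.1.le, Real.coe_toNNReal s hs.1.le, ← enorm_pow,
        Real.enorm_of_nonneg (sq_nonneg _)]
    -- Convergence holds in `L²`: by the isometry the distance is the `L²` error of the step
    -- functions.
    · refine TendstoInMeasure.congr (fun k => dyadicProcess_integral_ae_eq hW k t) (hI t).symm
        (tendstoInMeasure_of_tendsto_Lp ?_)
      rw [tendsto_iff_norm_sub_tendsto_zero]
      have hφ : ∀ v : ℝ, 0 ≤ v → ∫ s in (0 : ℝ)..v, C * s ^ e = C * (v ^ (e + 1) / (e + 1)) :=
        fun v hv => by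
          rw [intervalIntegral.integral_const_mul, integral_rpow (Or.inl (by linarith)),
            Real.zero_rpow (by linarith), sub_zero]
      have hφ2 : ∫ s in (0 : ℝ)..t, (C * s ^ e) ^ 2
          = C ^ 2 * ((t : ℝ) ^ (2 * e + 1) / (2 * e + 1)) := by
        have h2 : (t : ℝ) ^ (2 * e + 1) / (2 * e + 1) = ∫ s in (0 : ℝ)..t, s ^ (2 * e) := by
          rw [integral_rpow (Or.inl (by linarith)), Real.zero_rpow (by linarith), sub_zero]
        rw [h2, ← intervalIntegral.integral_const_mul]
        refine intervalIntegral.integral_congr fun s hs => ?_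
        rw [Set.uIcc_of_le t.coe_nonneg] at hs
        rw [mul_pow, ← Real.rpow_natCast (s ^ e), ← Real.rpow_mul hs.1, mul_comm 2 e,
          Nat.cast_ofNat]
      have hnorm : ∀ k, ‖stepIntegral (k * 2 ^ k) (fun i => (i : ℝ) / 2 ^ k) (dyadicCoef C e k) w t
          - x t‖ = √(∫ s in (0 : ℝ)..t, (dyadicStep C e k s - C * s ^ e) ^ 2) := fun k => by
        have hτ : Monotone fun i : ℕ => (i : ℝ) / 2 ^ k := fun i j hij => by
          have : (i : ℝ) ≤ j := by exact_mod_cast hij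
          exact div_le_div_of_nonneg_right this (by positivity)
        have h := norm_stepIntegral_sub_sq (n := k * 2 ^ k) (a := dyadicCoef C e k)
          (φ := fun s => C * s ^ e) hτ (by simp) hw t.coe_nonneg
          (intervalIntegrable_const_mul_rpow he) (intervalIntegrable_const_mul_rpow_sq he t.coe_nonneg)
          (fun v hv => by rw [hx v t hv.1 hv.2, hφ v hv.1]) (by rw [hxx t t.coe_nonneg, hφ2])
        rw [dyadicStep, ← Real.sqrt_sq (norm_nonneg (stepIntegral _ _ _ _ _ - _)), h]
      simp only [hnorm]
      simpa using (tendsto_integral_dyadicStep_sub_sq hC he t.coe_nonneg).sqrt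

end ItoIntegral

/-! ### Positivity and values of the constants -/

section Constants

theorem aConj_pos {H : ℝ} (hH : 0 < H) (hH1 : H < 1) : 0 < aConj H := by
  have h1 := Real.Gamma_pos_of_pos (show 0 < 2 * H + 1 by linarith)
  have h2 := Real.Gamma_pos_of_pos (show 0 < 3 - 2 * H by linarith)
  have h3 := Real.sin_pos_of_pos_of_lt_pi (x := Real.pi * H) (by positivity)
    (by nlinarith [Real.pi_pos])
  rw [aConj]
  positivity

theorem cM_pos {H : ℝ} (hH : 0 < H) (hH1 : H < 1) : 0 < cM H := by
  have h1 := aConj_pos hH hH1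
  have h2 := Real.Gamma_pos_of_pos (show 0 < 3 / 2 - H by linarith)
  have h3 := Real.Gamma_pos_of_pos (show 0 < H + 1 / 2 by linarith)
  have h4 := Real.Gamma_pos_of_pos (show 0 < 3 - 2 * H by linarith)
  rw [cM]
  positivity

theorem cPsi_pos {H : ℝ} (hH : 0 < H) (hH1 : H < 1) : 0 < cPsi H := by
  have h1 := aConj_pos hH hH1
  have h2 := Real.Gamma_pos_of_pos (show 0 < 3 / 2 - H by linarith)
  have h3 := Real.Gamma_pos_of_pos (show 0 < H + 1 / 2 by linarith)
  have h4 := Real.Gamma_pos_of_pos (show 0 < 3 - 2 * H by linarith)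
  rw [cPsi]
  positivity

theorem aCov_one_sub (H : ℝ) : aCov H (1 - H) = aConj H := by
  rw [aCov, if_pos (by ring)]

/-- Each component of the fractional Gaussian field has unit variance at time one. -/
theorem aCov_self {H : ℝ} (hH : 0 < H) (hH1 : H < 1) : aCov H H = 1 := by
  rcases eq_or_ne H (1 / 2) with rfl | hne
  · rw [aCov, if_pos (by norm_num), aConj]
    have h1 : (2 * (1 / 2) + 1 : ℝ) = 2 := by norm_num
    have h2 : (3 - 2 * (1 / 2) : ℝ) = 2 := by norm_num
    rw [h1, h2, Real.Gamma_two, mul_one_div, Real.sin_pi_div_two]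
    norm_num
  · have hs : 0 < Real.sin (Real.pi * H) :=
      Real.sin_pos_of_pos_of_lt_pi (by positivity) (by nlinarith [Real.pi_pos])
    have hΓ := Real.Gamma_pos_of_pos (show 0 < 2 * H + 1 by linarith)
    have hc : Real.cos (Real.pi * H) ≠ 0 := by
      intro h0
      rcases lt_or_gt_of_ne hne with h | h
      · exact (Real.cos_pos_of_mem_Ioo ⟨by nlinarith [Real.pi_pos],
          by nlinarith [Real.pi_pos]⟩).ne' h0
      · exact (Real.cos_neg_of_pi_div_two_lt_of_lt (by nlinarith [Real.pi_pos])
          (by nlinarith [Real.pi_pos])).ne h0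
    -- Reflection at `-2H` gives `Γ(-2H) Γ(2H+1) = -π / sin(2πH)`. The double-angle formula cancels
    -- the remaining sine and cosine, the latter nonzero because `H ≠ 1/2`.
    have hrefl := Real.Gamma_mul_Gamma_one_sub (-(H + H))
    rw [show 1 - -(H + H) = 2 * H + 1 by ring,
      show Real.pi * -(H + H) = -(2 * (Real.pi * H)) by ring, Real.sin_neg,
      Real.sin_two_mul] at hrefl
    rw [aCov, if_neg (fun h => hne (by linarith)), sub_self, zero_mul, Real.cos_zero,
      show (H + H) * (Real.pi / 2) = Real.pi * H by ring, mul_assoc (-(2 / Real.pi)),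
      Real.mul_self_sqrt (by positivity)]
    have hπ := Real.pi_ne_zero
    calc _ = -(2 / Real.pi) * (Real.Gamma (-(H + H)) * Real.Gamma (2 * H + 1))
          * (Real.sin (Real.pi * H) * Real.cos (Real.pi * H)) := by ring
      _ = 1 := by
        rw [hrefl]
        field_simp

end Constants

/-! ### The field as curves in `L²`, and its filtration -/

namespace IsFractionalGaussianField

variable {Ω : Type*} {mΩ : MeasurableSpace Ω} {P : Measure Ω}
  {Z : Hurst × ℝ≥0 → Ω → ℝ}

theorem memLp (hZ : IsFractionalGaussianField Z P) (i : Hurst × ℝ≥0) : MemLp (Z i) 2 P :=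
  (hZ.gaussian.hasGaussianLaw_eval i).memLp_two

/-- The component of index `H` of the field as a curve in `L²`. -/
noncomputable def curve (hZ : IsFractionalGaussianField Z P) (H : Hurst) (t : ℝ) : Lp ℝ 2 P :=
  (hZ.memLp (H, t.toNNReal)).toLp (Z (H, t.toNNReal))

variable (hZ : IsFractionalGaussianField Z P) (H : Hurst)

theorem inner_curve (H' : Hurst) {s t : ℝ} (hs : 0 ≤ s) (ht : 0 ≤ t) :
    ⟪hZ.curve H s, hZ.curve H' t⟫ = aCov H H' / 2 * (s ^ ((H : ℝ) + H') + t ^ ((H : ℝ) + H')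
      - |s - t| ^ ((H : ℝ) + H')) := by
  have h := hZ.covariance H H' s.toNNReal t.toNNReal
  rw [Real.coe_toNNReal s hs, Real.coe_toNNReal t ht] at h
  rw [← h, L2.inner_def]
  refine integral_congr_ae ?_
  filter_upwards [(hZ.memLp (H, s.toNNReal)).coeFn_toLp,
    (hZ.memLp (H', t.toNNReal)).coeFn_toLp] with ω h1 h2
  rw [curve, curve, h1, h2, real_inner_eq_re_inner]
  simp [mul_comm]

theorem isFractionalCurve : IsFractionalCurve H (hZ.curve H) := fun s r hs hr => by
  rw [inner_curve hZ H H hs hr, aCov_self H.2.1 H.2.2, ← two_mul]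
  ring

/-- The exponents add up to `1`, so for `s ≤ t` the covariance collapses to `s + t - (t - s) = 2s`,
independent of `t`. -/
theorem inner_curve_conj {s t : ℝ} (hs : 0 ≤ s) (hst : s ≤ t) :
    ⟪hZ.curve H s, hZ.curve H.conj t⟫ = aConj H * s := by
  have : (H : ℝ) + H.conj = 1 := add_sub_cancel _ _
  rw [inner_curve hZ H H.conj hs (hs.trans hst), this, Real.rpow_one, Real.rpow_one,
    Real.rpow_one, abs_of_nonpos (sub_nonpos.2 hst)]
  change aCov H (1 - H) / 2 * _ = _
  rw [aCov_one_sub]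
  ring

theorem curve_mem_gaussianSpan (t : ℝ) : hZ.curve H t ∈ gaussianSpan hZ.memLp :=
  toLp_mem_gaussianSpan hZ.memLp _

theorem pastSpan_le_gaussianSpan (t : ℝ) : pastSpan (hZ.curve H) t ≤ gaussianSpan hZ.memLp :=
  pastSpan_le (Submodule.isClosed_topologicalClosure _) fun r _ => hZ.curve_mem_gaussianSpan H r

theorem hurstFiltration_eq (t : ℝ≥0) : hurstFiltration Z hZ.measurable H t =
    MeasurableSpace.comap (fun ω (j : Set.Iic t) => Z (H, j) ω) MeasurableSpace.pi :=
  Filtration.natural_eq_comap _ _ t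

theorem aestronglyMeasurable_of_mem {t : ℝ≥0} {x : Lp ℝ 2 P}
    (hx : x ∈ pastSpan (hZ.curve H) t) :
    AEStronglyMeasurable[hurstFiltration Z hZ.measurable H t] x P := by
  refine aestronglyMeasurable_of_mem_pastSpan ((hurstFiltration Z hZ.measurable H).le t)
    (fun r hr => ?_) hx
  have hle : r.toNNReal ≤ t := Real.toNNReal_le_iff_le_coe.2 hr.2
  have h1 : StronglyMeasurable[hurstFiltration Z hZ.measurable H t] (Z (H, r.toNNReal)) :=
    (Filtration.stronglyAdapted_natural (u := fun t => Z (H, t))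
      (fun t => (hZ.measurable (H, t)).stronglyMeasurable) r.toNNReal).mono
      ((hurstFiltration Z hZ.measurable H).mono hle)
  exact ⟨_, h1, (hZ.memLp (H, r.toNNReal)).coeFn_toLp⟩

variable [IsProbabilityMeasure P]

/-- The conditional expectation of the conjugate component is the fundamental martingale. -/
theorem doMartingale_ae_eq {t : ℝ≥0} {x : Lp ℝ 2 P} (hx : x ∈ pastSpan (hZ.curve H) t)
    (hxz : ∀ r : ℝ, 0 ≤ r → r ≤ t → ⟪x, hZ.curve H r⟫ = aConj H * r) :
    doMartingale Z hZ.measurable P H t =ᵐ[P] x := by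
  have hmeas := hZ.aestronglyMeasurable_of_mem H hx
  rw [hurstFiltration_eq hZ] at hmeas
  rw [doMartingale, hurstFiltration_eq hZ]
  refine condExp_ae_eq_of_inner_eq_zero hZ.memLp hZ.gaussian hZ.measurable hZ.centered
    (hZ.pastSpan_le_gaussianSpan H t hx) (fun j : Set.Iic t => (H, (j : ℝ≥0))) hmeas _ fun r => ?_
  have e : ∀ (K : Hurst) (r : ℝ≥0), (hZ.memLp (K, r)).toLp (Z (K, r)) = hZ.curve K r :=
    fun K r => by
      rw [curve]
      simp only [Real.toNNReal_coe]
  have hr : ((r : ℝ≥0) : ℝ) ≤ t := r.2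
  rw [e, e, inner_sub_left, real_inner_comm,
    hZ.inner_curve_conj H (NNReal.coe_nonneg _) hr, hxz _ (NNReal.coe_nonneg _) hr, sub_self]

/-- Increments of a version of a curve which are orthogonal to the past are independent of it. -/
theorem indep_hurstFiltration {s : ℝ≥0} {x : Lp ℝ 2 P} (hx : x ∈ gaussianSpan hZ.memLp)
    (hxz : ∀ r : ℝ, 0 ≤ r → r ≤ s → ⟪x, hZ.curve H r⟫ = 0) {g : Ω → ℝ} (hg : g =ᵐ[P] x) :
    Indep (MeasurableSpace.comap g inferInstance) (hurstFiltration Z hZ.measurable H s) P := by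
  rw [hurstFiltration_eq hZ]
  refine indep_of_inner_eq_zero hZ.memLp hZ.gaussian hZ.centered hx
    (fun j : Set.Iic s => (H, (j : ℝ≥0))) (fun r => ?_) hg
  have := hxz r (NNReal.coe_nonneg _) r.2
  rw [curve] at this
  simpa only [Real.toNNReal_coe] using this

end IsFractionalGaussianField

/-! ### The driving Brownian motion and the stochastic differential equation -/

theorem continuous_integral_toNNReal {f : ℝ → ℝ}
    (hf : ∀ n : ℕ, IntervalIntegrable f volume 0 n) :
    Continuous fun t : ℝ≥0 => ∫ s in (0 : ℝ)..t, f s := by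
  refine continuous_iff_continuousAt.2 fun t => ?_
  obtain ⟨n, hn⟩ := exists_nat_gt t
  have h1 := intervalIntegral.continuousOn_primitive_interval' (hf n) Set.left_mem_uIcc
  have h2 : ContinuousOn (fun t : ℝ≥0 => ∫ s in (0 : ℝ)..t, f s) (Set.Iic (n : ℝ≥0)) :=
    h1.comp NNReal.continuous_coe.continuousOn fun s hs => by
      rw [Set.uIcc_of_le n.cast_nonneg]
      exact ⟨s.coe_nonneg, by exact_mod_cast (show s ≤ n from hs)⟩
  exact h2.continuousAt (Iic_mem_nhds hn)

/-- If `⟪X v, y⟫` is constant on `[s, t]`, then so is `⟪wienerPow e X v, y⟫`. -/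
theorem inner_wienerPow_sub {E : Type*} [NormedAddCommGroup E] [InnerProductSpace ℝ E]
    [CompleteSpace E] {e b s t : ℝ} {X : ℝ → E} {y : E}
    (hX : IntervalIntegrable (fun s => s ^ (e - 1) • X s) volume 0 t) (hs : 0 < s) (hst : s ≤ t)
    (hy : ∀ v ∈ Set.Icc s t, ⟪X v, y⟫ = b) :
    ⟪wienerPow e X t - wienerPow e X s, y⟫ = 0 := by
  have ht := hs.trans_le hst
  have h1 : IntervalIntegrable (fun s => s ^ (e - 1) • X s) volume 0 s := hX.mono_set (by
    rw [Set.uIcc_of_le hs.le, Set.uIcc_of_le ht.le]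
    exact Set.Icc_subset_Icc_right hst)
  have h2 : IntervalIntegrable (fun s => s ^ (e - 1) • X s) volume s t := h1.symm.trans hX
  have h3 : wienerPow e X t - wienerPow e X s
      = t ^ e • X t - s ^ e • X s - e • ∫ v in s..t, v ^ (e - 1) • X v := by
    rw [← intervalIntegral.integral_interval_sub_left hX h1, smul_sub, wienerPow, wienerPow]
    abel
  have h4 : ⟪∫ v in s..t, v ^ (e - 1) • X v, y⟫ = (∫ v in s..t, v ^ (e - 1)) * b := by
    rw [real_inner_comm, ← innerSL_apply_apply ℝ y,
      ← ContinuousLinearMap.intervalIntegral_comp_comm _ h2, ← intervalIntegral.integral_mul_const]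
    refine intervalIntegral.integral_congr fun v hv => ?_
    rw [Set.uIcc_of_le hst] at hv
    rw [innerSL_apply_apply, real_inner_smul_right, real_inner_comm, hy v hv]
  rw [h3, inner_sub_left, inner_sub_left, real_inner_smul_left, real_inner_smul_left,
    real_inner_smul_left, h4, hy t ⟨hst, le_rfl⟩, hy s ⟨le_rfl, hst⟩]
  rcases eq_or_ne e 0 with rfl | he
  · simp
  · rw [integral_rpow (Or.inr ⟨fun h => he (by linarith), fun h => by
      rw [Set.uIcc_of_le hst] at h
      exact absurd h.1 (not_le.2 hs)⟩), sub_add_cancel]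
    field_simp
    ring

namespace IsFractionalGaussianField

variable {Ω : Type*} {mΩ : MeasurableSpace Ω} {P : Measure Ω} {Z : Hurst × ℝ≥0 → Ω → ℝ}

/-- The fundamental martingale of the field, as a curve in `L²`. -/
theorem exists_martingaleCurve (hZ : IsFractionalGaussianField Z P) (H : Hurst) :
    ∃ M : ℝ → Lp ℝ 2 P, IsPowerMartingaleCurve H (cM H) M ∧
      (∀ t, 0 ≤ t → M t ∈ pastSpan (hZ.curve H) t) ∧
      (∀ r t, 0 ≤ r → r ≤ t → ⟪M t, hZ.curve H r⟫ = aConj H * r) := by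
  obtain ⟨M, hM1, hM2, hM3⟩ := (hZ.isFractionalCurve H).exists_fundamental_martingale H.2.1 H.2.2
    (z' := hZ.curve H.conj) (a := aConj H) fun s t hs hst => hZ.inner_curve_conj H hs hst
  refine ⟨M, ⟨H.2.1, H.2.2, cM_pos H.2.1 H.2.2, fun s t hs ht => ?_⟩, hM1, hM2⟩
  rcases le_total s t with h | h
  · rw [min_eq_left h]
    exact hM3 s t hs h
  · rw [min_eq_right h, real_inner_comm]
    exact hM3 t s ht h

variable [IsProbabilityMeasure P]

/-- The Brownian curve of the fundamental martingale has an adapted continuous version, which is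
a Brownian motion with respect to the filtration of the field. -/
theorem exists_isBrownianMotionWrt (hZ : IsFractionalGaussianField Z P) (H : Hurst)
    {M : ℝ → Lp ℝ 2 P} (hM : IsPowerMartingaleCurve H (cM H) M)
    (hmem : ∀ t, 0 ≤ t → M t ∈ pastSpan (hZ.curve H) t)
    (hMz : ∀ r t, 0 ≤ r → r ≤ t → ⟪M t, hZ.curve H r⟫ = aConj H * r) :
    ∃ W : ℝ≥0 → Ω → ℝ, IsBrownianMotionWrt (hurstFiltration Z hZ.measurable H) W P ∧
      ∀ t : ℝ≥0, W t =ᵐ[P] (IsPowerMartingaleCurve.brownianCurve H (cM H) M t : Lp ℝ 2 P) := by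
  have hH1 := H.2.2
  have hint : ∀ t : ℝ, 0 ≤ t → IntervalIntegrable
      (fun s => s ^ ((H : ℝ) - 1 / 2 - 1) • M s) volume 0 t := fun t ht =>
    hM.intervalIntegrable (e := (H : ℝ) - 1 / 2) (by linarith) ht
  set w : ℝ → Lp ℝ 2 P := IsPowerMartingaleCurve.brownianCurve H (cM H) M with hw
  have hwp : ∀ t, 0 ≤ t → w t ∈ pastSpan (hZ.curve H) t := fun t ht =>
    Submodule.smul_mem _ _ (wienerPow_mem (hint t ht) ht fun s hs => hmem s hs.1)
  have hwg : ∀ t, 0 ≤ t → w t ∈ gaussianSpan hZ.memLp := fun t ht =>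
    hZ.pastSpan_le_gaussianSpan H t (hwp t ht)
  obtain ⟨Y, hYc, -, hY⟩ := hM.exists_continuous_brownianCurve hZ.memLp hZ.gaussian hZ.centered hwg
  obtain ⟨W, hWa, hWY⟩ := exists_adapted_of_ae_eq (F := hurstFiltration Z hZ.measurable H)
    (X := fun t => w t) (fun t => hZ.aestronglyMeasurable_of_mem H (hwp t t.coe_nonneg))
    (fun t => (hY t).symm) (Eventually.of_forall hYc)
  have hW : ∀ t : ℝ≥0, W t =ᵐ[P] w t := fun t =>
    EventuallyEq.trans (hWY.mono fun ω h => h t) (hY t)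
  refine ⟨W, ⟨?_, hWa, fun s t hst => ?_⟩, hW⟩
  · have hpre := IsGaussianProcess.isPreBrownianReal_of_covariance
      (isGaussianProcess_of_mem hZ.memLp hZ.gaussian hZ.centered (X := fun t : ℝ≥0 => w t)
        fun t => hwg t t.coe_nonneg)
      (fun t => integral_eq_zero_of_mem hZ.memLp hZ.gaussian hZ.centered (hwg t t.coe_nonneg))
      fun s t hst => by
        have : (s : ℝ) ≤ t := hst
        rw [covariance_eq_inner hZ.memLp hZ.gaussian hZ.centered (hwg s s.coe_nonneg)
          (hwg t t.coe_nonneg), hM.inner_brownianCurve s.coe_nonneg t.coe_nonneg,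
          min_eq_left this]
    refine ⟨hpre.congr fun t => (hW t).symm, ?_⟩
    filter_upwards [hWY] with ω hω
    have : (W · ω) = (Y · ω) := funext hω
    rw [this]
    exact hYc ω
  · refine hZ.indep_hurstFiltration H (x := w t - w s)
      (Submodule.sub_mem _ (hwg t t.coe_nonneg) (hwg s s.coe_nonneg)) (fun r hr hrs => ?_) ?_
    · have hst' : (s : ℝ) ≤ t := hst
      -- The orthogonality lemma needs a positive left endpoint `s`. This follows from `r > 0`; at
      -- `r = 0` the curve vanishes. For `r ≤ s` the pairing of `M v` with `z r` stays `a_H r` on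
      -- `[s, t]`, so the increment of `W` is orthogonal to `z r`.
      rcases hr.eq_or_lt with rfl | hr0
      · have h0 : ‖hZ.curve H 0‖ ^ 2 = 0 := by
          have hH0 : 2 * (H : ℝ) ≠ 0 := (mul_pos two_pos H.2.1).ne'
          rw [← real_inner_self_eq_norm_sq, hZ.isFractionalCurve H 0 0 le_rfl le_rfl, sub_self,
            abs_zero, Real.zero_rpow hH0]
          norm_num
        rw [norm_eq_zero.1 (sq_eq_zero_iff.1 h0), inner_zero_right]
      · rw [hw, IsPowerMartingaleCurve.brownianCurve, IsPowerMartingaleCurve.brownianCurve,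
          ← smul_sub, real_inner_smul_left, inner_wienerPow_sub (b := aConj H * r)
          (hint t t.coe_nonneg) (hr0.trans_le hrs) hst'
          fun v hv => hMz r v hr (hrs.trans hv.1), mul_zero]
    · filter_upwards [hW s, hW t, Lp.coeFn_sub (w t) (w s)] with ω h1 h2 h3
      rw [h3, Pi.sub_apply, h1, h2]

/-- The Dobrić–Ojeda process has an adapted continuous modification which is an Itô diffusion. -/
theorem exists_isItoDiffusion (hZ : IsFractionalGaussianField Z P) (H : Hurst)
    {M : ℝ → Lp ℝ 2 P} (hM : IsPowerMartingaleCurve H (cM H) M)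
    (hmem : ∀ t, 0 ≤ t → M t ∈ pastSpan (hZ.curve H) t)
    (hMz : ∀ r t, 0 ≤ r → r ≤ t → ⟪M t, hZ.curve H r⟫ = aConj H * r) {W : ℝ≥0 → Ω → ℝ}
    (hW : ∀ t : ℝ≥0, W t =ᵐ[P] (IsPowerMartingaleCurve.brownianCurve H (cM H) M t : Lp ℝ 2 P)) :
    ∃ V : ℝ≥0 → Ω → ℝ, (∀ t, V t =ᵐ[P] doProcess Z hZ.measurable P H t) ∧
      IsItoDiffusion (hurstFiltration Z hZ.measurable H) W
        (fun t _ => diffusionConst H * t ^ ((H : ℝ) - 1 / 2))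
        (fun t x => (2 * (H : ℝ) - 1) * t⁻¹ * x) V P := by
  have hH := H.2.1
  have hH1 := H.2.2
  have hk := cPsi_pos hH hH1
  set k := cPsi H with hkdef
  obtain ⟨Y₀, hYc₀, hYm₀, hY₀⟩ := hM.exists_continuous_rpow_smul hZ.memLp hZ.gaussian hZ.centered
    fun t ht => hZ.pastSpan_le_gaussianSpan H t (hmem t ht)
  set Y : ℝ≥0 → Ω → ℝ := fun t ω => k * Y₀ t ω with hYdef
  have hYc : ∀ ω, Continuous (Y · ω) := fun ω => (hYc₀ ω).const_mul k
  have hYm : ∀ t, Measurable (Y t) := fun t => (hYm₀ t).const_mul k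
  have hY : ∀ t : ℝ≥0, Y t =ᵐ[P] ((k * (t : ℝ) ^ (2 * (H : ℝ) - 1)) • M t : Lp ℝ 2 P) :=
    fun t => by
      rw [mul_smul]
      filter_upwards [hY₀ t, Lp.coeFn_smul k ((t : ℝ) ^ (2 * (H : ℝ) - 1) • M t)] with ω h1 h2
      rw [h2, Pi.smul_apply, ← h1, smul_eq_mul]
  -- `M` vanishes at `0`, so the value given to `0 ^ (2H - 1)` plays no role.
  have hY0 : Y 0 =ᵐ[P] 0 := by
    have hM0 : M ((0 : ℝ≥0) : ℝ) = 0 := by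
      rw [NNReal.coe_zero, ← norm_eq_zero, ← sq_eq_zero_iff, hM.norm_sq le_rfl,
        Real.zero_rpow (by linarith), mul_zero]
    have := hY 0
    rw [hM0, smul_zero] at this
    exact this.trans (Lp.coeFn_zero _ _ _)
  obtain ⟨V, hVa, hVY⟩ := exists_adapted_of_ae_eq (F := hurstFiltration Z hZ.measurable H)
    (X := fun t : ℝ≥0 => ((k * (t : ℝ) ^ (2 * (H : ℝ) - 1)) • M t : Lp ℝ 2 P))
    (fun t => hZ.aestronglyMeasurable_of_mem H
      (Submodule.smul_mem _ _ (hmem t t.coe_nonneg)))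
    (fun t => (hY t).symm) (Eventually.of_forall hYc)
  have hdrift : ∀ᵐ ω ∂P, ∀ n : ℕ,
      IntervalIntegrable (fun s : ℝ => s⁻¹ * Y s.toNNReal ω) volume 0 n :=
    ae_all_iff.2 fun n => (hM.integral_inv_mul_ae_eq hYc hYm hY n.cast_nonneg).1
  -- `J` is the path minus its drift, and `x` below is its `L²` counterpart: the Wiener integral of
  -- `k s^(2H-1)` against `M`, integrated by parts. Their agreement is the stochastic equation.
  set J : ℝ≥0 → Ω → ℝ := fun t ω =>
    Y t ω - (2 * (H : ℝ) - 1) * ∫ s in (0 : ℝ)..t, s⁻¹ * Y s.toNNReal ω with hJdef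
  set x : ℝ → Lp ℝ 2 P := fun t => k • wienerPow (2 * (H : ℝ) - 1) M t with hxdef
  have hint : ∀ t : ℝ, 0 ≤ t → IntervalIntegrable
      (fun s => s ^ (2 * (H : ℝ) - 1 - 1) • M s) volume 0 t := fun t ht =>
    hM.intervalIntegrable (e := 2 * (H : ℝ) - 1) (by linarith) ht
  have hxp : ∀ t, 0 ≤ t → x t ∈ pastSpan (hZ.curve H) t := fun t ht =>
    Submodule.smul_mem _ _ (wienerPow_mem (hint t ht) ht fun s hs => hmem s hs.1)
  have hJc : ∀ᵐ ω ∂P, Continuous (J · ω) := by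
    filter_upwards [hdrift] with ω hω
    exact (hYc ω).sub ((continuous_integral_toNNReal hω).const_mul _)
  have hJx : ∀ t : ℝ≥0, J t =ᵐ[P] x t := fun t => by
    set u : Lp ℝ 2 P := k • ∫ s in (0 : ℝ)..t, s ^ (2 * (H : ℝ) - 1 - 1) • M s with hu
    have hxt : x t = (k * (t : ℝ) ^ (2 * (H : ℝ) - 1)) • M t - (2 * (H : ℝ) - 1) • u := by
      rw [hxdef, hu]
      simp only [wienerPow]
      rw [smul_sub, mul_smul, smul_comm k (2 * (H : ℝ) - 1)]
    rw [hxt]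
    filter_upwards [hY t, (hM.integral_inv_mul_ae_eq hYc hYm hY t.coe_nonneg).2,
      Lp.coeFn_sub ((k * (t : ℝ) ^ (2 * (H : ℝ) - 1)) • M t) ((2 * (H : ℝ) - 1) • u),
      Lp.coeFn_smul (2 * (H : ℝ) - 1) u] with ω h1 h2 h3 h4
    rw [h3, Pi.sub_apply, h4, Pi.smul_apply, ← h1, ← h2, smul_eq_mul]
  obtain ⟨I, hIa, hIJ⟩ := exists_adapted_of_ae_eq (F := hurstFiltration Z hZ.measurable H)
    (X := fun t : ℝ≥0 => x t) (fun t => hZ.aestronglyMeasurable_of_mem H (hxp t t.coe_nonneg))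
    (fun t => (hJx t).symm) hJc
  have hIx : ∀ t : ℝ≥0, I t =ᵐ[P] x t := fun t =>
    EventuallyEq.trans (hIJ.mono fun ω h => h t) (hJx t)
  have hIc : ∀ᵐ ω ∂P, Continuous (I · ω) := by
    filter_upwards [hIJ, hJc] with ω h1 h2
    have : (I · ω) = (J · ω) := funext h1
    rwa [this]
  refine ⟨V, fun t => ?_, hVa, ?_, ?_, I, ?_, ?_⟩
  · have hMt := hZ.doMartingale_ae_eq H (hmem t t.coe_nonneg)
      fun r hr hrt => hMz r t hr hrt
    filter_upwards [hVY, hY t, hMt,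
      Lp.coeFn_smul (k * (t : ℝ) ^ (2 * (H : ℝ) - 1)) (M t)] with ω h1 h2 h3 h4
    rw [h1 t, h2, h4, Pi.smul_apply, doProcess, h3, Psi, smul_eq_mul]
  · filter_upwards [hVY] with ω hω
    have : (V · ω) = (Y · ω) := funext hω
    rw [this]
    exact hYc ω
  · filter_upwards [hVY, hdrift] with ω hω hd t
    obtain ⟨n, hn⟩ := exists_nat_ge t
    have h1 : IntervalIntegrable (fun s : ℝ => s⁻¹ * Y s.toNNReal ω) volume 0 t :=
      (hd n).mono_set (by
        rw [Set.uIcc_of_le t.coe_nonneg, Set.uIcc_of_le n.cast_nonneg]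
        exact Set.Icc_subset_Icc_right (by exact_mod_cast hn))
    simpa only [hω, mul_assoc] using h1.const_mul (2 * (H : ℝ) - 1)
  -- The covariances of `x` with the Brownian curve, and its norm, are those of the Wiener integral
  -- of `C s^(H-1/2)`; this is where `C = c_Ψ √(c_M (2-2H))` comes from.
  · have hC : diffusionConst H = k * √(cM H * (2 - 2 * H)) := rfl
    have hsq : diffusionConst H ^ 2 = k ^ 2 * (cM H * (2 - 2 * H)) := by
      rw [hC, mul_pow, Real.sq_sqrt (mul_nonneg (cM_pos hH hH1).le (by linarith))]
    refine isItoIntegral_of_inner (w := IsPowerMartingaleCurve.brownianCurve H (cM H) M) (x := x)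
      (by rw [hC]; positivity) (by linarith) (fun u v hu hv => hM.inner_brownianCurve hu hv) hW
      (fun u t hu hut => ?_) (fun t ht => ?_) hIx hIa hIc
    · rw [real_inner_comm, hxdef]
      simp only
      rw [real_inner_smul_left, hM.inner_wienerPow_brownianCurve (hu.trans hut) hu,
        min_eq_right hut, hC, show (H : ℝ) - 1 / 2 + 1 = H + 1 / 2 by ring, mul_assoc]
    · rw [hxdef]
      simp only
      rw [norm_smul, mul_pow, hM.norm_sq_wienerPow ht, hsq, Real.norm_eq_abs, sq_abs,
        show 2 * ((H : ℝ) - 1 / 2) + 1 = 2 * H by ring]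
      ring
  · filter_upwards [hVY, hIJ, hY0] with ω hω hI h0 t
    rw [hω t, hω 0, h0, hI t, Pi.zero_apply, zero_add]
    simp only [hω, mul_assoc]
    rw [intervalIntegral.integral_const_mul, hJdef]
    ring

end IsFractionalGaussianField

end DobricOjeda

theorem mainTheorem1 {Ω : Type*} {mΩ : MeasurableSpace Ω} (P : Measure Ω)
    [IsProbabilityMeasure P] (Z : DobricOjeda.Hurst × ℝ≥0 → Ω → ℝ)
    (hZ : DobricOjeda.IsFractionalGaussianField Z P) (H : DobricOjeda.Hurst) :
    ∃ W : ℝ≥0 → Ω → ℝ,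
      DobricOjeda.IsBrownianMotionWrt
        (DobricOjeda.hurstFiltration Z hZ.measurable H) W P ∧
      ∃ V : ℝ≥0 → Ω → ℝ,
        (∀ t, V t =ᵐ[P] DobricOjeda.doProcess Z hZ.measurable P H t) ∧
        DobricOjeda.IsItoDiffusion (DobricOjeda.hurstFiltration Z hZ.measurable H) W
          (fun t _ => DobricOjeda.diffusionConst H * t ^ ((H : ℝ) - 1 / 2))
          (fun t x => (2 * (H : ℝ) - 1) * t⁻¹ * x) V P := by
  obtain ⟨M, hM, hmem, hMz⟩ := hZ.exists_martingaleCurve H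
  obtain ⟨W, hWB, hW⟩ := hZ.exists_isBrownianMotionWrt H hM hmem hMz
  exact ⟨W, hWB, hZ.exists_isItoDiffusion H hM hmem hMz hW⟩
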